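/- Let $\mathcal P$ be a finite set of points in the Euclidean plane in general position (no three points collinear, no four points cocircular). A \emph{triangulation} of $\mathcal P$ is a subdivision of the convex hull of $\mathcal P$ into triangles that meet face to face and whose set of vertices is exactly $\mathcal P$. For an integer $k\ge 0$, a triangle with vertices in $\mathcal P$ is \emph{order-$k$ Delaunay} if at most $k$ points of $\mathcal P$ lie strictly inside its circumcircle; a triangulation of $\mathcal P$ is \emph{order-$k$ Delaunay} if all of its triangles are order-$k$ Delaunay; and an edge $\overline{uv}$ with $u,v\in\mathcal P$, $u\ne v$, is \emph{useful-$k$} if some order-$k$ Delaunay triangulation of $\mathcal P$ contains it. (Thus order-$k$ implies order-$k'$ for every $k'>k$.) Let $k>1$ be an integer and let $e_k$ be the number of useful-$k$ edges of $\mathcal P$ that are not useful-$i$ for any $i<k$. Then $\mathcal P$ has at least $$2^{e_k/C_k}-1,\qquad C_k=(4k+1)(2k+1)^2+1,$$ triangulations that are order-$k$ Delaunay and not order-$i$ Delaunay for any $i<k$. (The number of such triangulations is finite.) -/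

import Mathlib

open scoped Finset

noncomputable section

namespace HigherOrderDelaunay

/-- The Euclidean plane. -/
abbrev Plane : Type := EuclideanSpace ℝ (Fin 2)

/-- A finite planar point set is in general position if no three of its points are collinear
and no four of its points are cocircular. -/
def GeneralPosition (P : Finset Plane) : Prop :=
  (∀ t ⊆ P, #t = 3 → ¬ Collinear ℝ (t : Set Plane)) ∧
    ∀ t ⊆ P, #t = 4 → ¬ EuclideanGeometry.Cospherical (t : Set Plane)

/-- A triangulation of `P`: a (geometric) simplicial complex in the plane whose vertices are
exactly the points of `P` and whose simplices cover the convex hull of `P`. Its edges and triangles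
are its faces with two, respectively three, vertices. -/
def IsTriangulation (P : Finset Plane) (K : Geometry.SimplicialComplex ℝ Plane) : Prop :=
  K.vertices = (P : Set Plane) ∧ K.space = convexHull ℝ (P : Set Plane)

open scoped Classical in
/-- The number of points of `P` in the interior of a circle. -/
def pointsInside (P : Finset Plane) (C : EuclideanGeometry.Sphere Plane) : ℕ :=
  #{p ∈ P | dist p C.center < C.radius}

/-- The triangle with vertex set `t` is order-`k` Delaunay in `P`: its circumcircle has at most `k`
points of `P` inside. (Three non-collinear points lie on exactly one circle, so `C` below is the
circumcircle.) -/
def IsOrderTriangle (P : Finset Plane) (k : ℕ) (t : Finset Plane) : Prop :=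
  ∃ C : EuclideanGeometry.Sphere Plane, (∀ p ∈ t, p ∈ C) ∧ pointsInside P C ≤ k

/-- `K` is an order-`k` Delaunay triangulation of `P`. -/
def IsOrderTriangulation (P : Finset Plane) (k : ℕ) (K : Geometry.SimplicialComplex ℝ Plane) :
    Prop :=
  IsTriangulation P K ∧ ∀ t ∈ K.faces, #t = 3 → IsOrderTriangle P k t

/-- The edge with endpoint set `e` is useful-`k`: some order-`k` Delaunay triangulation of `P`
contains it. -/
def IsUsefulEdge (P : Finset Plane) (k : ℕ) (e : Finset Plane) : Prop :=
  #e = 2 ∧ ∃ K, IsOrderTriangulation P k K ∧ e ∈ K.faces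

open scoped Classical in
/-- The edges, as pairs of points of `P`, that are useful-`k` but not useful-`i` for any
`i < k`. -/
def exactUsefulEdges (P : Finset Plane) (k : ℕ) : Finset (Finset Plane) :=
  {e ∈ P.powersetCard 2 | IsUsefulEdge P k e ∧ ∀ i < k, ¬ IsUsefulEdge P i e}

/-- The triangulations of `P` that are order-`k` Delaunay but not order-`i` Delaunay for any
`i < k`. -/
def exactOrderTriangulations (P : Finset Plane) (k : ℕ) :
    Set (Geometry.SimplicialComplex ℝ Plane) :=
  {K | IsOrderTriangulation P k K ∧ ∀ i < k, ¬ IsOrderTriangulation P i K}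

end HigherOrderDelaunay

end

noncomputable section

namespace HigherOrderDelaunay

/-! ### Affine functions, discs, sides of lines -/

/-! Two edges conflict when both meet the interior of one Delaunay triangle (`Conflict`). The
Delaunay triangulation constrained to contain `e` consists of the triangles `t` not crossed by `e`
such that every point of `P` inside the circumcircle of `t` is hidden by `e` from all interior
points of `t` (`Cdt`). Its new triangles overlap only Delaunay triangles crossed by `e`
(`crossed_of_overlap`), so for a conflict-free set `S` the retriangulated regions have disjoint
interiors and the local changes can be glued (`multiCdt`, `exists_multiCdt`).

Order is controlled by `exists_side_disc`: an edge `u v` of an order-`k` triangulation, with some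
point of `P` on its left, carries a disc through `u` and `v` with at most `k` points of `P` inside,
none of them on the left. Comparing circles, whose power functions differ by affine functions, then
bounds the order of every triangle of `Cdt P e` (`card_circ_le_of_mem_Cdt`).

Let `I` be a conflict-free set of exact useful-`k` edges. For nonempty `S ⊆ I` the glued
triangulation has order `k` and contains an exact edge, hence has no smaller order. It contains
every edge of `S` and no other edge of `I`, so it determines `S`. This yields `2 ^ #I - 1`
triangulations (`two_pow_le_ncard`). A maximal `I` is large because each edge has few conflicts
(`card_conflict_le`, `exists_independent`).

Two counts bound the conflicts. Ordered along a useful edge, the crossed Delaunay edges have on each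
side at most `k` endpoints, which form a sequence without the pattern `a b a b`; hence there are at
most `4 * k - 3` of them (`card_crossEdges_le`). Conversely, an endpoint of a useful edge crossing a
Delaunay edge `a b` spans with `a b` a circle with at most `2 * k - 2` points on its own side, which
leaves `2 * k - 1` candidates per side (`mem_cand_of_crossAt`, `card_cand_le`). -/

/-- A real function on the plane which is affine. -/
def IsAffine (f : Plane → ℝ) : Prop := ∃ l : Plane →ₗ[ℝ] ℝ, ∃ c : ℝ, ∀ x, f x = l x + c

/-- The power function of a circle: the squared norm plus an affine function. -/
def IsDisc (D : Plane → ℝ) : Prop := IsAffine fun x => D x - ‖x‖ ^ 2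

theorem IsAffine.combo {f : Plane → ℝ} (hf : IsAffine f) {a b : ℝ} (h : a + b = 1) (x y : Plane) :
    f (a • x + b • y) = a * f x + b * f y := by
  obtain ⟨l, c, hl⟩ := hf
  obtain rfl : b = 1 - a := by linarith
  simp only [hl, map_add, map_smul, smul_eq_mul]
  ring

theorem IsAffine.sum {f : Plane → ℝ} (hf : IsAffine f) {ι : Type*} (t : Finset ι) (w : ι → ℝ)
    (g : ι → Plane) (h : ∑ p ∈ t, w p = 1) : f (∑ p ∈ t, w p • g p) = ∑ p ∈ t, w p * f (g p) := by
  obtain ⟨l, c, hl⟩ := hf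
  simp only [hl, map_sum, map_smul, smul_eq_mul, mul_add, Finset.sum_add_distrib,
    ← Finset.sum_mul, h, one_mul]

theorem IsAffine.sub {f g : Plane → ℝ} (hf : IsAffine f) (hg : IsAffine g) :
    IsAffine fun x => f x - g x := by
  obtain ⟨l, c, hl⟩ := hf
  obtain ⟨m, d, hm⟩ := hg
  exact ⟨l - m, c - d, fun x => by simp [hl, hm]; ring⟩

theorem IsAffine.add {f g : Plane → ℝ} (hf : IsAffine f) (hg : IsAffine g) :
    IsAffine fun x => f x + g x := by
  obtain ⟨l, c, hl⟩ := hf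
  obtain ⟨m, d, hm⟩ := hg
  exact ⟨l + m, c + d, fun x => by simp [hl, hm]; ring⟩

theorem IsAffine.const_mul {f : Plane → ℝ} (hf : IsAffine f) (a : ℝ) :
    IsAffine fun x => a * f x := by
  obtain ⟨l, c, hl⟩ := hf
  exact ⟨a • l, a * c, fun x => by simp [hl]; ring⟩

theorem IsAffine.neg {f : Plane → ℝ} (hf : IsAffine f) : IsAffine fun x => -f x := by
  simpa using hf.const_mul (-1)

theorem IsAffine.const (a : ℝ) : IsAffine fun _ => a := ⟨0, a, fun x => by simp⟩

theorem IsAffine.finset_sum {ι : Type*} (t : Finset ι) {f : ι → Plane → ℝ}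
    (hf : ∀ i, IsAffine (f i)) : IsAffine fun x => ∑ i ∈ t, f i x := by
  classical
  induction t using Finset.induction_on with
  | empty => simpa using IsAffine.const 0
  | insert i s hi ih => simpa [Finset.sum_insert hi] using (hf i).add ih

theorem IsAffine.continuous {f : Plane → ℝ} (hf : IsAffine f) : Continuous f := by
  obtain ⟨l, c, hl⟩ := hf
  rw [show f = fun x => l x + c from funext hl]
  exact (l.continuous_of_finiteDimensional).add continuous_const

/-- All discs share the quadratic part, so comparing two of them is a matter of the sign of an
affine function. The disc comparisons below rest on this. -/
theorem IsDisc.sub {D E : Plane → ℝ} (hD : IsDisc D) (hE : IsDisc E) :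
    IsAffine fun x => D x - E x := by
  have := IsAffine.sub hD hE
  simpa using this

theorem IsDisc.add_affine {D f : Plane → ℝ} (hD : IsDisc D) (hf : IsAffine f) :
    IsDisc fun x => D x + f x := by
  have := IsAffine.add hD hf
  unfold IsDisc
  convert this using 2
  ring

/-- The defect term `a * b * ‖x - y‖ ^ 2` is what makes discs strictly convex. -/
theorem normSq_combo {a b : ℝ} (h : a + b = 1) (x y : Plane) :
    ‖a • x + b • y‖ ^ 2 = a * ‖x‖ ^ 2 + b * ‖y‖ ^ 2 - a * b * ‖x - y‖ ^ 2 := by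
  obtain rfl : b = 1 - a := by linarith
  simp only [EuclideanSpace.norm_sq_eq, Fin.sum_univ_two, Real.norm_eq_abs, sq_abs,
    PiLp.add_apply, PiLp.smul_apply, PiLp.sub_apply, smul_eq_mul]
  ring

theorem IsDisc.combo {D : Plane → ℝ} (hD : IsDisc D) {a b : ℝ} (h : a + b = 1) (x y : Plane) :
    D (a • x + b • y) = a * D x + b * D y - a * b * ‖x - y‖ ^ 2 := by
  have := IsAffine.combo hD h x y
  rw [normSq_combo h] at this
  linarith

/-- The open segment between two distinct points of a closed disc lies in the open disc. -/
theorem IsDisc.neg_of_openSegment {D : Plane → ℝ} (hD : IsDisc D) {x y z : Plane}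
    (hx : D x ≤ 0) (hy : D y ≤ 0) (hxy : x ≠ y) (hz : z ∈ openSegment ℝ x y) : D z < 0 := by
  obtain ⟨a, b, ha, hb, hab, rfl⟩ := hz
  rw [hD.combo hab]
  have : 0 < ‖x - y‖ ^ 2 := by
    have := norm_pos_iff.2 (sub_ne_zero.2 hxy)
    positivity
  have h2 : 0 < a * b * ‖x - y‖ ^ 2 := by positivity
  nlinarith

theorem IsDisc.convex {D : Plane → ℝ} (hD : IsDisc D) : Convex ℝ {x | D x < 0} := by
  intro x hx y hy a b ha hb hab
  simp only [Set.mem_ofPred_eq] at *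
  rw [hD.combo hab]
  have h2 : 0 ≤ a * b * ‖x - y‖ ^ 2 := by positivity
  rcases eq_or_lt_of_le ha with h | h
  · have : b = 1 := by linarith
    subst this; nlinarith
  · nlinarith [mul_nonneg hb (neg_nonneg.2 hy.le), mul_pos h (neg_pos.2 hx)]

theorem IsAffine.convex_le {f : Plane → ℝ} (hf : IsAffine f) (c : ℝ) : Convex ℝ {x | f x ≤ c} := by
  intro x hx y hy a b ha hb hab
  simp only [Set.mem_ofPred_eq] at *
  rw [hf.combo hab]
  obtain rfl : b = 1 - a := by linarith
  nlinarith [mul_le_mul_of_nonneg_left hx ha, mul_le_mul_of_nonneg_left hy hb]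

theorem IsAffine.convex_lt {f : Plane → ℝ} (hf : IsAffine f) (c : ℝ) : Convex ℝ {x | f x < c} := by
  intro x hx y hy a b ha hb hab
  simp only [Set.mem_ofPred_eq] at *
  rw [hf.combo hab]
  obtain rfl : b = 1 - a := by linarith
  rcases eq_or_lt_of_le ha with h | h
  · subst h; simpa using hy
  · nlinarith [mul_lt_mul_of_pos_left hx h, mul_le_mul_of_nonneg_left hy.le hb]

theorem IsAffine.convex_ge {f : Plane → ℝ} (hf : IsAffine f) (c : ℝ) : Convex ℝ {x | c ≤ f x} := by
  simpa using hf.neg.convex_le (-c)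

theorem IsAffine.convex_gt {f : Plane → ℝ} (hf : IsAffine f) (c : ℝ) : Convex ℝ {x | c < f x} := by
  simpa using hf.neg.convex_lt (-c)

theorem IsAffine.exists_zero {f : Plane → ℝ} (hf : IsAffine f) {x y : Plane} (hx : 0 < f x)
    (hy : f y < 0) : ∃ z ∈ openSegment ℝ x y, f z = 0 := by
  have hd : 0 < f x - f y := by linarith
  have hab : -f y / (f x - f y) + f x / (f x - f y) = 1 := by field_simp; ring
  refine ⟨_, ⟨-f y / (f x - f y), f x / (f x - f y), by apply div_pos <;> linarith, by positivity,
    hab, rfl⟩, ?_⟩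
  rw [hf.combo hab]
  field_simp
  ring

/-- Along a segment, an affine function with `f x ≤ 0 ≤ f z` is nonnegative beyond `z`. -/
theorem IsAffine.nonneg_beyond {f : Plane → ℝ} (hf : IsAffine f) {x y z : Plane}
    (hz : z ∈ segment ℝ x y) (hzx : z ≠ x) (hx : f x ≤ 0) (h : 0 ≤ f z) : 0 ≤ f y := by
  obtain ⟨a, b, ha, hb, hab, rfl⟩ := hz
  have hb' : 0 < b := by
    rcases eq_or_lt_of_le hb with h0 | h0
    · exfalso; apply hzx
      have : a = 1 := by linarith
      simp [this, ← h0]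
    · exact h0
  rw [hf.combo hab] at h
  by_contra hy
  push Not at hy
  nlinarith [mul_nonneg ha (neg_nonneg.2 hx), mul_pos hb' (neg_pos.2 hy)]

/-- Twice the signed area of the triangle `a b p`. -/
def side (a b p : Plane) : ℝ := (b 0 - a 0) * (p 1 - a 1) - (b 1 - a 1) * (p 0 - a 0)

theorem side_affine (a b : Plane) : IsAffine (side a b) :=
  ⟨(b 0 - a 0) • (EuclideanSpace.proj (1 : Fin 2) : Plane →L[ℝ] ℝ).toLinearMap -
    (b 1 - a 1) • (EuclideanSpace.proj (0 : Fin 2) : Plane →L[ℝ] ℝ).toLinearMap,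
    - (b 0 - a 0) * a 1 + (b 1 - a 1) * a 0, fun x => by simp [side]; ring⟩

theorem side_swap (a b p : Plane) : side b a p = -side a b p := by simp only [side]; ring
theorem side_rot (a b p : Plane) : side b p a = side a b p := by simp only [side]; ring
@[simp] theorem side_left (a b : Plane) : side a b a = 0 := by simp only [side]; ring
@[simp] theorem side_right (a b : Plane) : side a b b = 0 := by simp only [side]; ring

theorem Plane.ext {x y : Plane} (h0 : x 0 = y 0) (h1 : x 1 = y 1) : x = y := by
  ext i; fin_cases i <;> assumption

theorem exists_of_side_eq_zero {a b p : Plane} (hab : a ≠ b) (h : side a b p = 0) :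
    ∃ s : ℝ, p = a + s • (b - a) := by
  by_cases h0 : b 0 - a 0 = 0
  · have h1 : b 1 - a 1 ≠ 0 := fun h1 => hab (Plane.ext (by linarith) (by linarith))
    refine ⟨(p 1 - a 1) / (b 1 - a 1), Plane.ext ?_ ?_⟩
    · simp only [side, h0, zero_mul, zero_sub, neg_eq_zero, mul_eq_zero, h1, false_or] at h
      simp [h0]; linarith
    · simp; field_simp; ring
  · refine ⟨(p 0 - a 0) / (b 0 - a 0), Plane.ext ?_ ?_⟩
    · simp; field_simp; ring
    · simp only [side] at h
      simp; field_simp; linarith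

theorem collinear_of_side_eq_zero {a b p : Plane} (h : side a b p = 0) :
    Collinear ℝ ({a, b, p} : Set Plane) := by
  by_cases hab : a = b
  · subst hab; simpa using collinear_pair ℝ a p
  obtain ⟨s, rfl⟩ := exists_of_side_eq_zero hab h
  rw [collinear_iff_of_mem (p₀ := a) (by simp)]
  refine ⟨b - a, ?_⟩
  rintro q (rfl | rfl | rfl)
  · exact ⟨0, by simp⟩
  · exact ⟨1, by simp⟩
  · exact ⟨s, by simp [add_comm]⟩

theorem GeneralPosition.side_ne {P : Finset Plane} (hP : GeneralPosition P) {a b c : Plane}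
    (ha : a ∈ P) (hb : b ∈ P) (hc : c ∈ P) (hab : a ≠ b) (hac : a ≠ c) (hbc : b ≠ c) :
    side a b c ≠ 0 := by
  classical
  intro h
  refine hP.1 {a, b, c} ?_ (Finset.card_eq_three.2 ⟨a, b, c, hab, hac, hbc, rfl⟩) ?_
  · intro x hx
    simp only [Finset.mem_insert, Finset.mem_singleton] at hx
    rcases hx with rfl | rfl | rfl <;> assumption
  · simpa using collinear_of_side_eq_zero h

theorem segment_side {u v z : Plane} (hz : z ∈ segment ℝ u v) : side u v z = 0 := by
  obtain ⟨a, b, ha, hb, hab, rfl⟩ := hz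
  rw [(side_affine u v).combo hab]; simp

theorem openSegment_side {u v z : Plane} (hz : z ∈ openSegment ℝ u v) : side u v z = 0 :=
  segment_side (openSegment_subset_segment _ _ _ hz)

theorem GeneralPosition.notMem_openSegment {P : Finset Plane} (hP : GeneralPosition P)
    {u v p : Plane} (hu : u ∈ P) (hv : v ∈ P) (hp : p ∈ P) (huv : u ≠ v) :
    p ∉ openSegment ℝ u v := by
  intro h
  by_cases h1 : u = p
  · subst h1
    exact huv (left_mem_openSegment_iff.1 h)
  by_cases h2 : v = p
  · subst h2
    exact huv (right_mem_openSegment_iff.1 h)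
  exact hP.side_ne hu hv hp huv h1 h2 (openSegment_side h)

/-- A convex set avoiding `u` and `v` that meets the open segment meets the line only there. -/
theorem mem_openSegment_of_convex {C : Set Plane} (hC : Convex ℝ C) {u v y z : Plane}
    (huv : u ≠ v) (hy : y ∈ C) (hyo : y ∈ openSegment ℝ u v) (hu : u ∉ C) (hv : v ∉ C)
    (hz : z ∈ C) (hs : side u v z = 0) : z ∈ openSegment ℝ u v := by
  obtain ⟨s, rfl⟩ := exists_of_side_eq_zero huv hs
  obtain ⟨a, b, ha, hb, hab, rfl⟩ := hyo
  obtain rfl : a = 1 - b := by linarith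
  by_cases h0 : s ≤ 0
  · exfalso; apply hu
    have := hC hy hz (a := -s / (b - s)) (b := b / (b - s))
      (div_nonneg (by linarith) (by linarith)) (div_nonneg (by linarith) (by linarith))
      (by rw [← add_div, div_eq_one_iff_eq (by linarith)]; ring)
    convert this using 1
    have hd : b - s ≠ 0 := by linarith
    apply Plane.ext <;> simp <;> field_simp <;> ring
  by_cases h1 : 1 ≤ s
  · exfalso; apply hv
    have := hC hy hz (a := (s - 1) / (s - b)) (b := (1 - b) / (s - b))
      (div_nonneg (by linarith) (by linarith)) (div_nonneg (by linarith) (by linarith))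
      (by rw [← add_div, div_eq_one_iff_eq (by linarith)]; ring)
    convert this using 1
    have hd : s - b ≠ 0 := by linarith
    apply Plane.ext <;> simp <;> field_simp <;> ring
  · exact ⟨1 - s, s, by linarith, by linarith, by ring, by
      apply Plane.ext <;> simp <;> ring⟩

/-! ### Barycentric coordinates -/

/-- The coordinate of a vertex is the signed area spanned with the opposite edge, divided by the
area of the whole triangle. -/
theorem exists_bary {t : Finset Plane} (ht : #t = 3) (hc : ¬ Collinear ℝ (t : Set Plane)) :
    ∃ w : Plane → Plane → ℝ, (∀ p, IsAffine (w p)) ∧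
      (∀ p ∈ t, w p p = 1) ∧ (∀ p ∈ t, ∀ q ∈ t, p ≠ q → w p q = 0) ∧
      (∀ x, ∑ p ∈ t, w p x = 1) ∧ ∀ x, ∑ p ∈ t, w p x • p = x := by
  classical
  obtain ⟨a, b, c, hab, hac, hbc, rfl⟩ := Finset.card_eq_three.1 ht
  have hd : side a b c ≠ 0 := fun h => hc (by simpa using collinear_of_side_eq_zero h)
  have h1 : side b c a = side a b c := side_rot a b c
  have h2 : side c a b = side a b c := (side_rot b c a).trans h1
  refine ⟨fun p x => if p = a then (side a b c)⁻¹ * side b c x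
    else if p = b then (side a b c)⁻¹ * side c a x else (side a b c)⁻¹ * side a b x,
    ?_, ?_, ?_, ?_, ?_⟩
  · intro p
    dsimp only
    split_ifs <;> exact (side_affine _ _).const_mul _
  · intro p hp
    simp only [Finset.mem_insert, Finset.mem_singleton] at hp
    rcases hp with rfl | rfl | rfl
    · simp [h1, hd]
    · simp [hab.symm, h2, hd]
    · simp [hac.symm, hbc.symm, hd]
  · intro p hp q hq hpq
    simp only [Finset.mem_insert, Finset.mem_singleton] at hp hq
    rcases hp with rfl | rfl | rfl <;> rcases hq with rfl | rfl | rfl <;>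
      simp_all [eq_comm]
  · intro x
    rw [Finset.sum_insert (by simp [hab, hac]), Finset.sum_pair hbc]
    simp only [if_true, hab.symm, hac.symm, hbc.symm, if_false]
    rw [← mul_add, ← mul_add, inv_mul_eq_one₀ hd]
    simp only [side]; ring
  · intro x
    rw [Finset.sum_insert (by simp [hab, hac]), Finset.sum_pair hbc]
    simp only [if_true, hab.symm, hac.symm, hbc.symm, if_false]
    apply Plane.ext <;> simp only [PiLp.add_apply, PiLp.smul_apply, smul_eq_mul] <;>
      field_simp <;> simp only [side] <;> ring

theorem IsDisc.exists_center {D : Plane → ℝ} (hD : IsDisc D) :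
    ∃ (o : Plane) (R : ℝ), ∀ x, D x = dist x o ^ 2 - R := by
  obtain ⟨l, c, hl⟩ := hD
  have h0 : ∀ x : Plane, l x = x 0 * l (EuclideanSpace.single 0 1) +
      x 1 * l (EuclideanSpace.single 1 1) := by
    intro x
    conv_lhs => rw [show x = x 0 • (EuclideanSpace.single 0 1 : Plane) +
      x 1 • (EuclideanSpace.single 1 1 : Plane) from Plane.ext (by simp) (by simp)]
    simp
  refine ⟨!₂[-l (EuclideanSpace.single 0 1) / 2, -l (EuclideanSpace.single 1 1) / 2],
    (l (EuclideanSpace.single 0 1) / 2) ^ 2 + (l (EuclideanSpace.single 1 1) / 2) ^ 2 - c, ?_⟩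
  intro x
  have := hl x
  rw [h0] at this
  rw [dist_eq_norm]
  simp only [EuclideanSpace.norm_sq_eq, Fin.sum_univ_two, Real.norm_eq_abs, sq_abs,
    PiLp.sub_apply] at this ⊢
  simp
  linarith

theorem isDisc_dist (o : Plane) (R : ℝ) : IsDisc fun x => dist x o ^ 2 - R := by
  refine ⟨(-2 * o 0) • (EuclideanSpace.proj (0 : Fin 2) : Plane →L[ℝ] ℝ).toLinearMap +
    (-2 * o 1) • (EuclideanSpace.proj (1 : Fin 2) : Plane →L[ℝ] ℝ).toLinearMap,
    o 0 ^ 2 + o 1 ^ 2 - R, ?_⟩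
  intro x
  simp only [dist_eq_norm, EuclideanSpace.norm_sq_eq, Fin.sum_univ_two, Real.norm_eq_abs, sq_abs,
    PiLp.sub_apply]
  simp
  ring

theorem GeneralPosition.card_circle_le {P : Finset Plane} (hP : GeneralPosition P)
    {D : Plane → ℝ} (hD : IsDisc D) {t : Finset Plane} (ht : t ⊆ P) (h : ∀ p ∈ t, D p = 0) :
    #t ≤ 3 := by
  by_contra h4
  obtain ⟨s, hs, hs4⟩ := Finset.exists_subset_card_eq (show 4 ≤ #t by omega)
  obtain ⟨o, R, hR⟩ := hD.exists_center
  refine hP.2 s (hs.trans ht) hs4 ⟨o, √R, fun p hp => ?_⟩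
  have h1 : dist p o ^ 2 = R := by linarith [h p (hs hp), hR p]
  rw [← h1, Real.sqrt_sq dist_nonneg]

/-- Four points of `P` on a circle are not distinct. -/
theorem GeneralPosition.mem_of_circle {P : Finset Plane} (hP : GeneralPosition P)
    {D : Plane → ℝ} (hD : IsDisc D) {t : Finset Plane} (ht : t ⊆ P) (h3 : #t = 3)
    (h : ∀ p ∈ t, D p = 0) {q : Plane} (hq : q ∈ P) (h0 : D q = 0) : q ∈ t := by
  classical
  by_contra hqt
  have := hP.card_circle_le hD (t := insert q t) (Finset.insert_subset hq ht)
    (by simpa [h0] using h)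
  rw [Finset.card_insert_of_notMem hqt] at this
  omega

/-- A nondegenerate triple of points. -/
def NonDeg (t : Finset Plane) : Prop := #t = 3 ∧ ¬ Collinear ℝ (t : Set Plane)

theorem GeneralPosition.nonDeg {P : Finset Plane} (hP : GeneralPosition P) {t : Finset Plane}
    (ht : t ⊆ P) (h3 : #t = 3) : NonDeg t := ⟨h3, hP.1 t ht h3⟩

open scoped Classical in
/-- Barycentric coordinates with respect to a triangle. -/
def bc (t : Finset Plane) : Plane → Plane → ℝ :=
  if h : NonDeg t then (exists_bary h.1 h.2).choose else fun _ _ => 0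

theorem bc_spec {t : Finset Plane} (h : NonDeg t) : (∀ p, IsAffine (bc t p)) ∧
      (∀ p ∈ t, bc t p p = 1) ∧ (∀ p ∈ t, ∀ q ∈ t, p ≠ q → bc t p q = 0) ∧
      (∀ x, ∑ p ∈ t, bc t p x = 1) ∧ ∀ x, ∑ p ∈ t, bc t p x • p = x := by
  have := (exists_bary h.1 h.2).choose_spec
  rwa [bc, dif_pos h]

section NonDeg
variable {t : Finset Plane} (h : NonDeg t)
include h

theorem NonDeg.eval {f : Plane → ℝ} (hf : IsAffine f) (x : Plane) :
    f x = ∑ p ∈ t, bc t p x * f p := by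
  conv_lhs => rw [← (bc_spec h).2.2.2.2 x]
  exact hf.sum t _ _ ((bc_spec h).2.2.2.1 x)

end NonDeg

/-- The open triangle. -/
def otri (t : Finset Plane) : Set Plane := {x | ∀ p ∈ t, 0 < bc t p x}

theorem isOpen_otri {t : Finset Plane} (h : NonDeg t) : IsOpen (otri t) := by
  have : otri t = ⋂ p ∈ t, {x | 0 < bc t p x} := by ext; simp [otri]
  rw [this]
  exact isOpen_biInter_finset fun p _ => isOpen_lt continuous_const ((bc_spec h).1 p).continuous

theorem mem_convexHull_iff_bc {t : Finset Plane} (h : NonDeg t) {x : Plane} :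
    x ∈ convexHull ℝ (t : Set Plane) ↔ ∀ p ∈ t, 0 ≤ bc t p x := by
  constructor
  · intro hx p hp
    refine convexHull_min ?_ (((bc_spec h).1 p).convex_ge 0) hx
    intro q hq
    by_cases hpq : p = q
    · subst hpq; simp [(bc_spec h).2.1 p hp]
    · simp [(bc_spec h).2.2.1 p hp q hq hpq]
  · intro hx
    exact Finset.mem_convexHull'.2 ⟨fun p => bc t p x, hx, (bc_spec h).2.2.2.1 x,
      (bc_spec h).2.2.2.2 x⟩

theorem otri_subset {t : Finset Plane} (h : NonDeg t) :
    otri t ⊆ convexHull ℝ (t : Set Plane) :=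
  fun _ hx => (mem_convexHull_iff_bc h).2 fun p hp => (hx p hp).le

theorem mem_otri_of_combo {t : Finset Plane} (h : NonDeg t) {x y : Plane} (hx : x ∈ otri t)
    (hy : y ∈ convexHull ℝ (t : Set Plane)) {a b : ℝ} (ha : 0 < a) (hb : 0 ≤ b) (hab : a + b = 1) :
    a • x + b • y ∈ otri t := by
  intro p hp
  rw [((bc_spec h).1 p).combo hab]
  have h1 := mul_pos ha (hx p hp)
  have h2 := mul_nonneg hb ((mem_convexHull_iff_bc h).1 hy p hp)
  linarith

theorem convex_otri {t : Finset Plane} (h : NonDeg t) : Convex ℝ (otri t) := by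
  intro x hx y hy a b ha hb hab
  rcases eq_or_lt_of_le ha with h0 | h0
  · obtain rfl : b = 1 := by linarith
    simpa [← h0] using hy
  · exact mem_otri_of_combo h hx (otri_subset h hy) h0 hb hab

theorem otri_nonempty {t : Finset Plane} (h : NonDeg t) : (otri t).Nonempty := by
  refine ⟨∑ p ∈ t, (1 / 3 : ℝ) • p, fun p hp => ?_⟩
  rw [((bc_spec h).1 p).sum t (fun _ => 1 / 3) (fun q => q) (by simp [h.1])]
  rw [Finset.sum_eq_single p]
  · simp [(bc_spec h).2.1 p hp]
  · intro q hq hqp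
    simp [(bc_spec h).2.2.1 p hp q hq hqp.symm]
  · exact fun h => absurd hp h

theorem convexHull_subset_closure_otri {t : Finset Plane} (h : NonDeg t) :
    convexHull ℝ (t : Set Plane) ⊆ closure (otri t) := by
  intro y hy
  obtain ⟨x, hx⟩ := otri_nonempty h
  have hc : Filter.Tendsto (fun s : ℝ => s • x + (1 - s) • y) (nhdsWithin 0 (Set.Ioi 0))
      (nhds y) := by
    have : Continuous fun s : ℝ => s • x + (1 - s) • y := by fun_prop
    have := this.tendsto 0
    simp only [zero_smul, sub_zero, one_smul, zero_add] at this
    exact this.mono_left nhdsWithin_le_nhds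
  refine mem_closure_of_tendsto hc ?_
  filter_upwards [Ioo_mem_nhdsGT (show (0 : ℝ) < 1 by norm_num)] with s hs
  exact mem_otri_of_combo h hx hy hs.1 (by linarith [hs.2]) (by ring)

theorem NonDeg.nonpos {t : Finset Plane} (h : NonDeg t) {f : Plane → ℝ} (hf : IsAffine f)
    (hp : ∀ p ∈ t, f p ≤ 0) {x : Plane} (hx : x ∈ convexHull ℝ (t : Set Plane)) : f x ≤ 0 := by
  rw [h.eval hf]
  exact Finset.sum_nonpos fun p hpt =>
    mul_nonpos_of_nonneg_of_nonpos ((mem_convexHull_iff_bc h).1 hx p hpt) (hp p hpt)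

theorem NonDeg.eq_zero {t : Finset Plane} (h : NonDeg t) {f : Plane → ℝ} (hf : IsAffine f)
    (hp : ∀ p ∈ t, f p ≤ 0) {x : Plane} (hx : x ∈ otri t) (h0 : 0 ≤ f x) : ∀ p ∈ t, f p = 0 := by
  have h1 : f x = 0 := le_antisymm (h.nonpos hf hp (otri_subset h hx)) h0
  rw [h.eval hf] at h1
  intro p hpt
  have := (Finset.sum_eq_zero_iff_of_nonpos fun p hpt =>
    mul_nonpos_of_nonneg_of_nonpos (hx p hpt).le (hp p hpt)).1 h1 p hpt
  exact (mul_eq_zero.1 this).resolve_left (hx p hpt).ne'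

/-! ### Circumcircles -/

/-- The power function of the circumcircle of a triangle. -/
def circ (t : Finset Plane) (x : Plane) : ℝ := ‖x‖ ^ 2 - ∑ p ∈ t, ‖p‖ ^ 2 * bc t p x

theorem isDisc_circ {t : Finset Plane} (h : NonDeg t) : IsDisc (circ t) := by
  have := (IsAffine.finset_sum t (f := fun p x => ‖p‖ ^ 2 * bc t p x)
    fun p => ((bc_spec h).1 p).const_mul _).neg
  unfold IsDisc
  convert this using 2
  simp [circ]

theorem circ_eq_zero {t : Finset Plane} (h : NonDeg t) {q : Plane} (hq : q ∈ t) :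
    circ t q = 0 := by
  rw [circ, Finset.sum_eq_single q]
  · simp [(bc_spec h).2.1 q hq]
  · intro p hp hpq
    simp [(bc_spec h).2.2.1 p hp q hq hpq]
  · exact fun h => absurd hq h

theorem circ_unique {t : Finset Plane} (h : NonDeg t) {D : Plane → ℝ} (hD : IsDisc D)
    (h0 : ∀ p ∈ t, D p = 0) (x : Plane) : D x = circ t x := by
  have := h.eval (hD.sub (isDisc_circ h)) x
  rw [Finset.sum_eq_zero] at this
  · linarith
  · intro p hp
    simp [h0 p hp, circ_eq_zero h hp]

theorem exists_combo_mem {U : Set Plane} (hU : IsOpen U) {x : Plane} (hx : x ∈ U) (y : Plane) :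
    ∃ s : ℝ, 0 < s ∧ s < 1 ∧ (1 - s) • x + s • y ∈ U := by
  have hc : Continuous fun s : ℝ => (1 - s) • x + s • y := by fun_prop
  have h0 := hc.continuousAt.preimage_mem_nhds (x := 0) (hU.mem_nhds (by simpa using hx))
  have := Filter.inter_mem (nhdsWithin_le_nhds (s := Set.Ioi 0) h0)
    (Ioo_mem_nhdsGT (show (0 : ℝ) < 1 by norm_num))
  obtain ⟨s, h1, h2, h3⟩ := Filter.nonempty_of_mem this
  exact ⟨s, h2, h3, h1⟩

/-- The closed disc is convex and contains the vertices, which gives `≤`; strict convexity gives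
`<`. -/
theorem circ_neg_of_otri {t : Finset Plane} (h : NonDeg t) {x : Plane} (hx : x ∈ otri t) :
    circ t x < 0 := by
  obtain ⟨p, hp⟩ : t.Nonempty := Finset.card_pos.1 (by rw [h.1]; norm_num)
  have h2 : ∀ y ∈ convexHull ℝ (t : Set Plane), circ t y ≤ 0 := by
    intro y hy
    by_contra hc
    push Not at hc
    have hD := isDisc_circ h
    have : Convex ℝ {z | circ t z ≤ 0} := by
      intro z hz w hw a b ha hb hab
      simp only [Set.mem_ofPred_eq] at *
      rw [hD.combo hab]
      have : 0 ≤ a * b * ‖z - w‖ ^ 2 := by positivity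
      nlinarith [mul_nonneg ha (neg_nonneg.2 hz), mul_nonneg hb (neg_nonneg.2 hw)]
    exact absurd (convexHull_min (fun q hq => (circ_eq_zero h hq).le) this hy) (not_le.2 hc)
  have hxp : x ≠ p := by
    rintro rfl
    obtain ⟨q, hq, hqp⟩ := Finset.exists_mem_ne (by rw [h.1]; norm_num) x
    have := hx q hq
    rw [(bc_spec h).2.2.1 q hq x hp hqp] at this
    exact lt_irrefl _ this
  -- Pushing `x` slightly away from the vertex `p` stays in the triangle and exhibits `x` as
  -- strictly between `p` and the new point.
  obtain ⟨s, hs0, -, hz⟩ := exists_combo_mem (isOpen_otri h) hx ((2 : ℝ) • x - p)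
  set z := (1 - s) • x + s • ((2 : ℝ) • x - p) with hzdef
  have hs : 1 + s ≠ 0 := by positivity
  refine (isDisc_circ h).neg_of_openSegment (h2 z (otri_subset h hz)) (circ_eq_zero h hp).le ?_
    ⟨1 / (1 + s), s / (1 + s), by positivity, by positivity, by field_simp, ?_⟩
  · intro hzp
    have h0 : (1 + s) • (x - p) = 0 := by
      rw [← sub_eq_zero.2 hzp, hzdef]
      module
    exact hxp (sub_eq_zero.1 ((smul_eq_zero.1 h0).resolve_left hs))
  · apply Plane.ext <;> simp [hzdef] <;> field_simp <;> ring

/-! ### Generic points -/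

/-- A point on no line through two points of `P`. -/
def Generic (P : Finset Plane) (x : Plane) : Prop :=
  ∀ a ∈ P, ∀ b ∈ P, a ≠ b → side a b x ≠ 0

theorem exists_side_ne_zero {a b : Plane} (hab : a ≠ b) : ∃ y, side a b y ≠ 0 := by
  by_contra hc
  push Not at hc
  have h0 := hc (a + EuclideanSpace.single 0 1)
  have h1 := hc (a + EuclideanSpace.single 1 1)
  simp [side] at h0 h1
  exact hab (Plane.ext (by linarith) (by linarith))

/-- The lines are avoided one at a time: a small move leaves the new line, and being off the earlier
ones is an open condition. -/
theorem exists_generic (P : Finset Plane) {U : Set Plane} (hU : IsOpen U) (hne : U.Nonempty) :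
    ∃ x ∈ U, Generic P x := by
  classical
  have key : ∀ F : Finset (Plane × Plane), ∃ x ∈ U, ∀ c ∈ F, c.1 ≠ c.2 → side c.1 c.2 x ≠ 0 := by
    intro F
    induction F using Finset.induction_on with
    | empty => obtain ⟨x, hx⟩ := hne; exact ⟨x, hx, by simp⟩
    | insert c F _ ih =>
      obtain ⟨x, hx, hF⟩ := ih
      by_cases hc : c.1 = c.2
      · refine ⟨x, hx, fun d hd hne => ?_⟩
        rcases Finset.mem_insert.1 hd with rfl | hd
        · exact absurd hc hne
        · exact hF d hd hne
      by_cases h0 : side c.1 c.2 x = 0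
      · obtain ⟨y, hy⟩ := exists_side_ne_zero hc
        have hV : IsOpen (U ∩ ⋂ d ∈ F, {z | d.1 ≠ d.2 → side d.1 d.2 z ≠ 0}) := by
          refine hU.inter (isOpen_biInter_finset fun d _ => ?_)
          by_cases hd : d.1 = d.2
          · simp [hd]
          · simpa [hd] using isOpen_ne_fun (side_affine d.1 d.2).continuous continuous_const
        obtain ⟨s, hs0, hs1, hm⟩ := exists_combo_mem hV (x := x) ⟨hx, by simpa using hF⟩ y
        refine ⟨_, hm.1, fun d hd hne => ?_⟩
        rcases Finset.mem_insert.1 hd with rfl | hd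
        · rw [(side_affine _ _).combo (by ring), h0]
          simp [hs0.ne', hy]
        · have := Set.mem_iInter₂.1 hm.2 d hd
          exact this hne
      · refine ⟨x, hx, fun d hd hne => ?_⟩
        rcases Finset.mem_insert.1 hd with rfl | hd
        · exact h0
        · exact hF d hd hne
  obtain ⟨x, hx, h⟩ := key (P ×ˢ P)
  exact ⟨x, hx, fun a ha b hb hab => h (a, b) (by simp [ha, hb]) hab⟩

theorem Generic.notMem_convexHull {P : Finset Plane} (h2 : 2 ≤ #P) {x : Plane} (hx : Generic P x)
    {s : Finset Plane} (hs : s ⊆ P) (hc : #s ≤ 2) : x ∉ convexHull ℝ (s : Set Plane) := by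
  classical
  obtain ⟨r, hsr, hrP, hr⟩ := Finset.exists_subsuperset_card_eq hs hc h2
  obtain ⟨a, b, hab, rfl⟩ := Finset.card_eq_two.1 hr
  intro h
  have h' := convexHull_mono (𝕜 := ℝ) (Finset.coe_subset.2 hsr) h
  simp only [Finset.coe_insert, Finset.coe_singleton, convexHull_pair] at h'
  exact hx a (hrP (by simp)) b (hrP (by simp)) hab (segment_side h')

theorem mem_convexHull_erase [DecidableEq Plane] {t : Finset Plane} (h : NonDeg t) {x p : Plane}
    (hx : x ∈ convexHull ℝ (t : Set Plane)) (hp : p ∈ t) (h0 : bc t p x = 0) :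
    x ∈ convexHull ℝ ((t.erase p : Finset Plane) : Set Plane) := by
  refine Finset.mem_convexHull'.2 ⟨fun q => bc t q x, fun q hq =>
    (mem_convexHull_iff_bc h).1 hx q (Finset.mem_of_mem_erase hq), ?_, ?_⟩
  · have := (bc_spec h).2.2.2.1 x
    rwa [← Finset.add_sum_erase _ _ hp, h0, zero_add] at this
  · have := (bc_spec h).2.2.2.2 x
    rwa [← Finset.add_sum_erase _ _ hp, h0, zero_smul, zero_add] at this

theorem Generic.mem_otri {P : Finset Plane} (hP : GeneralPosition P) {x : Plane}
    (hx : Generic P x) {t : Finset Plane} (ht : t ⊆ P) (h3 : #t = 3)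
    (hxt : x ∈ convexHull ℝ (t : Set Plane)) : x ∈ otri t := by
  classical
  have h := hP.nonDeg ht h3
  intro p hp
  refine lt_of_le_of_ne ((mem_convexHull_iff_bc h).1 hxt p hp) fun h0 => ?_
  refine hx.notMem_convexHull (by have := Finset.card_le_card ht; omega) ((Finset.erase_subset p t).trans ht) ?_
    (mem_convexHull_erase h hxt hp h0.symm)
  rw [Finset.card_erase_of_mem hp, h3]

/-- Carathéodory's theorem gives at most three points, and genericity rules out fewer. -/
theorem Generic.exists_triple {P Q : Finset Plane} (hP : GeneralPosition P) (h2 : 2 ≤ #P)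
    (hQ : Q ⊆ P) {x : Plane} (hx : Generic P x) (hxQ : x ∈ convexHull ℝ (Q : Set Plane)) :
    ∃ t ⊆ Q, #t = 3 ∧ x ∈ otri t := by
  rw [convexHull_eq_union] at hxQ
  simp only [Set.mem_iUnion] at hxQ
  obtain ⟨t, htQ, hai, hxt⟩ := hxQ
  have htQ' : t ⊆ Q := by exact_mod_cast htQ
  have hle : #t ≤ 3 := by
    have h1 := hai.card_le_finrank_succ
    have h3 := Submodule.finrank_le (vectorSpan ℝ (Set.range ((↑) : t → Plane)))
    simp at h1 h3
    omega
  have h3 : #t = 3 := by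
    by_contra hne
    exact hx.notMem_convexHull h2 (htQ'.trans hQ) (by omega) hxt
  exact ⟨t, htQ', h3, hx.mem_otri hP (htQ'.trans hQ) h3 hxt⟩

/-- A simplex pivot: subtract a growing multiple of the coordinates of `p` from those of `x` until
the first one vanishes; that vertex is replaced by `p`. -/
theorem exchange [DecidableEq Plane] {t : Finset Plane} (h : NonDeg t) {x : Plane}
    (hx : x ∈ otri t) {p : Plane} (hp : p ∉ t) :
    ∃ a ∈ t, x ∈ convexHull ℝ ((insert p (t.erase a) : Finset Plane) : Set Plane) := by
  have hs := (bc_spec h).2.2.2.1 p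
  have hne : (t.filter fun a => 0 < bc t a p).Nonempty := by
    by_contra hc
    rw [Finset.not_nonempty_iff_eq_empty, Finset.filter_eq_empty_iff] at hc
    have : ∑ a ∈ t, bc t a p ≤ 0 := Finset.sum_nonpos fun a ha => not_lt.1 (hc ha)
    linarith
  obtain ⟨a, ha, hmin⟩ := Finset.exists_min_image _ (fun a => bc t a x / bc t a p) hne
  rw [Finset.mem_filter] at ha
  have hr : 0 ≤ bc t a x / bc t a p := (div_pos (hx a ha.1) ha.2).le
  set r := bc t a x / bc t a p with hrdef
  have hra : bc t a x - r * bc t a p = 0 := by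
    rw [hrdef, div_mul_cancel₀ _ ha.2.ne', sub_self]
  refine ⟨a, ha.1, ?_⟩
  have hpe : p ∉ t.erase a := fun hc => hp (Finset.mem_of_mem_erase hc)
  have hneq : ∀ q ∈ t.erase a, q ≠ p := fun q hq hqp => hpe (hqp ▸ hq)
  refine Finset.mem_convexHull'.2 ⟨fun q => if q = p then r else bc t q x - r * bc t q p,
    ?_, ?_, ?_⟩
  · intro q hq
    rcases Finset.mem_insert.1 hq with rfl | hq
    · simpa using hr
    · simp only [if_neg (hneq q hq)]
      have hqt := Finset.mem_of_mem_erase hq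
      rcases lt_or_ge 0 (bc t q p) with h0 | h0
      · have := hmin q (Finset.mem_filter.2 ⟨hqt, h0⟩)
        rw [le_div_iff₀ h0] at this
        linarith
      · nlinarith [hx q hqt, mul_nonneg hr (neg_nonneg.2 h0)]
  · rw [Finset.sum_insert hpe, if_pos rfl, Finset.sum_congr rfl fun q hq => if_neg (hneq q hq),
      ← zero_add (∑ q ∈ t.erase a, _), ← hra, Finset.add_sum_erase t (fun q => bc t q x - r * bc t q p) ha.1, Finset.sum_sub_distrib,
      ← Finset.mul_sum, hs, (bc_spec h).2.2.2.1 x]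
    ring
  · have e : ∀ q ∈ t.erase a, (if q = p then r else bc t q x - r * bc t q p) • q =
        (bc t q x - r * bc t q p) • q := fun q hq => by rw [if_neg (hneq q hq)]
    have e2 := Finset.add_sum_erase t (fun q => (bc t q x - r * bc t q p) • q) ha.1
    simp only [hra, zero_smul, zero_add] at e2
    simp only [Finset.sum_insert hpe, if_true]
    rw [Finset.sum_congr rfl e, e2]
    simp only [sub_smul, Finset.sum_sub_distrib, mul_smul, ← Finset.smul_sum,
      (bc_spec h).2.2.2.2]
    abel

/-- A generic point of the convex hull of `Q` lies in a Delaunay triangle of `Q`. -/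
theorem Generic.exists_delaunay {P Q : Finset Plane} (hP : GeneralPosition P) (h2 : 2 ≤ #P)
    (hQ : Q ⊆ P) {x : Plane} (hx : Generic P x) (hxQ : x ∈ convexHull ℝ (Q : Set Plane)) :
    ∃ t ⊆ Q, #t = 3 ∧ x ∈ otri t ∧ ∀ p ∈ Q, 0 ≤ circ t p := by
  classical
  have hne : ((Q.powersetCard 3).filter fun t => x ∈ otri t).Nonempty := by
    obtain ⟨t, h1, h2, h3⟩ := hx.exists_triple hP h2 hQ hxQ
    exact ⟨t, by simp [Finset.mem_powersetCard, h1, h2, h3]⟩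
  -- `circ t x` is `‖x‖ ^ 2` minus the height over `x` of the triangle lifted to the paraboloid, so
  -- maximising it selects the lowest lifted triangle. A point of `Q` inside its circle would give a
  -- lower one by exchange.
  obtain ⟨t, ht, hmax⟩ := Finset.exists_max_image _ (fun t => circ t x) hne
  simp only [Finset.mem_filter, Finset.mem_powersetCard] at ht hmax
  obtain ⟨⟨htQ, h3⟩, hxt⟩ := ht
  refine ⟨t, htQ, h3, hxt, fun p hp => ?_⟩
  by_contra hneg
  push Not at hneg
  have hnd := hP.nonDeg (htQ.trans hQ) h3
  have hpt : p ∉ t := fun h => by rw [circ_eq_zero hnd h] at hneg; exact lt_irrefl _ hneg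
  obtain ⟨a, ha, hxa⟩ := exchange hnd hxt hpt
  set t' := insert p (t.erase a)
  have hpe : p ∉ t.erase a := fun hc => hpt (Finset.mem_of_mem_erase hc)
  have h3' : #t' = 3 := by
    rw [Finset.card_insert_of_notMem hpe, Finset.card_erase_of_mem ha, h3]
  have hQ' : t' ⊆ Q := Finset.insert_subset hp ((Finset.erase_subset a t).trans htQ)
  have hx' := hx.mem_otri hP (hQ'.trans hQ) h3' hxa
  have hnd' := hP.nonDeg (hQ'.trans hQ) h3'
  have hle := hmax t' ⟨⟨hQ', h3'⟩, hx'⟩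
  have hz := hnd'.eq_zero ((isDisc_circ hnd).sub (isDisc_circ hnd')) ?_ hx' (by linarith) p
    (Finset.mem_insert_self _ _)
  · rw [circ_eq_zero hnd' (Finset.mem_insert_self _ _)] at hz
    linarith
  · intro q hq
    rw [circ_eq_zero hnd' hq]
    rcases Finset.mem_insert.1 hq with rfl | hq
    · linarith
    · rw [circ_eq_zero hnd (Finset.mem_of_mem_erase hq)]; simp

/-- The affine function `circ t - circ t'` is nonpositive on `t` and nonnegative on `t'`, so it
vanishes at `x` and then at all vertices of `t`. These lie on the circle of `t'`, and general
position finishes. -/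
theorem delaunay_unique {P : Finset Plane} (hP : GeneralPosition P) {t t' : Finset Plane}
    (ht : t ⊆ P) (h3 : #t = 3) (ht' : t' ⊆ P) (h3' : #t' = 3) {x : Plane} (hx : x ∈ otri t)
    (hx' : x ∈ otri t') (h : ∀ p ∈ t', 0 ≤ circ t p) (h' : ∀ p ∈ t, 0 ≤ circ t' p) : t = t' := by
  have hnd := hP.nonDeg ht h3
  have hnd' := hP.nonDeg ht' h3'
  have hf := (isDisc_circ hnd).sub (isDisc_circ hnd')
  have h1 : 0 ≤ circ t x - circ t' x := by
    have := hnd'.nonpos ((isDisc_circ hnd').sub (isDisc_circ hnd))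
      (fun p hp => by rw [circ_eq_zero hnd' hp]; simpa using h p hp) (otri_subset hnd' hx')
    linarith
  have h2 := hnd.eq_zero hf (fun p hp => by rw [circ_eq_zero hnd hp]; simpa using h' p hp) hx h1
  refine Finset.eq_of_subset_of_card_le (fun p hp => ?_) (by omega)
  refine hP.mem_of_circle (isDisc_circ hnd') ht' h3' (fun q hq => circ_eq_zero hnd' hq) (ht hp) ?_
  have := h2 p hp
  rw [circ_eq_zero hnd hp] at this
  linarith

open scoped Classical

/-! ### Triangulations from families of triangles -/

theorem NonDeg.affineIndependent {t : Finset Plane} (h : NonDeg t) :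
    AffineIndependent ℝ ((↑) : t → Plane) := by
  obtain ⟨h3, hc⟩ := h
  obtain ⟨a, b, c, hab, hac, hbc, rfl⟩ := Finset.card_eq_three.1 h3
  have h1 : AffineIndependent ℝ ![a, b, c] := by
    rw [affineIndependent_iff_not_collinear_set]
    simpa using hc
  have h2 := h1.range
  have e : Set.range ![a, b, c] = (({a, b, c} : Finset Plane) : Set Plane) := by
    simp [Matrix.range_cons, Matrix.range_empty]
    ext; simp; tauto
  rw [e] at h2
  exact h2

theorem GeneralPosition.affineIndependent {P : Finset Plane} (hP : GeneralPosition P)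
    (hP3 : 3 ≤ #P) {s : Finset Plane} (hs : s ⊆ P) (h3 : #s ≤ 3) :
    AffineIndependent ℝ ((↑) : s → Plane) := by
  obtain ⟨t, hst, htP, ht⟩ := Finset.exists_subsuperset_card_eq hs h3 hP3
  exact (hP.nonDeg htP ht).affineIndependent.mono (s := (s : Set Plane)) (t := (t : Set Plane))
    (by exact_mod_cast hst)

/-- A weighted mean of nonpositive values is nonnegative only if the weights live on the zero set;
this isolates the face on a supporting line. -/
theorem mem_convexHull_filter {t : Finset Plane} {f : Plane → ℝ} (hf : IsAffine f)
    (ht : ∀ p ∈ t, f p ≤ 0) {x : Plane} (hx : x ∈ convexHull ℝ (t : Set Plane)) (h0 : 0 ≤ f x) :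
    x ∈ convexHull ℝ ((t.filter fun p => f p = 0 : Finset Plane) : Set Plane) := by
  obtain ⟨w, hw, hw1, rfl⟩ := Finset.mem_convexHull'.1 hx
  rw [hf.sum t w (fun p => p) hw1] at h0
  have hz := (Finset.sum_eq_zero_iff_of_nonpos fun p hp =>
    mul_nonpos_of_nonneg_of_nonpos (hw p hp) (ht p hp)).1
    (le_antisymm (Finset.sum_nonpos fun p hp =>
      mul_nonpos_of_nonneg_of_nonpos (hw p hp) (ht p hp)) h0)
  have hw0 : ∀ p ∈ t, ¬ f p = 0 → w p = 0 := fun p hp h =>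
    (mul_eq_zero.1 (hz p hp)).resolve_right h
  refine Finset.mem_convexHull'.2 ⟨w, fun p hp => hw p (Finset.mem_filter.1 hp).1, ?_, ?_⟩
  · rw [← hw1]
    refine Finset.sum_subset (Finset.filter_subset _ _) fun p hp h => hw0 p hp fun h' => ?_
    exact h (Finset.mem_filter.2 ⟨hp, h'⟩)
  · refine Finset.sum_subset (Finset.filter_subset _ _) fun p hp h => ?_
    rw [hw0 p hp fun h' => h (Finset.mem_filter.2 ⟨hp, h'⟩), zero_smul]

/-- A line contains at most two points of `P`. -/
theorem GeneralPosition.card_zero_le {P : Finset Plane} (hP : GeneralPosition P) {f : Plane → ℝ}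
    (hf : IsAffine f) {y : Plane} (hy : f y ≠ 0) {s : Finset Plane} (hs : s ⊆ P)
    (h0 : ∀ p ∈ s, f p = 0) : #s ≤ 2 := by
  by_contra hc
  obtain ⟨t, hts, ht⟩ := Finset.exists_subset_card_eq (show 3 ≤ #s by omega)
  have hnd := hP.nonDeg (hts.trans hs) ht
  apply hy
  rw [hnd.eval hf]
  exact Finset.sum_eq_zero fun p hp => by rw [h0 p (hts hp), mul_zero]

theorem isAffine_dual_sub (f : StrongDual ℝ Plane) (u : ℝ) : IsAffine fun x => f x - u :=
  ⟨f.toLinearMap, -u, fun x => by simp [sub_eq_add_neg]⟩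

theorem le_on_convexHull {t : Finset Plane} (h : NonDeg t) {f : Plane → ℝ} (hf : IsAffine f)
    (h0 : ∀ x ∈ otri t, f x ≤ 0) {x : Plane} (hx : x ∈ convexHull ℝ (t : Set Plane)) :
    f x ≤ 0 := by
  have : IsClosed {x | f x ≤ 0} := isClosed_le hf.continuous continuous_const
  exact closure_minimal h0 this (convexHull_subset_closure_otri h hx)

/-- Triangles with disjoint interiors meet in a common face. -/
theorem GeneralPosition.inter_subset_of_disjoint {P : Finset Plane} (hP : GeneralPosition P)
    (hP3 : 3 ≤ #P) {t t' : Finset Plane} (ht : t ⊆ P) (h3 : #t = 3) (ht' : t' ⊆ P)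
    (h3' : #t' = 3) (hd : Disjoint (otri t) (otri t')) :
    convexHull ℝ (t : Set Plane) ∩ convexHull ℝ (t' : Set Plane) ⊆
      convexHull ℝ ((t ∩ t' : Finset Plane) : Set Plane) := by
  have hnd := hP.nonDeg ht h3
  have hnd' := hP.nonDeg ht' h3'
  obtain ⟨f, u, hfu, hfu'⟩ := geometric_hahn_banach_open_open (convex_otri hnd) (isOpen_otri hnd)
    (convex_otri hnd') (isOpen_otri hnd') hd
  have hf := isAffine_dual_sub f u
  have h1 : ∀ x ∈ convexHull ℝ (t : Set Plane), f x - u ≤ 0 := fun x hx =>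
    le_on_convexHull hnd hf (fun x hx => by linarith [hfu x hx]) hx
  have h2 : ∀ x ∈ convexHull ℝ (t' : Set Plane), -(f x - u) ≤ 0 := fun x hx =>
    le_on_convexHull hnd' hf.neg (fun x hx => by linarith [hfu' x hx]) hx
  rintro x ⟨hx, hx'⟩
  have hx0 := h1 x hx
  have hx0' := h2 x hx'
  have m1 := mem_convexHull_filter hf (fun p hp => h1 p (subset_convexHull ℝ _ hp)) hx
    (by linarith)
  have m2 := mem_convexHull_filter hf.neg (fun p hp => h2 p (subset_convexHull ℝ _ hp)) hx'
    (by linarith)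
  simp only [neg_eq_zero] at m2
  set s := t.filter fun p => f p - u = 0
  set s' := t'.filter fun p => f p - u = 0
  have hst : s ⊆ t := Finset.filter_subset _ _
  have hst' : s' ⊆ t' := Finset.filter_subset _ _
  have hsub : s ∪ s' ⊆ P := Finset.union_subset (hst.trans ht) (hst'.trans ht')
  obtain ⟨y, hy⟩ := otri_nonempty hnd
  -- The separating line carries at most two points of `P`, so the two touching faces lie in one
  -- affinely independent set and their hulls meet in the hull of the common vertices.
  have hcard : #(s ∪ s') ≤ 2 := hP.card_zero_le hf (y := y) (by linarith [hfu y hy]) hsub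
    (fun p hp => by
      rcases Finset.mem_union.1 hp with h | h <;> exact (Finset.mem_filter.1 h).2)
  have hai := hP.affineIndependent hP3 hsub (by omega)
  have := hai.convexHull_inter (t₁ := s) (t₂ := s') Finset.subset_union_left
    Finset.subset_union_right
  have hm : x ∈ convexHull ℝ ((s : Set Plane) ∩ (s' : Set Plane)) := by
    rw [this]; exact ⟨m1, m2⟩
  refine convexHull_mono ?_ hm
  rw [Finset.coe_inter]
  exact Set.inter_subset_inter (by exact_mod_cast hst) (by exact_mod_cast hst')

theorem NonDeg.convexHull_inter {t : Finset Plane} (h : NonDeg t) {s s' : Finset Plane}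
    (hs : s ⊆ t) (hs' : s' ⊆ t) :
    convexHull ℝ (s : Set Plane) ∩ convexHull ℝ (s' : Set Plane) ⊆
      convexHull ℝ ((s ∩ s' : Finset Plane) : Set Plane) := by
  have := h.affineIndependent.convexHull_inter (t₁ := s) (t₂ := s') hs hs'
  rw [Finset.coe_inter]
  exact this.ge

/-- Faces of two triangles with disjoint interiors meet in a common face. -/
theorem GeneralPosition.face_inter_subset {P : Finset Plane} (hP : GeneralPosition P)
    (hP3 : 3 ≤ #P) {t t' : Finset Plane} (ht : t ⊆ P) (h3 : #t = 3) (ht' : t' ⊆ P)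
    (h3' : #t' = 3) (hd : t ≠ t' → Disjoint (otri t) (otri t')) {s s' : Finset Plane}
    (hs : s ⊆ t) (hs' : s' ⊆ t') :
    convexHull ℝ (s : Set Plane) ∩ convexHull ℝ (s' : Set Plane) ⊆
      convexHull ℝ ((s ∩ s' : Finset Plane) : Set Plane) := by
  have hnd := hP.nonDeg ht h3
  have hnd' := hP.nonDeg ht' h3'
  by_cases htt : t = t'
  · subst htt
    exact hnd.convexHull_inter hs hs'
  rintro x ⟨hx, hx'⟩
  have h1 := hP.inter_subset_of_disjoint hP3 ht h3 ht' h3' (hd htt)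
    ⟨convexHull_mono (by exact_mod_cast hs) hx, convexHull_mono (by exact_mod_cast hs') hx'⟩
  have h2 := hnd.convexHull_inter (s := t ∩ t') Finset.inter_subset_left hs ⟨h1, hx⟩
  have h3 := hnd'.convexHull_inter (s := t ∩ t' ∩ s) (s' := s')
    ((Finset.inter_subset_left).trans Finset.inter_subset_right) hs' ⟨h2, hx'⟩
  refine convexHull_mono ?_ h3
  intro p hp
  simp at hp ⊢
  tauto

/-- The union of the closed triangles is closed, the hull is contained in the closure of its
interior, and generic points are dense there. -/
theorem mem_iUnion_of_generic {P : Finset Plane} (hP : GeneralPosition P) (hP3 : 3 ≤ #P)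
    {T : Finset (Finset Plane)} (hT : ∀ t ∈ T, t ⊆ P ∧ #t = 3)
    (cov : ∀ x, Generic P x → x ∈ convexHull ℝ (P : Set Plane) → ∃ t ∈ T, x ∈ otri t)
    {x : Plane} (hx : x ∈ convexHull ℝ (P : Set Plane)) :
    ∃ t ∈ T, x ∈ convexHull ℝ (t : Set Plane) := by
  have hcl : IsClosed (⋃ t ∈ T, convexHull ℝ (t : Set Plane)) :=
    T.finite_toSet.isClosed_biUnion fun t _ => (t.finite_toSet.isCompact_convexHull (𝕜 := ℝ)).isClosed
  have hne : (interior (convexHull ℝ (P : Set Plane))).Nonempty := by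
    obtain ⟨t, htP, ht⟩ := Finset.exists_subset_card_eq hP3
    have hnd := hP.nonDeg htP ht
    obtain ⟨y, hy⟩ := otri_nonempty hnd
    exact ⟨y, interior_maximal ((otri_subset hnd).trans (convexHull_mono (by exact_mod_cast htP)))
      (isOpen_otri hnd) hy⟩
  have hmem : x ∈ closure (interior (convexHull ℝ (P : Set Plane))) := by
    rw [(convex_convexHull ℝ _).closure_interior_eq_closure_of_nonempty_interior hne]
    exact subset_closure hx
  have hsub : closure (interior (convexHull ℝ (P : Set Plane))) ⊆
      ⋃ t ∈ T, convexHull ℝ (t : Set Plane) := by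
    refine closure_minimal ?_ hcl
    intro y hy
    by_contra hyT
    obtain ⟨z, ⟨hz1, hz2⟩, hzg⟩ := exists_generic P (isOpen_interior.inter hcl.isOpen_compl)
      ⟨y, hy, hyT⟩
    obtain ⟨t, ht, hzt⟩ := cov z hzg (interior_subset hz1)
    exact hz2 (Set.mem_biUnion ht (otri_subset (hP.nonDeg (hT t ht).1 (hT t ht).2) hzt))
  simpa using hsub hmem

/-- A point of `P` on the boundary of a triangle other than a vertex would be collinear with two
vertices. -/
theorem mem_triple_of_mem_convexHull {P : Finset Plane} (hP : GeneralPosition P)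
    (hP3 : 3 ≤ #P) {t : Finset Plane} (ht : t ⊆ P) (h3 : #t = 3) {p : Plane} (hp : p ∈ P)
    (hpt : p ∈ convexHull ℝ (t : Set Plane)) (hno : p ∉ otri t) : p ∈ t := by
  have hnd := hP.nonDeg ht h3
  by_contra hc
  obtain ⟨a, ha, h0⟩ : ∃ a ∈ t, bc t a p = 0 := by
    by_contra hall
    push Not at hall
    exact hno fun a ha => lt_of_le_of_ne ((mem_convexHull_iff_bc hnd).1 hpt a ha) (hall a ha).symm
  have hm := mem_convexHull_erase hnd hpt ha h0
  have hpe : p ∉ t.erase a := fun h => hc (Finset.mem_of_mem_erase h)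
  have hsub : insert p (t.erase a) ⊆ P :=
    Finset.insert_subset hp ((Finset.erase_subset a t).trans ht)
  have hai := hP.affineIndependent hP3 hsub (by
    rw [Finset.card_insert_of_notMem hpe, Finset.card_erase_of_mem ha, h3])
  have h2 := hai.convexHull_inter (t₁ := {p}) (t₂ := t.erase a) (by simp)
    (Finset.subset_insert _ _)
  have h4 : p ∈ convexHull ℝ (((({p} : Finset Plane) : Set Plane) ∩ (t.erase a : Finset Plane))) := by
    rw [h2]; exact ⟨by simp, hm⟩
  rw [← Finset.coe_inter, Finset.singleton_inter_of_notMem hpe] at h4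
  simp at h4

/-- Coverage is only asked at generic points, where boundary cases cannot occur. Together with `emp`
it also makes every point of `P` a vertex. -/
theorem exists_triangulation {P : Finset Plane} (hP : GeneralPosition P) (hP3 : 3 ≤ #P)
    (T : Finset (Finset Plane)) (hT : ∀ t ∈ T, t ⊆ P ∧ #t = 3)
    (disj : ∀ t ∈ T, ∀ t' ∈ T, t ≠ t' → Disjoint (otri t) (otri t'))
    (cov : ∀ x, Generic P x → x ∈ convexHull ℝ (P : Set Plane) → ∃ t ∈ T, x ∈ otri t)
    (emp : ∀ t ∈ T, ∀ p ∈ P, p ∉ otri t) :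
    ∃ K : Geometry.SimplicialComplex ℝ Plane, IsTriangulation P K ∧
      K.faces = {s | s.Nonempty ∧ ∃ t ∈ T, s ⊆ t} := by
  refine ⟨{ faces := {s | s.Nonempty ∧ ∃ t ∈ T, s ⊆ t}
            isRelLowerSet_faces := ?_
            indep := ?_
            inter_subset_convexHull := ?_ }, ⟨?_, ?_⟩, rfl⟩
  · rintro s ⟨hs, t, ht, hst⟩
    exact ⟨hs, fun r hrs hr => ⟨hr, t, ht, subset_trans hrs hst⟩⟩
  · rintro s ⟨hs, t, ht, hst⟩
    exact hP.affineIndependent hP3 (hst.trans (hT t ht).1)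
      ((Finset.card_le_card hst).trans (hT t ht).2.le)
  · rintro s s' ⟨hs, t, ht, hst⟩ ⟨hs', t', ht', hst'⟩
    have := hP.face_inter_subset hP3 (hT t ht).1 (hT t ht).2 (hT t' ht').1 (hT t' ht').2
      (disj t ht t' ht') hst hst'
    rwa [Finset.coe_inter] at this
  · ext p
    constructor
    · rintro ⟨-, t, ht, hpt⟩
      exact (hT t ht).1 (hpt (by simp))
    · intro hp
      obtain ⟨t, ht, hpt⟩ := mem_iUnion_of_generic hP hP3 hT cov (subset_convexHull ℝ _ hp)
      exact ⟨by simp, t, ht, by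
        simpa using mem_triple_of_mem_convexHull hP hP3 (hT t ht).1 (hT t ht).2 hp hpt
          (emp t ht p hp)⟩
  · ext x
    rw [Geometry.SimplicialComplex.mem_space_iff]
    constructor
    · rintro ⟨s, ⟨hs, t, ht, hst⟩, hx⟩
      exact convexHull_mono (by exact_mod_cast hst.trans (hT t ht).1) hx
    · intro hx
      obtain ⟨t, ht, hxt⟩ := mem_iUnion_of_generic hP hP3 hT cov hx
      exact ⟨t, ⟨Finset.card_pos.1 (by rw [(hT t ht).2]; norm_num), t, ht, subset_rfl⟩, hxt⟩

/-! ### Delaunay triangles and constrained Delaunay triangles -/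

/-- The relative interior of an edge. -/
def edgeInt (e : Finset Plane) : Set Plane := convexHull ℝ (e : Set Plane) \ e

theorem edgeInt_pair {u v : Plane} (huv : u ≠ v) : edgeInt {u, v} = openSegment ℝ u v := by
  ext z
  simp only [edgeInt, Finset.coe_insert, Finset.coe_singleton, convexHull_pair, Set.mem_sdiff,
    Set.mem_insert_iff, Set.mem_singleton_iff, not_or]
  constructor
  · rintro ⟨hz, h1, h2⟩
    exact mem_openSegment_of_ne_left_right (Ne.symm h1) (Ne.symm h2) hz
  · intro hz
    refine ⟨openSegment_subset_segment _ _ _ hz, ?_, ?_⟩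
    · rintro rfl; exact huv (left_mem_openSegment_iff.1 hz)
    · rintro rfl; exact huv (right_mem_openSegment_iff.1 hz)

theorem notMem_edgeInt {P : Finset Plane} (hP : GeneralPosition P) {e : Finset Plane}
    (he : e ⊆ P) (h2 : #e = 2) {p : Plane} (hp : p ∈ P) : p ∉ edgeInt e := by
  obtain ⟨u, v, huv, rfl⟩ := Finset.card_eq_two.1 h2
  rw [edgeInt_pair huv]
  exact hP.notMem_openSegment (he (by simp)) (he (by simp)) hp huv

/-- The Delaunay triangles of `P`. -/
def Del (P : Finset Plane) : Finset (Finset Plane) :=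
  {t ∈ P.powersetCard 3 | ∀ p ∈ P, 0 ≤ circ t p}

/-- The triangles of the Delaunay triangulation of `P` constrained to contain the edge `e`. -/
def Cdt (P e : Finset Plane) : Finset (Finset Plane) :=
  {t ∈ P.powersetCard 3 | Disjoint (otri t) (edgeInt e) ∧
    ∀ x ∈ otri t, ∀ p ∈ P, circ t p < 0 → ∃ z ∈ segment ℝ x p, z ∈ edgeInt e}

theorem mem_Del {P t : Finset Plane} :
    t ∈ Del P ↔ t ⊆ P ∧ #t = 3 ∧ ∀ p ∈ P, 0 ≤ circ t p := by
  simp [Del, Finset.mem_powersetCard, and_assoc]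

theorem mem_Cdt {P e t : Finset Plane} :
    t ∈ Cdt P e ↔ t ⊆ P ∧ #t = 3 ∧ Disjoint (otri t) (edgeInt e) ∧
      ∀ x ∈ otri t, ∀ p ∈ P, circ t p < 0 → ∃ z ∈ segment ℝ x p, z ∈ edgeInt e := by
  simp [Cdt, Finset.mem_powersetCard, and_assoc]

section
variable {P : Finset Plane} (hP : GeneralPosition P)
include hP

theorem Del_cover (hP2 : 2 ≤ #P) {x : Plane} (hx : Generic P x)
    (hxP : x ∈ convexHull ℝ (P : Set Plane)) : ∃ t ∈ Del P, x ∈ otri t := by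
  obtain ⟨t, h1, h2, h3, h4⟩ := hx.exists_delaunay hP hP2 subset_rfl hxP
  exact ⟨t, mem_Del.2 ⟨h1, h2, h4⟩, h3⟩

theorem Del_unique {t t' : Finset Plane} (ht : t ∈ Del P) (ht' : t' ∈ Del P) {x : Plane}
    (hx : x ∈ otri t) (hx' : x ∈ otri t') : t = t' := by
  obtain ⟨h1, h2, h3⟩ := mem_Del.1 ht
  obtain ⟨h1', h2', h3'⟩ := mem_Del.1 ht'
  exact delaunay_unique hP h1 h2 h1' h2' hx hx' (fun p hp => h3 p (h1' hp))
    (fun p hp => h3' p (h1 hp))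

omit hP in
theorem segment_otri {t : Finset Plane} (h : NonDeg t) {x p z : Plane} (hx : x ∈ otri t)
    (hp : p ∈ convexHull ℝ (t : Set Plane)) (hz : z ∈ segment ℝ x p) : z = p ∨ z ∈ otri t := by
  obtain ⟨a, b, ha, hb, hab, rfl⟩ := hz
  rcases eq_or_lt_of_le ha with h0 | h0
  · left
    obtain rfl : b = 1 := by linarith
    simp [← h0]
  · exact Or.inr (mem_otri_of_combo h hx hp h0 hb hab)

/-- A vertex of `t'` inside the circle of `t` would be hidden from `x` by `e`, but the segment to it
runs inside `t'`, which `e` does not cross. So `delaunay_unique` applies. -/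
theorem Cdt_unique {e : Finset Plane} (he : e ⊆ P) (he2 : #e = 2) {t t' : Finset Plane}
    (ht : t ∈ Cdt P e) (ht' : t' ∈ Cdt P e) {x : Plane}
    (hx : x ∈ otri t) (hx' : x ∈ otri t') : t = t' := by
  have key : ∀ {t t' : Finset Plane}, t ∈ Cdt P e → t' ∈ Cdt P e → x ∈ otri t → x ∈ otri t' →
      ∀ p ∈ t', 0 ≤ circ t p := by
    intro t t' ht ht' hx hx' p hp
    obtain ⟨h1, h2, h3, h4⟩ := mem_Cdt.1 ht
    obtain ⟨h1', h2', h3', h4'⟩ := mem_Cdt.1 ht'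
    by_contra hneg
    obtain ⟨z, hz, hze⟩ := h4 x hx p (h1' hp) (not_le.1 hneg)
    rcases segment_otri (hP.nonDeg h1' h2') hx' (subset_convexHull ℝ _ hp) hz with rfl | h
    · exact notMem_edgeInt hP he he2 (h1' hp) hze
    · exact Set.disjoint_left.1 h3' h hze
  obtain ⟨h1, h2, -⟩ := mem_Cdt.1 ht
  obtain ⟨h1', h2', -⟩ := mem_Cdt.1 ht'
  exact delaunay_unique hP h1 h2 h1' h2' hx hx' (key ht ht' hx hx') (key ht' ht hx' hx)

omit hP in
theorem exists_pos_affine {u v x : Plane} (h : side u v x ≠ 0) :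
    ∃ f : Plane → ℝ, IsAffine f ∧ 0 < f x ∧ ∀ z, f z = 0 ↔ side u v z = 0 := by
  rcases lt_or_gt_of_ne h with h | h
  · exact ⟨_, (side_affine u v).neg, by simpa using h, by simp⟩
  · exact ⟨_, side_affine u v, h, by simp⟩

omit hP in
theorem disjoint_segment_endpoint {u v x : Plane} (huv : u ≠ v) (h : side u v x ≠ 0) {w : Plane}
    (hw : w = u ∨ w = v) : Disjoint (segment ℝ x w) (openSegment ℝ u v) := by
  rw [Set.disjoint_left]
  rintro z ⟨a, b, ha, hb, hab, rfl⟩ hz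
  have hw0 : side u v w = 0 := by rcases hw with rfl | rfl <;> simp
  have h0 := openSegment_side hz
  rw [(side_affine u v).combo hab, hw0, mul_zero, add_zero, mul_eq_zero] at h0
  have ha0 := h0.resolve_right h
  obtain rfl : b = 1 := by linarith
  simp only [ha0, zero_smul, one_smul, zero_add] at hz
  rcases hw with rfl | rfl
  · exact huv (left_mem_openSegment_iff.1 hz)
  · exact huv (right_mem_openSegment_iff.1 hz)

omit hP in
/-- The points visible from `x` still surround `x`. -/
theorem mem_convexHull_visible {u v x : Plane} (hu : u ∈ P) (hv : v ∈ P) (huv : u ≠ v)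
    (h : side u v x ≠ 0) (hx : x ∈ convexHull ℝ (P : Set Plane)) :
    x ∈ convexHull ℝ
      ((P.filter fun p => Disjoint (segment ℝ x p) (openSegment ℝ u v) : Finset Plane) :
        Set Plane) := by
  set Q := P.filter fun p => Disjoint (segment ℝ x p) (openSegment ℝ u v)
  by_contra hc
  -- Suppose a line separates `x` from the visible points. The endpoints `u`, `v` are visible, so
  -- all of `u v` is on their side; the segment from `x` to a hidden point meets `u v`, so hidden
  -- points are there as well, contradicting that `x` is in the hull of `P`.
  obtain ⟨f, c, hfx, hfQ⟩ := geometric_hahn_banach_point_closed (convex_convexHull ℝ (Q : Set Plane))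
    (Q.finite_toSet.isCompact_convexHull (𝕜 := ℝ)).isClosed hc
  have hQ : ∀ p ∈ Q, 0 < f p - f x := fun p hp => by
    linarith [hfQ p (subset_convexHull ℝ _ hp)]
  have hf := isAffine_dual_sub f (f x)
  have hfu := hQ u (Finset.mem_filter.2 ⟨hu, disjoint_segment_endpoint huv h (Or.inl rfl)⟩)
  have hfv := hQ v (Finset.mem_filter.2 ⟨hv, disjoint_segment_endpoint huv h (Or.inr rfl)⟩)
  have hall : ∀ p ∈ P, 0 < f p - f x := by
    intro p hp
    by_cases hpQ : p ∈ Q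
    · exact hQ p hpQ
    · have : ¬ Disjoint (segment ℝ x p) (openSegment ℝ u v) := fun hd =>
        hpQ (Finset.mem_filter.2 ⟨hp, hd⟩)
      obtain ⟨z, hz, hzo⟩ := Set.not_disjoint_iff.1 this
      have hz0 : 0 < f z - f x :=
        (hf.convex_gt 0).segment_subset hfu hfv (openSegment_subset_segment _ _ _ hzo)
      by_contra hneg
      have := (hf.convex_le 0).segment_subset (x := x) (y := p) (by simp) (not_lt.1 hneg) hz
      exact absurd hz0 (not_lt.2 this)
  have h0 : 0 < f x - f x := convexHull_min (fun p hp => hall p hp) (hf.convex_gt 0) hx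
  exact absurd h0 (by simp)

/-- The required triangle is a Delaunay triangle, around `x`, of the points visible from `x`. It
remains to pass from visibility at `x` to visibility at every point of the triangle. -/
theorem Cdt_cover (hP2 : 2 ≤ #P) {e : Finset Plane} (he : e ⊆ P) (he2 : #e = 2) {x : Plane}
    (hx : Generic P x) (hxP : x ∈ convexHull ℝ (P : Set Plane)) : ∃ t ∈ Cdt P e, x ∈ otri t := by
  obtain ⟨u, v, huv, rfl⟩ := Finset.card_eq_two.1 he2
  have hu : u ∈ P := he (by simp)
  have hv : v ∈ P := he (by simp)
  have hs := hx u hu v hv huv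
  have hmem := mem_convexHull_visible hu hv huv hs hxP
  obtain ⟨t, htQ, h3, hxt, hpos⟩ := hx.exists_delaunay hP hP2 (Finset.filter_subset _ _) hmem
  have htP := htQ.trans (Finset.filter_subset _ _)
  have hnd := hP.nonDeg htP h3
  have hcu := hpos u (Finset.mem_filter.2 ⟨hu, disjoint_segment_endpoint huv hs (Or.inl rfl)⟩)
  have hcv := hpos v (Finset.mem_filter.2 ⟨hv, disjoint_segment_endpoint huv hs (Or.inr rfl)⟩)
  have hut : u ∉ otri t := fun h => absurd (circ_neg_of_otri hnd h) (not_lt.2 hcu)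
  have hvt : v ∉ otri t := fun h => absurd (circ_neg_of_otri hnd h) (not_lt.2 hcv)
  obtain ⟨f, hf, hfx, hf0⟩ := exists_pos_affine hs
  -- If `e` crossed the triangle, some vertex would lie beyond the line `u v`, and the segment to it
  -- from `x` would meet the line inside the triangle, hence on `e`; but the vertices are visible
  -- from `x`.
  have hdisj : Disjoint (otri t) (openSegment ℝ u v) := by
    rw [Set.disjoint_left]
    intro y hy hyo
    have hfy := (hf0 y).2 (openSegment_side hyo)
    obtain ⟨a, ha, hfa⟩ : ∃ a ∈ t, f a < 0 := by
      by_contra hc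
      push Not at hc
      have h0 := hnd.eq_zero hf.neg (fun p hp => by simpa using hc p hp) hy (by simp [hfy])
      have := hnd.nonpos hf (fun p hp => by have := h0 p hp; linarith) (otri_subset hnd hxt)
      linarith
    obtain ⟨z, hz, hfz⟩ := hf.exists_zero hfx hfa
    have hzs := openSegment_subset_segment _ _ _ hz
    have hzt : z ∈ otri t := by
      refine (segment_otri hnd hxt (subset_convexHull ℝ _ ha) hzs).resolve_left ?_
      rintro rfl
      linarith
    have hzo := mem_openSegment_of_convex (convex_otri hnd) huv hy hyo hut hvt hzt ((hf0 z).1 hfz)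
    exact Set.disjoint_left.1 (Finset.mem_filter.1 (htQ ha)).2 hzs hzo
  refine ⟨t, mem_Cdt.2 ⟨htP, h3, by rwa [edgeInt_pair huv], ?_⟩, hxt⟩
  intro y hy p hp hneg
  rw [edgeInt_pair huv]
  have hpQ : ¬ Disjoint (segment ℝ x p) (openSegment ℝ u v) := fun hd =>
    absurd (hpos p (Finset.mem_filter.2 ⟨hp, hd⟩)) (not_le.2 hneg)
  obtain ⟨z, hz, hzo⟩ := Set.not_disjoint_iff.1 hpQ
  have hC := (isDisc_circ hnd).convex
  have hxC := circ_neg_of_otri hnd hxt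
  have hzC : circ t z < 0 := hC.segment_subset hxC hneg hz
  -- The disc meets the line `u v` only within `e`. Hence the whole triangle is on one side of that
  -- line, and any segment from it to a point of the disc on or beyond the line meets `e`.
  have hline : ∀ w, circ t w < 0 → f w = 0 → w ∈ openSegment ℝ u v := fun w hw hfw =>
    mem_openSegment_of_convex hC huv hzC hzo (not_lt.2 hcu) (not_lt.2 hcv) hw ((hf0 w).1 hfw)
  have hne : ∀ w ∈ otri t, f w ≠ 0 := fun w hw hfw =>
    Set.disjoint_left.1 hdisj hw (hline w (circ_neg_of_otri hnd hw) hfw)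
  have hfy : 0 < f y := by
    by_contra hc
    obtain ⟨w, hw, hfw⟩ := hf.exists_zero hfx (lt_of_le_of_ne (not_lt.1 hc) (hne y hy))
    exact hne w ((convex_otri hnd).segment_subset hxt hy (openSegment_subset_segment _ _ _ hw)) hfw
  have hfz := (hf0 z).2 (openSegment_side hzo)
  have hfp : 0 ≤ -f p := hf.neg.nonneg_beyond hz (by rintro rfl; linarith) (by linarith)
    (by linarith)
  rcases eq_or_lt_of_le hfp with h0 | h0
  · exact ⟨p, right_mem_segment _ _ _, hline p hneg (by linarith)⟩
  · obtain ⟨w, hw, hfw⟩ := hf.exists_zero hfy (by linarith : f p < 0)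
    have hws := openSegment_subset_segment _ _ _ hw
    exact ⟨w, hws, hline w (hC.segment_subset (circ_neg_of_otri hnd hy) hneg hws) hfw⟩

/-- A Delaunay triangle overlapping a non-Delaunay triangle of `Cdt P e` is crossed by `e`. -/
theorem crossed_of_overlap {e : Finset Plane} (he : e ⊆ P) (he2 : #e = 2) {t τ : Finset Plane}
    (ht : t ∈ Cdt P e) (htD : t ∉ Del P) (hτ : τ ∈ Del P) {x : Plane} (hx : x ∈ otri t)
    (hxτ : x ∈ otri τ) : ¬ Disjoint (otri τ) (edgeInt e) := by
  intro hd
  apply htD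
  obtain ⟨h1, h2, h3⟩ := mem_Del.1 hτ
  obtain ⟨h1', h2', h3', h4'⟩ := mem_Cdt.1 ht
  have : t = τ := by
    refine delaunay_unique hP h1' h2' h1 h2 hx hxτ (fun p hp => ?_) (fun p hp => h3 p (h1' hp))
    by_contra hneg
    obtain ⟨z, hz, hze⟩ := h4' x hx p (h1 hp) (not_le.1 hneg)
    rcases segment_otri (hP.nonDeg h1 h2) hxτ (subset_convexHull ℝ _ hp) hz with rfl | h
    · exact notMem_edgeInt hP he he2 (h1 hp) hze
    · exact Set.disjoint_left.1 hd h hze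
  rwa [this]

/-- An edge meeting a closed triangle but not its interior is an edge of the triangle. -/
theorem subset_of_mem_edgeInt {e t : Finset Plane} (he : e ⊆ P) (he2 : #e = 2) (ht : t ⊆ P)
    (h3 : #t = 3) {m : Plane} (hm : m ∈ edgeInt e) (hmt : m ∈ convexHull ℝ (t : Set Plane))
    (hd : Disjoint (otri t) (edgeInt e)) : e ⊆ t := by
  have hnd := hP.nonDeg ht h3
  obtain ⟨u, v, huv, rfl⟩ := Finset.card_eq_two.1 he2
  rw [edgeInt_pair huv] at hm hd
  obtain ⟨f, c, hft, hfe⟩ := geometric_hahn_banach_open (convex_otri hnd) (isOpen_otri hnd)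
    (convex_openSegment u v) hd
  have hf := isAffine_dual_sub f c
  have h1 : ∀ x ∈ convexHull ℝ (t : Set Plane), f x - c ≤ 0 := fun x hx =>
    le_on_convexHull hnd hf (fun x hx => by linarith [hft x hx]) hx
  have hseg : ∀ x ∈ segment ℝ u v, -(f x - c) ≤ 0 := by
    have hcl : IsClosed {x | -(f x - c) ≤ 0} := isClosed_le hf.neg.continuous continuous_const
    intro x hx
    rw [← closure_openSegment] at hx
    exact closure_minimal (fun y hy => by simpa using hfe y hy) hcl hx
  have m0 := h1 m hmt
  have m0' := hseg m (openSegment_subset_segment _ _ _ hm)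
  have n1 := mem_convexHull_filter hf (fun p hp => h1 p (subset_convexHull ℝ _ hp)) hmt
    (by linarith)
  have hu := hseg u (left_mem_segment _ _ _)
  have hv := hseg v (right_mem_segment _ _ _)
  -- Both end values are nonnegative while the value at the intermediate point `m` is nonpositive,
  -- so the separating line is the line of `e`.
  have huv0 : f u - c = 0 ∧ f v - c = 0 := by
    obtain ⟨a, b, ha, hb, hab, rfl⟩ := hm
    rw [hf.combo hab] at m0 m0'
    constructor
    · have h : a * (f u - c) ≤ 0 := by nlinarith
      nlinarith
    · have h : b * (f v - c) ≤ 0 := by nlinarith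
      nlinarith
  set s := t.filter fun p => f p - c = 0
  obtain ⟨y, hy⟩ := otri_nonempty hnd
  have hcard : #({u, v} ∪ s) ≤ 2 := hP.card_zero_le hf (y := y) (by linarith [hft y hy])
    (Finset.union_subset he ((Finset.filter_subset _ _).trans ht)) (fun p hp => by
      rcases Finset.mem_union.1 hp with h | h
      · simp only [Finset.mem_insert, Finset.mem_singleton] at h
        rcases h with rfl | rfl
        exacts [huv0.1, huv0.2]
      · exact (Finset.mem_filter.1 h).2)
  have hsuv : s ⊆ {u, v} := by
    have := Finset.eq_of_subset_of_card_le (Finset.subset_union_left (s₁ := {u, v}) (s₂ := s))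
      (by rw [he2]; exact hcard)
    rw [this]; exact Finset.subset_union_right
  rw [← edgeInt_pair huv] at hm
  have hsing : ∀ w ∈ P, s ≠ ∅ ∧ s ≠ {w} := by
    intro w hw
    constructor
    · intro h; rw [h] at n1; simp at n1
    · intro h; rw [h] at n1
      simp only [Finset.coe_singleton, convexHull_singleton, Set.mem_singleton_iff] at n1
      exact notMem_edgeInt hP he he2 hw (n1 ▸ hm)
  have hsub : ({u, v} : Finset Plane) ⊆ s := by
    intro w hw
    by_contra hws
    have hsub2 : s ⊆ ({u, v} : Finset Plane).erase w := fun p hp =>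
      Finset.mem_erase.2 ⟨fun h => hws (h ▸ hp), hsuv hp⟩
    have : #s ≤ 1 := (Finset.card_le_card hsub2).trans (by rw [Finset.card_erase_of_mem hw, he2])
    rcases Nat.le_one_iff_eq_zero_or_eq_one.1 this with h | h
    · exact (hsing u (he (by simp))).1 (Finset.card_eq_zero.1 h)
    · obtain ⟨p, hp⟩ := Finset.card_eq_one.1 h
      have hps : p ∈ s := by rw [hp]; simp
      exact (hsing p (he (hsuv hps))).2 hp
  exact hsub.trans (Finset.filter_subset _ _)

/-! ### Combining constrained Delaunay triangulations -/

omit hP in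
theorem edgeInt_nonempty {e : Finset Plane} (he2 : #e = 2) :
    (edgeInt e).Nonempty := by
  obtain ⟨u, v, huv, rfl⟩ := Finset.card_eq_two.1 he2
  rw [edgeInt_pair huv]
  exact ⟨_, 1 / 2, 1 / 2, by norm_num, by norm_num, by norm_num, rfl⟩

omit hP in
/-- Two edges conflict if they cross the interior of a common Delaunay triangle. -/
def Conflict (P e e' : Finset Plane) : Prop :=
  ∃ τ ∈ Del P, ¬ Disjoint (otri τ) (edgeInt e) ∧ ¬ Disjoint (otri τ) (edgeInt e')

omit hP in
/-- The triangles of the Delaunay triangulation constrained by a set of nonconflicting edges. -/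
def multiCdt (P : Finset Plane) (S : Finset (Finset Plane)) : Finset (Finset Plane) :=
  {τ ∈ Del P | ∀ e ∈ S, Disjoint (otri τ) (edgeInt e)} ∪ S.biUnion fun e => Cdt P e \ Del P

omit hP in
theorem mem_multiCdt {S : Finset (Finset Plane)} {t : Finset Plane} :
    t ∈ multiCdt P S ↔ (t ∈ Del P ∧ ∀ e ∈ S, Disjoint (otri t) (edgeInt e)) ∨
      ∃ e ∈ S, t ∈ Cdt P e ∧ t ∉ Del P := by
  simp [multiCdt]

variable {S : Finset (Finset Plane)} (hS : ∀ e ∈ S, e ⊆ P ∧ #e = 2)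
  (hconf : ∀ e ∈ S, ∀ e' ∈ S, Conflict P e e' → e = e')
include hS

omit hP hS in
theorem multiCdt_triple {t : Finset Plane} (ht : t ∈ multiCdt P S) : t ⊆ P ∧ #t = 3 := by
  rcases mem_multiCdt.1 ht with ⟨h, -⟩ | ⟨e, -, h, -⟩
  · exact ⟨(mem_Del.1 h).1, (mem_Del.1 h).2.1⟩
  · exact ⟨(mem_Cdt.1 h).1, (mem_Cdt.1 h).2.1⟩

/-- If the Delaunay triangle around `x` is crossed by `e`, the triangle of `Cdt P e` around `x` is
used instead. It is not Delaunay, since otherwise it would be that crossed triangle. -/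
theorem multiCdt_cover (hP2 : 2 ≤ #P) {x : Plane} (hx : Generic P x)
    (hxP : x ∈ convexHull ℝ (P : Set Plane)) : ∃ t ∈ multiCdt P S, x ∈ otri t := by
  obtain ⟨τ, hτ, hxτ⟩ := Del_cover hP hP2 hx hxP
  by_cases h : ∀ e ∈ S, Disjoint (otri τ) (edgeInt e)
  · exact ⟨τ, mem_multiCdt.2 (Or.inl ⟨hτ, h⟩), hxτ⟩
  · push Not at h
    obtain ⟨e, he, hd⟩ := h
    obtain ⟨t, ht, hxt⟩ := Cdt_cover hP hP2 (hS e he).1 (hS e he).2 hx hxP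
    refine ⟨t, mem_multiCdt.2 (Or.inr ⟨e, he, ht, fun htD => hd ?_⟩), hxt⟩
    rw [← Del_unique hP htD hτ hxt hxτ]
    exact (mem_Cdt.1 ht).2.2.1

omit hS in
theorem exists_Del_overlap (hP2 : 2 ≤ #P) {t : Finset Plane} (ht : t ⊆ P)
    (h3 : #t = 3) {U : Set Plane} (hU : IsOpen U) (hUt : (U ∩ otri t).Nonempty) :
    ∃ τ ∈ Del P, ∃ x ∈ U, x ∈ otri t ∧ x ∈ otri τ := by
  have hnd := hP.nonDeg ht h3
  obtain ⟨x, ⟨hxU, hx⟩, hxg⟩ := exists_generic P (hU.inter (isOpen_otri hnd)) hUt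
  obtain ⟨τ, hτ, hxτ⟩ := Del_cover hP hP2 hxg
    (convexHull_mono (by exact_mod_cast ht) (otri_subset hnd hx))
  exact ⟨τ, hτ, x, hxU, hx, hxτ⟩

-- At a common generic point, look at the Delaunay triangle `τ` there. Two new triangles from
-- different edges would both force `τ` to be crossed, which is a conflict; a kept Delaunay triangle
-- is not crossed at all.
include hconf in
theorem multiCdt_disjoint (hP2 : 2 ≤ #P) {t t' : Finset Plane} (ht : t ∈ multiCdt P S)
    (ht' : t' ∈ multiCdt P S) (hne : t ≠ t') : Disjoint (otri t) (otri t') := by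
  obtain ⟨htP, h3⟩ := multiCdt_triple ht
  obtain ⟨htP', h3'⟩ := multiCdt_triple ht'
  rw [Set.disjoint_iff_inter_eq_empty, ← Set.not_nonempty_iff_eq_empty]
  intro hn
  obtain ⟨τ, hτ, x, hx', hx, hxτ⟩ := exists_Del_overlap hP hP2 htP h3
    (isOpen_otri (hP.nonDeg htP' h3')) (by rwa [Set.inter_comm])
  apply hne
  rcases mem_multiCdt.1 ht with ⟨hD, hd⟩ | ⟨e, he, hC, hD⟩ <;>
    rcases mem_multiCdt.1 ht' with ⟨hD', hd'⟩ | ⟨e', he', hC', hD'⟩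
  · exact Del_unique hP hD hD' hx hx'
  · exact absurd (hd e' he') (crossed_of_overlap hP (hS e' he').1 (hS e' he').2 hC' hD' hD hx' hx)
  · exact absurd (hd' e he) (crossed_of_overlap hP (hS e he).1 (hS e he).2 hC hD hD' hx hx')
  · have c := crossed_of_overlap hP (hS e he).1 (hS e he).2 hC hD hτ hx hxτ
    have c' := crossed_of_overlap hP (hS e' he').1 (hS e' he').2 hC' hD' hτ hx' hxτ
    obtain rfl := hconf e he e' he' ⟨τ, hτ, c, c'⟩
    exact Cdt_unique hP (hS e he).1 (hS e he).2 hC hC' hx hx'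

theorem multiCdt_empty {t : Finset Plane} (ht : t ∈ multiCdt P S) {p : Plane} (hp : p ∈ P) :
    p ∉ otri t := by
  intro hpt
  obtain ⟨htP, h3⟩ := multiCdt_triple ht
  have hneg := circ_neg_of_otri (hP.nonDeg htP h3) hpt
  rcases mem_multiCdt.1 ht with ⟨hD, -⟩ | ⟨e, he, hC, -⟩
  · exact absurd ((mem_Del.1 hD).2.2 p hp) (not_le.2 hneg)
  · obtain ⟨z, hz, hze⟩ := (mem_Cdt.1 hC).2.2.2 p hpt p hp hneg
    simp only [segment_same, Set.mem_singleton_iff] at hz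
    subst hz
    exact notMem_edgeInt hP (hS e he).1 (hS e he).2 hp hze

include hconf in
theorem exists_multiCdt (hP3 : 3 ≤ #P) :
    ∃ K : Geometry.SimplicialComplex ℝ Plane, IsTriangulation P K ∧
      K.faces = {s | s.Nonempty ∧ ∃ t ∈ multiCdt P S, s ⊆ t} :=
  exists_triangulation hP hP3 _ (fun _ ht => multiCdt_triple ht)
    (fun _ ht _ ht' hne => multiCdt_disjoint hP hS hconf (by omega) ht ht' hne)
    (fun _ hx hxP => multiCdt_cover hP hS (by omega) hx hxP)
    (fun _ ht _ hp => multiCdt_empty hP hS ht hp)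

/-- The constraining edges appear. -/
theorem exists_mem_multiCdt (hP3 : 3 ≤ #P) (hnot : ∀ e ∈ S, ∀ τ ∈ Del P, ¬ e ⊆ τ)
    {e : Finset Plane} (he : e ∈ S) : ∃ t ∈ multiCdt P S, e ⊆ t := by
  obtain ⟨m, hm⟩ := edgeInt_nonempty (hS e he).2
  have hmP : m ∈ convexHull ℝ (P : Set Plane) :=
    convexHull_mono (by exact_mod_cast (hS e he).1) hm.1
  obtain ⟨t, ht, hmt⟩ := mem_iUnion_of_generic hP hP3
    (T := Cdt P e) (fun t ht => ⟨(mem_Cdt.1 ht).1, (mem_Cdt.1 ht).2.1⟩)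
    (fun x hx hxP => Cdt_cover hP (by omega) (hS e he).1 (hS e he).2 hx hxP) hmP
  obtain ⟨h1, h2, h3, -⟩ := mem_Cdt.1 ht
  have het := subset_of_mem_edgeInt hP (hS e he).1 (hS e he).2 h1 h2 hm hmt h3
  exact ⟨t, mem_multiCdt.2 (Or.inr ⟨e, he, ht, fun hD => hnot e he t hD het⟩), het⟩

omit hS in
/-- A non-Delaunay edge crosses some Delaunay triangle. -/
theorem exists_crossed (hP3 : 3 ≤ #P) {e : Finset Plane} (he : e ⊆ P) (he2 : #e = 2)
    (hnot : ∀ τ ∈ Del P, ¬ e ⊆ τ) : ∃ τ ∈ Del P, ¬ Disjoint (otri τ) (edgeInt e) := by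
  obtain ⟨m, hm⟩ := edgeInt_nonempty he2
  have hmP : m ∈ convexHull ℝ (P : Set Plane) := convexHull_mono (by exact_mod_cast he) hm.1
  obtain ⟨τ, hτ, hmt⟩ := mem_iUnion_of_generic hP hP3
    (T := Del P) (fun t ht => ⟨(mem_Del.1 ht).1, (mem_Del.1 ht).2.1⟩)
    (fun x hx hxP => Del_cover hP (by omega) hx hxP) hmP
  obtain ⟨h1, h2, -⟩ := mem_Del.1 hτ
  exact ⟨τ, hτ, fun hd => hnot τ hτ (subset_of_mem_edgeInt hP he he2 h1 h2 hm hmt hd)⟩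

/-- Edges not conflicting with the constraints and not Delaunay do not appear. -/
theorem exists_conflict_of_subset (hP3 : 3 ≤ #P) {e : Finset Plane} (he : e ⊆ P) (he2 : #e = 2)
    (hnot : ∀ τ ∈ Del P, ¬ e ⊆ τ) {t : Finset Plane} (ht : t ∈ multiCdt P S) (het : e ⊆ t) :
    ∃ e' ∈ S, Conflict P e e' := by
  rcases mem_multiCdt.1 ht with ⟨hD, -⟩ | ⟨e', he', hC, hD⟩
  · exact absurd het (hnot t hD)
  obtain ⟨τ, hτ, hd⟩ := exists_crossed hP hP3 he he2 hnot
  obtain ⟨y, hyτ, hye⟩ := Set.not_disjoint_iff.1 hd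
  obtain ⟨h1, h2, -⟩ := mem_Del.1 hτ
  obtain ⟨h1', h2'⟩ := multiCdt_triple ht
  have hyt : y ∈ convexHull ℝ (t : Set Plane) := convexHull_mono (by exact_mod_cast het) hye.1
  -- A point of `e` inside `τ` lies in the closure of the open triangle `t`, so `t` and `τ` overlap
  -- and `e'` must cross `τ` too.
  have hmeet := mem_closure_iff.1 (convexHull_subset_closure_otri (hP.nonDeg h1' h2') hyt) _
    (isOpen_otri (hP.nonDeg h1 h2)) hyτ
  obtain ⟨x, hxτ, hxt⟩ := hmeet
  exact ⟨e', he', τ, hτ, hd,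
    crossed_of_overlap hP (hS e' he').1 (hS e' he').2 hC hD hτ hxt hxτ⟩

end

/-! ### Order of triangles and the discs of a useful edge -/

/-- The circle witnessing the order is forced to be the circumcircle, so the existential definition
can be traded for `circ`. -/
theorem card_circ_le_of_isOrderTriangle {P t : Finset Plane} (h : NonDeg t) {k : ℕ}
    (hk : IsOrderTriangle P k t) : #{p ∈ P | circ t p < 0} ≤ k := by
  obtain ⟨C, hC, hle⟩ := hk
  refine le_trans (Finset.card_le_card ?_) hle
  obtain ⟨q, hq⟩ : t.Nonempty := Finset.card_pos.1 (by rw [h.1]; norm_num)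
  have hr : 0 ≤ C.radius := by
    rw [← EuclideanGeometry.mem_sphere.1 (hC q hq)]; exact dist_nonneg
  intro p hp
  rw [Finset.mem_filter] at hp ⊢
  refine ⟨hp.1, ?_⟩
  have := circ_unique h (isDisc_dist C.center (C.radius ^ 2)) (fun p hp => by
    rw [EuclideanGeometry.mem_sphere.1 (hC p hp), sub_self]) p
  have h2 : dist p C.center ^ 2 < C.radius ^ 2 := by linarith [hp.2]
  exact lt_of_pow_lt_pow_left₀ 2 hr h2

theorem isOrderTriangle_of_card_circ_le {P t : Finset Plane} (h : NonDeg t) {k : ℕ}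
    (hk : #{p ∈ P | circ t p < 0} ≤ k) : IsOrderTriangle P k t := by
  obtain ⟨o, R, hR⟩ := (isDisc_circ h).exists_center
  obtain ⟨q, hq⟩ : t.Nonempty := Finset.card_pos.1 (by rw [h.1]; norm_num)
  have hz : ∀ p ∈ t, dist p o ^ 2 = R := fun p hp => by
    linarith [hR p, circ_eq_zero h hp]
  have hR0 : 0 ≤ R := by rw [← hz q hq]; positivity
  refine ⟨⟨o, √R⟩, fun p hp => ?_, le_trans (Finset.card_le_card ?_) hk⟩
  · rw [EuclideanGeometry.mem_sphere, ← hz p hp, Real.sqrt_sq dist_nonneg]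
  · intro p hp
    rw [Finset.mem_filter] at hp ⊢
    refine ⟨hp.1, ?_⟩
    rw [hR p, sub_neg]
    exact (Real.lt_sqrt dist_nonneg).1 hp.2

theorem faces_subset {P : Finset Plane} {K : Geometry.SimplicialComplex ℝ Plane}
    (hK : IsTriangulation P K) {s : Finset Plane} (hs : s ∈ K.faces) : s ⊆ P := by
  intro p hp
  have : p ∈ K.vertices := K.down_closed hs (by simpa using hp) (by simp)
  rw [hK.1] at this
  exact this

theorem triangulation_faces_finite {P : Finset Plane} {K : Geometry.SimplicialComplex ℝ Plane}
    (hK : IsTriangulation P K) : K.faces.Finite :=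
  P.powerset.finite_toSet.subset fun s hs => by simpa using faces_subset hK hs

/-! ### The pencil of circles through two points -/

/-- The circle with diameter `u v`. -/
def diam (u v x : Plane) : ℝ := (x 0 - u 0) * (x 0 - v 0) + (x 1 - u 1) * (x 1 - v 1)

theorem isDisc_diam (u v : Plane) : IsDisc (diam u v) := by
  refine ⟨(-(u 0 + v 0)) • (EuclideanSpace.proj (0 : Fin 2) : Plane →L[ℝ] ℝ).toLinearMap +
    (-(u 1 + v 1)) • (EuclideanSpace.proj (1 : Fin 2) : Plane →L[ℝ] ℝ).toLinearMap,
    u 0 * v 0 + u 1 * v 1, ?_⟩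
  intro x
  simp only [diam, EuclideanSpace.norm_sq_eq, Fin.sum_univ_two, Real.norm_eq_abs, sq_abs]
  simp
  ring

/-- The parameter of the circle through `u`, `v`, `p` in the pencil of circles through `u`, `v`. -/
def pencil (u v p : Plane) : ℝ := diam u v p / side u v p

theorem nonDeg_of_side {u v p : Plane} (h : side u v p ≠ 0) : NonDeg {u, v, p} := by
  have huv : u ≠ v := by rintro rfl; simp [side] at h
  have hup : u ≠ p := by rintro rfl; simp at h
  have hvp : v ≠ p := by rintro rfl; simp at h
  refine ⟨Finset.card_eq_three.2 ⟨u, v, p, huv, hup, hvp, rfl⟩, fun hc => h ?_⟩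
  obtain ⟨d, hd⟩ := (collinear_iff_of_mem (p₀ := u) (by simp)).1 hc
  obtain ⟨r, hr⟩ := hd v (by simp)
  obtain ⟨r', hr'⟩ := hd p (by simp)
  rw [hr, hr']
  simp [side]; ring

theorem circ_eq_pencil {u v p : Plane} (h : side u v p ≠ 0) (x : Plane) :
    circ {u, v, p} x = diam u v x - pencil u v p * side u v x := by
  have hD : IsDisc fun x => diam u v x - pencil u v p * side u v x := by
    simpa [sub_eq_add_neg] using
      (isDisc_diam u v).add_affine ((side_affine u v).const_mul (-pencil u v p))
  refine (circ_unique (nonDeg_of_side h) hD ?_ x).symm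
  intro q hq
  simp only [Finset.mem_insert, Finset.mem_singleton] at hq
  rcases hq with rfl | rfl | rfl
  · simp [diam]
  · simp [diam]
  · rw [pencil, div_mul_cancel₀ _ h, sub_self]

/-- On each side of the line `u v`, lying inside the circle through `u`, `v`, `p` is thus decided by
comparing pencil parameters. -/
theorem circ_eq_mul {u v p : Plane} (h : side u v p ≠ 0) {q : Plane} (hq : side u v q ≠ 0) :
    circ {u, v, p} q = side u v q * (pencil u v q - pencil u v p) := by
  rw [circ_eq_pencil h, mul_sub, pencil, pencil, mul_div_cancel₀ _ hq]
  ring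

/-- The first zero of two affine functions along a segment. -/
theorem exists_first_zero {g h : Plane → ℝ} (hg : IsAffine g) (hh : IsAffine h) {x p : Plane}
    (hgx : 0 < g x) (hhx : 0 < h x) (hp : g p < 0 ∨ h p < 0) :
    ∃ y ∈ segment ℝ x p, (g y = 0 ∧ 0 ≤ h y) ∨ (h y = 0 ∧ 0 ≤ g y) := by
  have key : ∀ {g h : Plane → ℝ}, IsAffine g → IsAffine h → 0 < g x → 0 < h x → g p < 0 →
      ∃ y ∈ segment ℝ x p, (g y = 0 ∧ 0 ≤ h y) ∨ (h y = 0 ∧ 0 ≤ g y) := by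
    intro g h hg hh hgx hhx hgp
    obtain ⟨y, hy, hgy⟩ := hg.exists_zero hgx hgp
    have hys := openSegment_subset_segment _ _ _ hy
    rcases le_or_gt 0 (h y) with h0 | h0
    · exact ⟨y, hys, Or.inl ⟨hgy, h0⟩⟩
    · obtain ⟨z, hz, hhz⟩ := hh.exists_zero hhx h0
      have hzs := openSegment_subset_segment _ _ _ hz
      have hzp : z ∈ segment ℝ x p :=
        (convex_segment x p).segment_subset (left_mem_segment ℝ x p) hys hzs
      refine ⟨z, hzp, Or.inr ⟨hhz, ?_⟩⟩
      have h1 : x ∈ {w | 0 ≤ g w} := hgx.le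
      have h2 : y ∈ {w | 0 ≤ g w} := hgy.ge
      exact (hg.convex_ge 0).segment_subset h1 h2 hzs
  rcases hp with hp | hp
  · exact key hg hh hgx hhx hp
  · obtain ⟨y, hy, h⟩ := key hh hg hhx hgx hp
    exact ⟨y, hy, h.symm⟩

theorem IsAffine.pos_of_openSegment {f : Plane → ℝ} (hf : IsAffine f) {x y z : Plane}
    (hz : z ∈ openSegment ℝ x y) (hx : f x = 0) : 0 < f z ↔ 0 < f y := by
  obtain ⟨a, b, ha, hb, hab, rfl⟩ := hz
  rw [hf.combo hab, hx, mul_zero, zero_add]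
  exact mul_pos_iff_of_pos_left hb

section
variable {P : Finset Plane} (hP : GeneralPosition P)
include hP

theorem GeneralPosition.eq_of_side_eq_zero {u v p : Plane} (hu : u ∈ P) (hv : v ∈ P) (hp : p ∈ P)
    (huv : u ≠ v) (h : side u v p = 0) : p = u ∨ p = v := by
  by_contra hc
  push Not at hc
  exact hP.side_ne hu hv hp huv hc.1.symm hc.2.symm h

/-- Faces meet in the hull of their common vertices, here at most `{a}`; but `a` cannot lie on the
open edge by general position. -/
theorem not_cross_edges {K : Geometry.SimplicialComplex ℝ Plane} (hK : IsTriangulation P K)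
    {u v s a : Plane} (huv : u ≠ v) (he : {u, v} ∈ K.faces) (hsa : {s, a} ∈ K.faces)
    (hsu : s ≠ u) (hsv : s ≠ v) {z : Plane} (hz : z ∈ segment ℝ s a)
    (hzo : z ∈ openSegment ℝ u v) : False := by
  have heP := faces_subset hK he
  have hsP := faces_subset hK hsa
  have h1 : z ∈ convexHull ℝ ((({s, a} : Finset Plane) : Set Plane) ∩ ({u, v} : Finset Plane)) :=
    K.inter_subset_convexHull hsa he ⟨by simpa using hz,
      by simpa using openSegment_subset_segment _ _ _ hzo⟩
  have h2 : z ∈ convexHull ℝ ({a} : Set Plane) := by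
    refine convexHull_mono ?_ h1
    rintro w ⟨hw1, hw2⟩
    simp only [Finset.coe_insert, Finset.coe_singleton, Set.mem_insert_iff,
      Set.mem_singleton_iff] at hw1 hw2 ⊢
    rcases hw1 with rfl | h
    · rcases hw2 with h | h
      exacts [absurd h hsu, absurd h hsv]
    · exact h
  simp only [convexHull_singleton, Set.mem_singleton_iff] at h2
  subst h2
  exact hP.notMem_openSegment (heP (by simp)) (heP (by simp)) (hsP (by simp)) huv hzo

/-- The triangle of a triangulation around a vertex in a prescribed direction. -/
theorem exists_triangle_at (hP2 : 2 ≤ #P) {K : Geometry.SimplicialComplex ℝ Plane}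
    (hK : IsTriangulation P K) {T : Finset Plane} (hTP : T ⊆ P) (hT : #T = 3) {s : Plane}
    (hs : s ∈ T) : ∃ t ∈ K.faces, #t = 3 ∧ s ∈ t ∧ ∃ x ∈ otri T, x ∈ otri t := by
  have hnd := hP.nonDeg hTP hT
  have hsP := hTP hs
  have hsK : {s} ∈ K.faces := by
    have : s ∈ K.vertices := by rw [hK.1]; exact hsP
    exact this
  -- The faces missing `s` form a closed set that does not contain `s`. A generic point of `T`
  -- outside it is covered by a face with vertex `s`.
  set C : Set Plane := ⋃ t ∈ {t ∈ K.faces | s ∉ t}, convexHull ℝ (t : Set Plane)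
  have hC : IsClosed C := ((triangulation_faces_finite hK).subset fun t ht => ht.1).isClosed_biUnion
    fun t _ => (t.finite_toSet.isCompact_convexHull (𝕜 := ℝ)).isClosed
  have hsC : s ∉ C := by
    simp only [C, Set.mem_iUnion]
    rintro ⟨t, ⟨ht, hst⟩, hs⟩
    have := K.inter_subset_convexHull hsK ht ⟨by simp, hs⟩
    rw [← Finset.coe_inter, Finset.singleton_inter_of_notMem hst] at this
    simp at this
  obtain ⟨x, ⟨hxC, hxT⟩, hxg⟩ := exists_generic P (hC.isOpen_compl.inter (isOpen_otri hnd))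
    (mem_closure_iff.1 (convexHull_subset_closure_otri hnd (subset_convexHull ℝ _ hs)) _
      hC.isOpen_compl hsC)
  have hxP : x ∈ K.space := by
    rw [hK.2]
    exact convexHull_mono (by exact_mod_cast hTP) (otri_subset hnd hxT)
  obtain ⟨t, ht, hxt⟩ := Geometry.SimplicialComplex.mem_space_iff.1 hxP
  have hst : s ∈ t := by
    by_contra hst
    exact hxC (Set.mem_biUnion (show t ∈ {t ∈ K.faces | s ∉ t} from ⟨ht, hst⟩) hxt)
  have htP := faces_subset hK ht
  have h3 : #t = 3 := by
    have hle : #t ≤ 3 := by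
      have h1 := (K.indep ht).card_le_finrank_succ
      have h3 := Submodule.finrank_le (vectorSpan ℝ (Set.range ((↑) : t → Plane)))
      simp at h1 h3
      omega
    by_contra hne
    exact hxg.notMem_convexHull hP2 htP (by omega) hxt
  exact ⟨t, ht, h3, hst, x, hxT, hxg.mem_otri hP htP h3 hxt⟩

/-- For an edge of an order-`k` triangulation there is a disc through its endpoints with at most
`k` points inside, all on the right of the edge. -/
theorem exists_side_disc {k : ℕ} {K : Geometry.SimplicialComplex ℝ Plane}
    (hK : IsOrderTriangulation P k K) {u v : Plane} (huv : u ≠ v) (he : {u, v} ∈ K.faces)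
    (hl : ∃ p ∈ P, 0 < side u v p) :
    ∃ B : Plane → ℝ, ∃ s ∈ P, IsDisc B ∧ B u = 0 ∧ B v = 0 ∧ B s = 0 ∧ 0 < side u v s ∧
      (∀ p ∈ P, 0 < side u v p → 0 ≤ B p) ∧ #{p ∈ P | B p < 0} ≤ k := by
  have heP := faces_subset hK.1 he
  have hu : u ∈ P := heP (by simp)
  have hv : v ∈ P := heP (by simp)
  -- The least pencil parameter on the left gives a circle with no point of `P` inside on that side.
  obtain ⟨s, hs, hmin⟩ := Finset.exists_min_image (P.filter fun p => 0 < side u v p)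
    (pencil u v) (by obtain ⟨p, hp, h⟩ := hl; exact ⟨p, Finset.mem_filter.2 ⟨hp, h⟩⟩)
  rw [Finset.mem_filter] at hs
  obtain ⟨hsP, hs0⟩ := hs
  have hnd := nonDeg_of_side hs0.ne'
  set T : Finset Plane := {u, v, s} with hT
  set B := circ T with hBdef
  have hB : IsDisc B := isDisc_circ hnd
  have hTP : T ⊆ P := by
    intro q hq
    simp only [hT, Finset.mem_insert, Finset.mem_singleton] at hq
    rcases hq with rfl | rfl | rfl <;> assumption
  have huT : u ∈ T := by simp [hT]
  have hvT : v ∈ T := by simp [hT]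
  have hsT : s ∈ T := by simp [hT]
  have hsu : s ≠ u := by rintro rfl; simp at hs0
  have hsv : s ≠ v := by rintro rfl; simp at hs0
  have hBu : B u = 0 := circ_eq_zero hnd huT
  have hBv : B v = 0 := circ_eq_zero hnd hvT
  have hBs : B s = 0 := circ_eq_zero hnd hsT
  have hleft : ∀ p ∈ P, 0 < side u v p → 0 ≤ B p := by
    intro p hp h0
    rw [hBdef, circ_eq_mul hs0.ne' h0.ne']
    exact mul_nonneg h0.le (sub_nonneg.2 (hmin p (Finset.mem_filter.2 ⟨hp, h0⟩)))
  have hP2 : 2 ≤ #P := by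
    have := Finset.card_le_card hTP
    have := hnd.1
    omega
  obtain ⟨t, ht, h3, hst, x, hxT, hxt⟩ := exists_triangle_at hP hP2 hK.1 hTP hnd.1 hsT
  have htP := faces_subset hK.1 ht
  have hndt := hP.nonDeg htP h3
  obtain ⟨m, hm⟩ : (openSegment ℝ u v).Nonempty :=
    ⟨_, 1 / 2, 1 / 2, by norm_num, by norm_num, by norm_num, rfl⟩
  have hBm : B m < 0 := hB.neg_of_openSegment hBu.le hBv.le huv hm
  have hline : ∀ z, B z < 0 → side u v z = 0 → z ∈ openSegment ℝ u v := fun z hz hz0 =>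
    mem_openSegment_of_convex hB.convex huv hBm hm (by simp [hBu]) (by simp [hBv]) hz hz0
  have hcross : ∀ a ∈ t, a ≠ s → ∀ z ∈ segment ℝ s a, z ∈ openSegment ℝ u v → False := by
    intro a ha has z hz hzo
    refine not_cross_edges hP hK.1 huv he (K.down_closed ht ?_ (by simp)) hsu hsv hz hzo
    simp [Finset.insert_subset_iff, hst, ha]
  -- the discs through `s`: neighbours of `s` in the triangle lie outside `B`
  have hA1 : ∀ a ∈ t, 0 ≤ B a := by
    intro a ha
    by_contra hneg
    push Not at hneg
    have has : a ≠ s := by rintro rfl; linarith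
    have hside : side u v a < 0 := by
      rcases lt_trichotomy (side u v a) 0 with h | h | h
      · exact h
      · rcases hP.eq_of_side_eq_zero hu hv (htP ha) huv h with rfl | rfl <;> linarith
      · linarith [hleft a (htP ha) h]
    obtain ⟨z, hz, hz0⟩ := (side_affine u v).exists_zero hs0 hside
    exact hcross a ha has z (openSegment_subset_segment _ _ _ hz)
      (hline z (hB.neg_of_openSegment hBs.le hneg.le has.symm hz) hz0)
  obtain ⟨hba, hb1, hb0, hbs, hbx⟩ := bc_spec hnd
  have hsideT : ∀ z, side u v z = bc T s z * side u v s := by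
    intro z
    rw [hnd.eval (side_affine u v) z, Finset.sum_eq_single s]
    · intro q hq hqs
      simp only [hT, Finset.mem_insert, Finset.mem_singleton] at hq
      rcases hq with rfl | rfl | rfl <;> simp at hqs ⊢
    · exact fun h => absurd hsT h
  have hopen : ∀ z, side u v z = 0 → 0 < bc T u z → 0 < bc T v z → z ∈ openSegment ℝ u v := by
    intro z hz hzu hzv
    have hzs : bc T s z = 0 := by
      have := hsideT z
      rw [hz] at this
      exact (mul_eq_zero.1 this.symm).resolve_right hs0.ne'
    have e1 := hbs z
    have e2 := hbx z
    rw [hT, Finset.sum_insert (by simp [huv, hsu.symm]), Finset.sum_pair hsv.symm] at e1 e2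
    rw [← hT, hzs] at e1 e2
    exact ⟨_, _, hzu, hzv, by linarith, by simpa using e2⟩
  -- No vertex of `t` lies in the open wedge at `s` spanned by `u` and `v`: beyond `u v` its edge to
  -- `s` would cross `u v`, and inside `T` it would be inside `B`.
  have hA2 : ∀ a ∈ t, ¬ (0 < bc T u a ∧ 0 < bc T v a) := by
    rintro a ha ⟨hau, hav⟩
    have has : a ≠ s := by
      rintro rfl
      rw [hb0 u huT _ hsT hsu.symm] at hau
      exact lt_irrefl _ hau
    rcases lt_trichotomy (bc T s a) 0 with h | h | h
    · obtain ⟨z, hz, hz0⟩ := (hba s).exists_zero (by rw [hb1 s hsT]; norm_num) h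
      refine hcross a ha has z (openSegment_subset_segment _ _ _ hz) (hopen z ?_ ?_ ?_)
      · rw [hsideT, hz0, zero_mul]
      · exact ((hba u).pos_of_openSegment hz (hb0 u huT s hsT hsu.symm)).2 hau
      · exact ((hba v).pos_of_openSegment hz (hb0 v hvT s hsT hsv.symm)).2 hav
    · have h0 : side u v a = 0 := by rw [hsideT, h, zero_mul]
      rcases hP.eq_of_side_eq_zero hu hv (htP ha) huv h0 with rfl | rfl
      · rw [hb0 v hvT _ huT huv.symm] at hav; exact lt_irrefl _ hav
      · rw [hb0 u huT _ hvT huv] at hau; exact lt_irrefl _ hau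
    · have : a ∈ otri T := by
        intro q hq
        simp only [hT, Finset.mem_insert, Finset.mem_singleton] at hq
        rcases hq with rfl | rfl | rfl <;> assumption
      exact absurd (circ_neg_of_otri hnd this) (not_lt.2 (hA1 a ha))
  obtain ⟨a, b, hab, htab⟩ : ∃ a b, a ≠ b ∧ t.erase s = {a, b} :=
    Finset.card_eq_two.1 (by rw [Finset.card_erase_of_mem hst, h3])
  have hat : a ∈ t := Finset.mem_of_mem_erase (show a ∈ t.erase s by simp [htab])
  have hbt : b ∈ t := Finset.mem_of_mem_erase (show b ∈ t.erase s by simp [htab])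
  have heval : ∀ f : Plane → ℝ, IsAffine f → f s = 0 → ∀ y,
      f y = bc t a y * f a + bc t b y * f b := by
    intro f hf hfs y
    rw [hndt.eval hf y, ← Finset.add_sum_erase t _ hst, htab, Finset.sum_pair hab, hfs]
    ring
  refine ⟨B, s, hsP, hB, hBu, hBv, hBs, hs0, hleft,
    le_trans (Finset.card_le_card ?_) (card_circ_le_of_isOrderTriangle hndt (hK.2 t ht h3))⟩
  intro p hp
  rw [Finset.mem_filter] at hp ⊢
  refine ⟨hp.1, ?_⟩
  have hside : side u v p < 0 := by
    rcases lt_trichotomy (side u v p) 0 with h | h | h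
    · exact h
    · rcases hP.eq_of_side_eq_zero hu hv hp.1 huv h with rfl | rfl <;> linarith [hp.2]
    · linarith [hleft p hp.1 h, hp.2]
  have hps : s ≠ p := by rintro rfl; linarith
  obtain ⟨z, hz, hz0⟩ := (side_affine u v).exists_zero hs0 hside
  have hzo := hline z (hB.neg_of_openSegment hBs.le hp.2.le hps hz) hz0
  have hpu : 0 < bc T u p := by
    rw [← (hba u).pos_of_openSegment hz (hb0 u huT s hsT hsu.symm), 
      (hba u).pos_of_openSegment (openSegment_symm ℝ u v ▸ hzo) (hb0 u huT v hvT huv), hb1 u huT]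
    norm_num
  have hpv : 0 < bc T v p := by
    rw [← (hba v).pos_of_openSegment hz (hb0 v hvT s hsT hsv.symm), 
      (hba v).pos_of_openSegment hzo (hb0 v hvT u huT huv.symm), hb1 v hvT]
    norm_num
  -- The wedge of `t` at `s` contains `p`: otherwise the walk from `x` to `p`, which stays in the
  -- wedge of `T`, leaves the wedge of `t` through the ray of `a` or `b` and puts that vertex into
  -- the wedge of `T`.
  have hgood : 0 ≤ bc t a p ∧ 0 ≤ bc t b p := by
    by_contra hc
    have hc' : bc t a p < 0 ∨ bc t b p < 0 := by
      by_contra h; push Not at h; exact hc h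
    obtain ⟨y, hy, hy0⟩ := exists_first_zero ((bc_spec hndt).1 a) ((bc_spec hndt).1 b)
      (hxt a hat) (hxt b hbt) hc'
    have hyu : 0 < bc T u y := ((hba u).convex_gt 0).segment_subset (hxT u huT) hpu hy
    have hyv : 0 < bc T v y := ((hba v).convex_gt 0).segment_subset (hxT v hvT) hpv hy
    rw [heval _ (hba u) (hb0 u huT s hsT hsu.symm)] at hyu
    rw [heval _ (hba v) (hb0 v hvT s hsT hsv.symm)] at hyv
    rcases hy0 with ⟨h0, h1⟩ | ⟨h0, h1⟩
    · rw [h0, zero_mul, zero_add] at hyu hyv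
      exact hA2 b hbt ⟨pos_of_mul_pos_right hyu h1, pos_of_mul_pos_right hyv h1⟩
    · rw [h0, zero_mul, add_zero] at hyu hyv
      exact hA2 a hat ⟨pos_of_mul_pos_right hyu h1, pos_of_mul_pos_right hyv h1⟩
  -- `circ t - B` vanishes at `s` and is nonpositive at `a` and `b`, so it is nonpositive on the
  -- wedge of `t`. Hence `B p < 0` forces `circ t p < 0`.
  have hfp := heval _ ((isDisc_circ hndt).sub hB)
    (by simp [circ_eq_zero hndt hst, hBs]) p
  rw [circ_eq_zero hndt hat, circ_eq_zero hndt hbt] at hfp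
  nlinarith [mul_nonneg hgood.1 (hA1 a hat), mul_nonneg hgood.2 (hA1 b hbt), hp.2]

/-- Triangles of the Delaunay triangulation constrained by a useful-`k` edge have order `k`. -/
theorem card_circ_le_of_mem_Cdt {k : ℕ} {K : Geometry.SimplicialComplex ℝ Plane}
    (hK : IsOrderTriangulation P k K) {e t : Finset Plane} (he2 : #e = 2) (he : e ∈ K.faces)
    (ht : t ∈ Cdt P e) : #{p ∈ P | circ t p < 0} ≤ k := by
  have heP := faces_subset hK.1 he
  obtain ⟨h1, h2, h3, h4⟩ := mem_Cdt.1 ht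
  have hnd := hP.nonDeg h1 h2
  obtain ⟨x, hxt, hxg⟩ := exists_generic P (isOpen_otri hnd) (otri_nonempty hnd)
  obtain ⟨u, v, huv, rfl, hx⟩ : ∃ u v, u ≠ v ∧ e = {u, v} ∧ 0 < side u v x := by
    obtain ⟨u, v, huv, rfl⟩ := Finset.card_eq_two.1 he2
    rcases lt_or_gt_of_ne (hxg u (heP (by simp)) v (heP (by simp)) huv) with h | h
    · exact ⟨v, u, huv.symm, Finset.pair_comm u v, by rw [side_swap]; linarith⟩
    · exact ⟨u, v, huv, rfl, h⟩
  have hu : u ∈ P := heP (by simp)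
  have hv : v ∈ P := heP (by simp)
  rw [edgeInt_pair huv] at h3 h4
  have hS := side_affine u v
  rcases Finset.eq_empty_or_nonempty {p ∈ P | circ t p < 0} with h0 | ⟨p₀, hp₀⟩
  · rw [h0]; simp
  rw [Finset.mem_filter] at hp₀
  have hend : ∀ w, w = u ∨ w = v → 0 ≤ circ t w := by
    intro w hw
    by_contra hneg
    obtain ⟨z, hz, hzo⟩ := h4 x hxt w (by rcases hw with rfl | rfl <;> assumption) (not_le.1 hneg)
    exact Set.disjoint_left.1 (disjoint_segment_endpoint huv hx.ne' hw) hz hzo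
  have hcu := hend u (Or.inl rfl)
  have hcv := hend v (Or.inr rfl)
  have hC := (isDisc_circ hnd).convex
  have hcross : ∀ p ∈ P, circ t p < 0 → ∃ z ∈ segment ℝ x p, z ∈ openSegment ℝ u v ∧
      circ t z < 0 := by
    intro p hp hneg
    obtain ⟨z, hz, hzo⟩ := h4 x hxt p hp hneg
    exact ⟨z, hz, hzo, hC.segment_subset (circ_neg_of_otri hnd hxt) hneg hz⟩
  obtain ⟨z₀, hz₀, hzo₀, hzc₀⟩ := hcross p₀ hp₀.1 hp₀.2
  have hne : ∀ w ∈ otri t, side u v w ≠ 0 := fun w hw h0 =>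
    Set.disjoint_left.1 h3 hw (mem_openSegment_of_convex hC huv hzc₀ hzo₀ (not_lt.2 hcu)
      (not_lt.2 hcv) (circ_neg_of_otri hnd hw) h0)
  have hvert : ∀ a ∈ t, 0 ≤ side u v a := by
    intro a ha
    by_contra hneg
    push Not at hneg
    obtain ⟨z, hz, hz0⟩ := hS.exists_zero hx hneg
    rcases segment_otri hnd hxt (subset_convexHull ℝ _ ha) (openSegment_subset_segment _ _ _ hz)
      with rfl | h
    · linarith
    · exact hne z h hz0
  obtain ⟨a, ha, ha0⟩ : ∃ a ∈ t, 0 < side u v a := by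
    by_contra hc
    push Not at hc
    exact absurd (hnd.nonpos hS hc (otri_subset hnd hxt)) (not_le.2 hx)
  obtain ⟨B, s, hs, hB, hBu, hBv, -, -, hleft, hcard⟩ :=
    exists_side_disc hP hK huv he ⟨a, h1 ha, ha0⟩
  refine le_trans (Finset.card_le_card ?_) hcard
  intro p hp
  rw [Finset.mem_filter] at hp ⊢
  refine ⟨hp.1, ?_⟩
  -- `circ t - B` is nonpositive on the triangle and nonnegative on `e`, so it stays nonnegative
  -- past `e` on the segment to `p`. Hence `B p ≤ circ t p < 0`.
  have hf := (isDisc_circ hnd).sub hB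
  have hfx : circ t x - B x ≤ 0 := by
    refine hnd.nonpos hf (fun q hq => ?_) (otri_subset hnd hxt)
    rw [circ_eq_zero hnd hq]
    rcases eq_or_lt_of_le (hvert q hq) with h | h
    · rcases hP.eq_of_side_eq_zero hu hv (h1 hq) huv h.symm with rfl | rfl <;> linarith
    · linarith [hleft q (h1 hq) h]
  obtain ⟨z, hz, hzo, -⟩ := hcross p hp.1 hp.2
  have hfz : 0 ≤ circ t z - B z :=
    (hf.convex_ge 0).segment_subset (by simpa [hBu] using hcu) (by simpa [hBv] using hcv)
      (openSegment_subset_segment _ _ _ hzo)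
  have := hf.nonneg_beyond hz (by rintro rfl; exact hx.ne' (openSegment_side hzo)) hfx hfz
  linarith [hp.2]

end

/-! ### Delaunay edges crossed by a useful edge -/

/-- The edges of the Delaunay triangulation. -/
def delEdges (P : Finset Plane) : Finset (Finset Plane) :=
  (Del P).biUnion fun τ => τ.powersetCard 2

theorem mem_delEdges {P g : Finset Plane} : g ∈ delEdges P ↔ ∃ τ ∈ Del P, g ⊆ τ ∧ #g = 2 := by
  simp [delEdges, Finset.mem_powersetCard]

/-- Two edges cross. -/
def Cross (e g : Finset Plane) : Prop := (edgeInt e ∩ edgeInt g).Nonempty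

/-- The segment `u v` crosses `a b` at `q`, with `a` on its left. -/
structure CrossAt (u v a b q : Plane) : Prop where
  mem_uv : q ∈ openSegment ℝ u v
  mem_ab : q ∈ openSegment ℝ a b
  pos : 0 < side u v a
  neg : side u v b < 0

theorem CrossAt.swap {u v a b q : Plane} (h : CrossAt u v a b q) : CrossAt v u b a q :=
  ⟨openSegment_symm ℝ u v ▸ h.1, openSegment_symm ℝ a b ▸ h.2,
    by rw [side_swap]; linarith [h.4], by rw [side_swap]; linarith [h.3]⟩

/-- The values of `side a b` at `u` and `v` have a vanishing positive combination, because `q` is on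
both lines, and the difference of the two is positive. -/
theorem CrossAt.side_pos {u v a b q : Plane} (h : CrossAt u v a b q) :
    side a b u < 0 ∧ 0 < side a b v := by
  have h0 := openSegment_side h.mem_ab
  obtain ⟨s, r, hs, hr, hsr, rfl⟩ := h.mem_uv
  rw [(side_affine a b).combo hsr] at h0
  have h1 : side a b v - side a b u = side u v a - side u v b := by simp only [side]; ring
  have h2 := h.pos
  have h3 := h.neg
  have h4 : 0 < side a b v := by
    by_contra hc
    push Not at hc
    have h5 : side a b u < 0 := by linarith
    nlinarith [mul_pos hs (neg_pos.2 h5), mul_nonneg hr.le (neg_nonneg.2 hc)]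
  refine ⟨?_, h4⟩
  by_contra hc
  push Not at hc
  nlinarith [mul_pos hr h4, mul_nonneg hs.le hc]

/-- A point of the disc `D` through `a`, `b`, `v` lying beyond the line through `q` and `v` (as seen
from `c`) is in the disc `B`. -/
theorem neg_of_disc_comparison {D B S σ : Plane → ℝ} (hD : IsDisc D) (hB : IsDisc B)
    (hS : IsAffine S) (hσ : IsAffine σ) {c q v y : Plane} (hDc : D c = 0) (hBc : 0 ≤ B c)
    (hDv : D v = 0) (hBv : B v = 0) (hDq : D q < 0) (hq : B q ≤ D q) (hσc : σ c = 0)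
    (hσq : σ q = 0) (hσv : 0 < σ v) (hσy : 0 < σ y) (hSc : 0 < S c) (hSy : S y < 0)
    (hS0 : ∀ z, S z = 0 → side q v z = 0) (hy : D y < 0) : B y < 0 := by
  have hqv : q ≠ v := by rintro rfl; linarith
  have hcy : c ≠ y := by rintro rfl; linarith
  obtain ⟨z, hz, hz0⟩ := hS.exists_zero hSc hSy
  have hzD : D z < 0 := hD.neg_of_openSegment hDc.le hy.le hcy hz
  have hzσ : 0 < σ z := (hσ.pos_of_openSegment hz hσc).2 hσy
  obtain ⟨m, hm⟩ : (openSegment ℝ q v).Nonempty :=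
    ⟨_, 1 / 2, 1 / 2, by norm_num, by norm_num, by norm_num, rfl⟩
  -- Inside `D` and strictly beyond the line `σ = 0`, the line through `q` and `v` reduces to the
  -- open segment between them.
  have hzo : z ∈ openSegment ℝ q v := by
    refine mem_openSegment_of_convex (hD.convex.inter (hσ.convex_gt 0)) hqv (y := m)
      ⟨hD.neg_of_openSegment hDq.le hDv.le hqv hm, (hσ.pos_of_openSegment hm hσq).2 hσv⟩ hm
      (fun h => ?_) (fun h => ?_) ⟨hzD, hzσ⟩ (hS0 z hz0)
    · exact absurd h.2 (by simp [hσq])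
    · exact absurd h.1 (by simp [hDv])
  have hf := hD.sub hB
  have hfz : 0 ≤ D z - B z := by
    have h1 : q ∈ {x | 0 ≤ D x - B x} := sub_nonneg.2 hq
    have h2 : v ∈ {x | 0 ≤ D x - B x} := by simp [hDv, hBv]
    exact (hf.convex_ge 0).segment_subset h1 h2 (openSegment_subset_segment _ _ _ hzo)
  have := hf.nonneg_beyond (openSegment_subset_segment _ _ _ hz) (by rintro rfl; linarith)
    (by linarith) hfz
  linarith

theorem side_of_mem_openSegment {u v q z : Plane} (hq : q ∈ openSegment ℝ u v)
    (hz : side u v z = 0) : side q v z = 0 := by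
  obtain ⟨s, r, hs, hr, hsr, rfl⟩ := hq
  obtain rfl : r = 1 - s := by linarith
  have : side (s • u + (1 - s) • v) v z = s * side u v z := by simp [side]; ring
  rw [this, hz, mul_zero]

/-- Endpoints on the positive side of `a b` which edges crossing `a b` can have. -/
def cand (P : Finset Plane) (k : ℕ) (a b : Plane) : Finset Plane :=
  {v ∈ P | 0 < side a b v ∧ #{p ∈ P | 0 < side a b p ∧ circ {a, b, v} p < 0} ≤ 2 * k - 2}

/-- All other qualifying elements have smaller value than the largest qualifying one, whose rank is
at most `n`. -/
theorem card_low_rank_le {ι : Type*} (W : Finset ι) (f : ι → ℝ) (hf : Set.InjOn f W) (n : ℕ) :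
    #{u ∈ W | #{p ∈ W | f p < f u} ≤ n} ≤ n + 1 := by
  set C := W.filter fun u => #{p ∈ W | f p < f u} ≤ n
  rcases C.eq_empty_or_nonempty with h | h
  · simp [h]
  obtain ⟨u, hu, hmax⟩ := C.exists_max_image f h
  have hCW : C ⊆ W := Finset.filter_subset _ _
  have hsub : C.erase u ⊆ {p ∈ W | f p < f u} := by
    intro p hp
    rw [Finset.mem_erase] at hp
    exact Finset.mem_filter.2 ⟨hCW hp.2, lt_of_le_of_ne (hmax p hp.2)
      fun h => hp.1 (hf (hCW hp.2) (hCW hu) h)⟩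
  have h1 := Finset.card_le_card hsub
  have h2 := (Finset.mem_filter.1 hu).2
  rw [Finset.card_erase_of_mem hu] at h1
  omega

section
variable {P : Finset Plane} (hP : GeneralPosition P)
include hP

theorem pencil_injOn {a b : Plane} (ha : a ∈ P) (hb : b ∈ P) {p q : Plane} (hp : p ∈ P)
    (hq : q ∈ P) (hpa : side a b p ≠ 0) (hqa : side a b q ≠ 0)
    (h : pencil a b p = pencil a b q) : p = q := by
  have hnd := nonDeg_of_side hqa
  have h0 : circ {a, b, q} p = 0 := by rw [circ_eq_mul hqa hpa, h, sub_self, mul_zero]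
  have := hP.mem_of_circle (isDisc_circ hnd) (t := {a, b, q})
    (by simp [Finset.insert_subset_iff, ha, hb, hq]) hnd.1 (fun x hx => circ_eq_zero hnd hx) hp h0
  simp only [Finset.mem_insert, Finset.mem_singleton] at this
  rcases this with rfl | rfl | h
  · simp at hpa
  · simp at hpa
  · exact h

/-- On the positive side of `a b`, the points in the circle of `v` are exactly those of smaller
pencil parameter, so candidates have rank at most `2 * k - 2`. -/
theorem card_cand_le {a b : Plane} (ha : a ∈ P) (hb : b ∈ P) {k : ℕ} (hk : 1 ≤ k) :
    #(cand P k a b) ≤ 2 * k - 1 := by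
  have hinj : Set.InjOn (pencil a b) (P.filter fun p => 0 < side a b p : Finset Plane) := by
    intro p hp q hq h
    simp only [Finset.coe_filter, Set.mem_ofPred_eq] at hp hq
    exact pencil_injOn hP ha hb hp.1 hq.1 hp.2.ne' hq.2.ne' h
  have := card_low_rank_le _ _ hinj (2 * k - 2)
  refine le_trans (Finset.card_le_card ?_) (this.trans (by omega))
  intro v hv
  simp only [cand, Finset.mem_filter] at hv ⊢
  obtain ⟨hvP, hv0, hle⟩ := hv
  refine ⟨⟨hvP, hv0⟩, le_trans (Finset.card_le_card ?_) hle⟩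
  intro p hp
  simp only [Finset.mem_filter] at hp ⊢
  refine ⟨hp.1.1, hp.1.2, ?_⟩
  rw [circ_eq_mul hv0.ne' hp.1.2.ne']
  exact mul_neg_of_pos_of_neg hp.1.2 (by linarith [hp.2])

theorem Cross.exists_crossAt {u v : Plane} (hu : u ∈ P) (hv : v ∈ P) (huv : u ≠ v)
    {g : Finset Plane} (hg : g ⊆ P) (hg2 : #g = 2) (hne : g ≠ {u, v}) (h : Cross {u, v} g) :
    ∃ a b q, g = {a, b} ∧ CrossAt u v a b q := by
  obtain ⟨a, b, hab, rfl⟩ := Finset.card_eq_two.1 hg2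
  obtain ⟨q, hq, hq'⟩ := h
  rw [edgeInt_pair huv] at hq
  rw [edgeInt_pair hab] at hq'
  have ha : a ∈ P := hg (by simp)
  have hb : b ∈ P := hg (by simp)
  have h0 := openSegment_side hq
  have hsum : ∃ s r : ℝ, 0 < s ∧ 0 < r ∧ s * side u v a + r * side u v b = 0 := by
    obtain ⟨s, r, hs, hr, hsr, rfl⟩ := hq'
    rw [(side_affine u v).combo hsr] at h0
    exact ⟨s, r, hs, hr, h0⟩
  obtain ⟨s, r, hs, hr, hsr⟩ := hsum
  have hne0 : side u v a ≠ 0 := by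
    intro ha0
    have hb0 : side u v b = 0 := by
      rw [ha0, mul_zero, zero_add] at hsr
      exact (mul_eq_zero.1 hsr).resolve_left hr.ne'
    apply hne
    rcases hP.eq_of_side_eq_zero hu hv ha huv ha0 with rfl | rfl <;>
      rcases hP.eq_of_side_eq_zero hu hv hb huv hb0 with rfl | rfl
    · exact absurd rfl hab
    · rfl
    · exact Finset.pair_comm _ _
    · exact absurd rfl hab
  rcases lt_or_gt_of_ne hne0 with h1 | h1
  · have h2 : 0 < side u v b := by
      by_contra hc
      push Not at hc
      nlinarith [mul_pos hs (neg_pos.2 h1), mul_nonneg hr.le (neg_nonneg.2 hc)]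
    exact ⟨b, a, q, Finset.pair_comm a b, hq, openSegment_symm ℝ a b ▸ hq', h2, h1⟩
  · have h2 : side u v b < 0 := by
      by_contra hc
      push Not at hc
      nlinarith [mul_pos hs h1, mul_nonneg hr.le hc]
    exact ⟨a, b, q, rfl, hq, hq', h1, h2⟩

/-- Take for `Δ` the empty circumcircle of a Delaunay triangle on `a b`. `Δ - B` is nonnegative at
`u` and `v`, hence at `q`, and nonpositive at `a`, hence nonnegative at `b`, which puts `b` in the
closed disc `B`. -/
theorem neg_of_crossAt {u v a b q s : Plane} (hu : u ∈ P) (hv : v ∈ P) (hs : s ∈ P)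
    {B : Plane → ℝ} (hB : IsDisc B) (hBu : B u = 0) (hBv : B v = 0) (hBs : B s = 0)
    (hs0 : 0 < side u v s) (hleft : ∀ p ∈ P, 0 < side u v p → 0 ≤ B p)
    (hab : {a, b} ∈ delEdges P) (hc : CrossAt u v a b q) :
    ∃ Δ : Plane → ℝ, IsDisc Δ ∧ Δ a = 0 ∧ Δ b = 0 ∧ 0 ≤ B a ∧ B b < 0 ∧ B q ≤ Δ q := by
  obtain ⟨τ, hτ, habτ, -⟩ := mem_delEdges.1 hab
  obtain ⟨h1, h2, h3⟩ := mem_Del.1 hτ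
  have hnd := hP.nonDeg h1 h2
  have haτ : a ∈ τ := habτ (by simp)
  have hbτ : b ∈ τ := habτ (by simp)
  have hBa := hleft a (h1 haτ) hc.pos
  have hf := (isDisc_circ hnd).sub hB
  have hΔa := circ_eq_zero hnd haτ
  have hΔb := circ_eq_zero hnd hbτ
  have hfq : 0 ≤ circ τ q - B q := by
    have hu' : u ∈ {x | 0 ≤ circ τ x - B x} := by simp [hBu, h3 u hu]
    have hv' : v ∈ {x | 0 ≤ circ τ x - B x} := by simp [hBv, h3 v hv]
    exact (hf.convex_ge 0).segment_subset hu' hv' (openSegment_subset_segment _ _ _ hc.mem_uv)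
  have hqa : q ≠ a := by
    rintro rfl
    exact hc.pos.ne' (openSegment_side hc.mem_uv)
  have hfb := hf.nonneg_beyond (openSegment_subset_segment _ _ _ hc.mem_ab) hqa
    (by linarith) hfq
  refine ⟨circ τ, isDisc_circ hnd, hΔa, hΔb, hBa, ?_, by linarith⟩
  refine lt_of_le_of_ne (by linarith) fun hBb => ?_
  -- Strictness: the circle `B` already carries the three points `u`, `v`, `s` of `P`, and `b` is
  -- none of them.
  have hndT := nonDeg_of_side hs0.ne'
  have := hP.mem_of_circle hB (t := {u, v, s})
    (by simp [Finset.insert_subset_iff, hu, hv, hs]) hndT.1 (fun x hx => by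
      simp only [Finset.mem_insert, Finset.mem_singleton] at hx
      rcases hx with rfl | rfl | rfl <;> assumption) (h1 hbτ) hBb
  have hneg := hc.neg
  simp only [Finset.mem_insert, Finset.mem_singleton] at this
  rcases this with rfl | rfl | rfl
  · simp at hneg
  · simp at hneg
  · linarith

omit hP in
theorem delEdges_subset {g : Finset Plane} (hg : g ∈ delEdges P) : g ⊆ P ∧ #g = 2 := by
  obtain ⟨τ, hτ, hgτ, h2⟩ := mem_delEdges.1 hg
  exact ⟨hgτ.trans (mem_Del.1 hτ).1, h2⟩

/-- The right endpoints of the Delaunay edges crossing a useful edge lie in a disc with few points,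
which bounds the parts of the discs through such an edge. -/
theorem disc_of_crossAt {k : ℕ} {K : Geometry.SimplicialComplex ℝ Plane}
    (hK : IsOrderTriangulation P k K) {u v : Plane} (huv : u ≠ v) (he : {u, v} ∈ K.faces)
    (hl : ∃ p ∈ P, 0 < side u v p) :
    ∃ B : Plane → ℝ, IsDisc B ∧ B u = 0 ∧ B v = 0 ∧ #{p ∈ P | B p < 0} ≤ k ∧
      ∀ a b q, {a, b} ∈ delEdges P → CrossAt u v a b q →
        ∃ Δ : Plane → ℝ, IsDisc Δ ∧ Δ a = 0 ∧ Δ b = 0 ∧ 0 ≤ B a ∧ B b < 0 ∧ B q ≤ Δ q := by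
  have heP := faces_subset hK.1 he
  obtain ⟨B, s, hs, hB, hBu, hBv, hBs, hs0, hleft, hcard⟩ := exists_side_disc hP hK huv he hl
  exact ⟨B, hB, hBu, hBv, hcard, fun a b q hab hc =>
    neg_of_crossAt hP (heP (by simp)) (heP (by simp)) hs hB hBu hBv hBs hs0 hleft hab hc⟩

/-- The part beyond `a b` of the disc through `a`, `b`, `v` is covered by the discs `B` and `B'`
attached to the two sides of `u v`. -/
theorem mem_cand_of_crossAt {k : ℕ} {K : Geometry.SimplicialComplex ℝ Plane}
    (hK : IsOrderTriangulation P k K) {u v a b q : Plane} (huv : u ≠ v) (he : {u, v} ∈ K.faces)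
    (hab : {a, b} ∈ delEdges P) (hc : CrossAt u v a b q) : v ∈ cand P k a b := by
  have heP := faces_subset hK.1 he
  have hu : u ∈ P := heP (by simp)
  have hv : v ∈ P := heP (by simp)
  have habP : ({a, b} : Finset Plane) ⊆ P := by
    obtain ⟨τ, hτ, h, -⟩ := mem_delEdges.1 hab
    exact h.trans (mem_Del.1 hτ).1
  have ha : a ∈ P := habP (by simp)
  have hb : b ∈ P := habP (by simp)
  obtain ⟨hσu, hσv⟩ := hc.side_pos
  obtain ⟨B, hB, hBu, hBv, hcard, hBab⟩ := disc_of_crossAt hP hK huv he ⟨a, ha, hc.pos⟩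
  obtain ⟨Δ, hΔ, hΔa, hΔb, hBa, hBb, hBq⟩ := hBab a b q hab hc
  obtain ⟨B', hB', hBv', hBu', hcard', hBab'⟩ :=
    disc_of_crossAt hP hK huv.symm (by rwa [Finset.pair_comm]) ⟨b, hb, hc.swap.pos⟩
  obtain ⟨Δ', hΔ', hΔb', hΔa', hBb', hBa', hBq'⟩ :=
    hBab' b a q (by rwa [Finset.pair_comm]) hc.swap
  have hnd := nonDeg_of_side hσv.ne'
  have hD := isDisc_circ hnd
  set D := circ {a, b, v}
  have hDa : D a = 0 := circ_eq_zero hnd (by simp)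
  have hDb : D b = 0 := circ_eq_zero hnd (by simp)
  have hDv : D v = 0 := circ_eq_zero hnd (by simp)
  have habne : a ≠ b := by rintro rfl; linarith [hc.pos, hc.neg]
  have hDq : D q < 0 := hD.neg_of_openSegment hDa.le hDb.le habne hc.mem_ab
  -- The power of `q` is the same for all circles through `a` and `b`, since `q` lies on this chord.
  have hsame : ∀ {E : Plane → ℝ}, IsDisc E → E a = 0 → E b = 0 → E q = D q := by
    intro E hE hEa hEb
    have hf := hE.sub hD
    obtain ⟨s, r, hs, hr, hsr, hq⟩ := hc.mem_ab
    have := hf.combo hsr a b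
    rw [hq, hEa, hEb, hDa, hDb] at this
    linarith
  rw [hsame hΔ hΔa hΔb] at hBq
  rw [hsame hΔ' hΔa' hΔb'] at hBq'
  have hσq := openSegment_side hc.mem_ab
  have hsub : {p ∈ P | 0 < side a b p ∧ D p < 0} ⊆
      ({p ∈ P | B p < 0} : Finset Plane).erase b ∪ ({p ∈ P | B' p < 0} : Finset Plane).erase a := by
    intro y hy
    rw [Finset.mem_filter] at hy
    obtain ⟨hyP, hσy, hDy⟩ := hy
    simp only [Finset.mem_union, Finset.mem_erase, Finset.mem_filter]
    have hya : y ≠ a := by rintro rfl; simp at hσy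
    have hyb : y ≠ b := by rintro rfl; simp at hσy
    rcases lt_trichotomy (side u v y) 0 with h | h | h
    · refine Or.inl ⟨hyb, hyP, ?_⟩
      exact neg_of_disc_comparison hD hB (side_affine u v) (side_affine a b) hDa hBa hDv hBv hDq
        hBq (by simp) hσq hσv hσy hc.pos h (fun z hz => side_of_mem_openSegment hc.mem_uv hz) hDy
    · rcases hP.eq_of_side_eq_zero hu hv hyP huv h with rfl | rfl <;> linarith
    · refine Or.inr ⟨hya, hyP, ?_⟩
      refine neg_of_disc_comparison hD hB' (side_affine v u) (side_affine a b) hDb hBb' hDv hBv'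
        hDq hBq' (by simp) hσq hσv hσy hc.swap.pos (by rw [side_swap]; linarith)
        (fun z hz => side_of_mem_openSegment hc.mem_uv ?_) hDy
      rw [side_swap] at hz
      linarith
  -- Each disc holds an endpoint of `a b` that is not counted, so the bound is `(k - 1) + (k - 1)`.
  have hbm : b ∈ ({p ∈ P | B p < 0} : Finset Plane) := Finset.mem_filter.2 ⟨hb, hBb⟩
  have ham : a ∈ ({p ∈ P | B' p < 0} : Finset Plane) := Finset.mem_filter.2 ⟨ha, hBa'⟩
  have h1 := Finset.card_le_card hsub
  have h2 := Finset.card_union_le (({p ∈ P | B p < 0} : Finset Plane).erase b)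
    (({p ∈ P | B' p < 0} : Finset Plane).erase a)
  rw [Finset.card_erase_of_mem hbm, Finset.card_erase_of_mem ham] at h2
  have h3 := Finset.card_pos.2 ⟨b, hbm⟩
  have h4 := Finset.card_pos.2 ⟨a, ham⟩
  refine Finset.mem_filter.2 ⟨hv, hσv, ?_⟩
  change #{p ∈ P | 0 < side a b p ∧ D p < 0} ≤ 2 * k - 2
  omega

end

/-! ### Davenport–Schinzel counting -/

section
variable {γ ι : Type*} {G : Finset γ} {φ : γ → ℝ} (hφ : Set.InjOn φ G)
  {s : γ → γ} (hs : ∀ g ∈ G, (∃ h ∈ G, φ g < φ h) →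
    s g ∈ G ∧ φ g < φ (s g) ∧ ∀ h ∈ G, φ g < φ h → φ (s g) ≤ φ h)
include hφ hs

/-- At each change from `g` to its successor `s g`, either the label of `g` occurs for the last time
or that of `s g` for the first time; otherwise the labels alternate. The last label has no final
change and the first no initial one, hence `#A - 1` twice. -/
theorem card_label_changes_le {α : γ → ι} {A : Finset ι} (hA : ∀ g ∈ G, α g ∈ A)
    (hab : ∀ g₁ ∈ G, ∀ g₂ ∈ G, ∀ g₃ ∈ G, ∀ g₄ ∈ G, φ g₁ < φ g₂ → φ g₂ < φ g₃ → φ g₃ < φ g₄ →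
      α g₁ = α g₃ → α g₂ = α g₄ → α g₁ = α g₂) :
    #{g ∈ G | (∃ h ∈ G, φ g < φ h) ∧ α g ≠ α (s g)} ≤ 2 * (#A - 1) := by
  rcases G.eq_empty_or_nonempty with hG | hG
  · simp [hG]
  obtain ⟨M, hM, hmax⟩ := G.exists_max_image φ hG
  obtain ⟨m, hm, hmin⟩ := G.exists_min_image φ hG
  set C := {g ∈ G | (∃ h ∈ G, φ g < φ h) ∧ α g ≠ α (s g)} with hC
  set L := {g ∈ C | ∀ h ∈ G, φ g < φ h → α h ≠ α g}
  set F := {g ∈ C | ∀ h ∈ G, φ h < φ (s g) → α h ≠ α (s g)}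
  have hCG : ∀ g ∈ C, g ∈ G ∧ (∃ h ∈ G, φ g < φ h) ∧ α g ≠ α (s g) := fun g hg =>
    Finset.mem_filter.1 hg
  have hsub : C ⊆ L ∪ F := by
    intro g hg
    by_contra hc
    simp only [L, F, Finset.mem_union, Finset.mem_filter, hg, true_and, not_or] at hc
    push Not at hc
    obtain ⟨⟨h', hh', hlt', hα'⟩, h, hh, hlt, hα⟩ := hc
    obtain ⟨hgG, hex, hne⟩ := hCG g hg
    obtain ⟨hsG, hsg, hsmin⟩ := hs g hgG hex
    have h1 : φ h < φ g := by
      by_contra h1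
      rcases eq_or_lt_of_le (not_lt.1 h1) with h2 | h2
      · have := hφ hgG hh h2
        subst this
        exact hne hα
      · linarith [hsmin h hh h2]
    have h2 : φ (s g) < φ h' := by
      refine lt_of_le_of_ne (hsmin h' hh' hlt') fun h3 => ?_
      have := hφ hsG hh' h3
      rw [← this] at hα'
      exact hne hα'.symm
    have := hab h hh g hgG (s g) hsG h' hh' h1 hsg h2 hα hα'.symm
    exact hne (this.symm.trans hα)
  have hL : #L ≤ #(A.erase (α M)) := by
    refine Finset.card_le_card_of_injOn α (fun g hg => ?_) (fun g hg g' hg' h => ?_)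
    · have hg := Finset.mem_filter.1 hg
      obtain ⟨hgG, ⟨h, hh, hlt⟩, -⟩ := hCG g hg.1
      refine Finset.mem_erase.2 ⟨fun hα => hg.2 M hM (lt_of_lt_of_le hlt (hmax h hh)) hα.symm,
        hA g hgG⟩
    · have hg := Finset.mem_filter.1 hg
      have hg' := Finset.mem_filter.1 hg'
      have hgG := (hCG g hg.1).1
      have hgG' := (hCG g' hg'.1).1
      rcases lt_trichotomy (φ g) (φ g') with h1 | h1 | h1
      · exact absurd h.symm (hg.2 g' hgG' h1)
      · exact hφ hgG hgG' h1
      · exact absurd h (hg'.2 g hgG h1)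
  have hF : #F ≤ #(A.erase (α m)) := by
    refine Finset.card_le_card_of_injOn (fun g => α (s g)) (fun g hg => ?_)
      (fun g hg g' hg' h => ?_)
    · have hg := Finset.mem_filter.1 hg
      obtain ⟨hgG, hex, -⟩ := hCG g hg.1
      obtain ⟨hsG, hsg, -⟩ := hs g hgG hex
      exact Finset.mem_erase.2 ⟨fun hα => hg.2 m hm (lt_of_le_of_lt (hmin g hgG) hsg) hα.symm,
        hA _ hsG⟩
    · have hg := Finset.mem_filter.1 hg
      have hg' := Finset.mem_filter.1 hg'
      obtain ⟨hgG, hex, -⟩ := hCG g hg.1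
      obtain ⟨hgG', hex', -⟩ := hCG g' hg'.1
      obtain ⟨hsG, hsg, hsmin⟩ := hs g hgG hex
      obtain ⟨hsG', hsg', hsmin'⟩ := hs g' hgG' hex'
      have hss : s g = s g' := by
        rcases lt_trichotomy (φ (s g)) (φ (s g')) with h1 | h1 | h1
        · exact absurd h (hg'.2 _ hsG h1)
        · exact hφ hsG hsG' h1
        · exact absurd h.symm (hg.2 _ hsG' h1)
      rcases lt_trichotomy (φ g) (φ g') with h1 | h1 | h1
      · have := hsmin g' hgG' h1
        rw [hss] at this
        linarith
      · exact hφ hgG hgG' h1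
      · have := hsmin' g hgG h1
        rw [← hss] at this
        linarith
  rw [Finset.card_erase_of_mem (hA M hM)] at hL
  rw [Finset.card_erase_of_mem (hA m hm)] at hF
  have h1 := Finset.card_le_card hsub
  have h2 := Finset.card_union_le L F
  omega

end

/-- The pair of labels determines the element, so each step changes at least one of the two labels.
-/
theorem card_le_of_no_alternation {γ ι : Type*} {G : Finset γ} {φ : γ → ℝ} (hφ : Set.InjOn φ G)
    {α β : γ → ι} (hinj : ∀ g ∈ G, ∀ g' ∈ G, α g = α g' → β g = β g' → g = g')
    {A B : Finset ι} (hA : ∀ g ∈ G, α g ∈ A) (hB : ∀ g ∈ G, β g ∈ B)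
    (hα : ∀ g₁ ∈ G, ∀ g₂ ∈ G, ∀ g₃ ∈ G, ∀ g₄ ∈ G, φ g₁ < φ g₂ → φ g₂ < φ g₃ → φ g₃ < φ g₄ →
      α g₁ = α g₃ → α g₂ = α g₄ → α g₁ = α g₂)
    (hβ : ∀ g₁ ∈ G, ∀ g₂ ∈ G, ∀ g₃ ∈ G, ∀ g₄ ∈ G, φ g₁ < φ g₂ → φ g₂ < φ g₃ → φ g₃ < φ g₄ →
      β g₁ = β g₃ → β g₂ = β g₄ → β g₁ = β g₂) :
    #G ≤ 2 * (#A - 1) + 2 * (#B - 1) + 1 := by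
  have hex : ∀ g, ∃ x, g ∈ G → (∃ h ∈ G, φ g < φ h) →
      x ∈ G ∧ φ g < φ x ∧ ∀ h ∈ G, φ g < φ h → φ x ≤ φ h := by
    intro g
    by_cases h : ∃ h ∈ G, φ g < φ h
    · obtain ⟨x, hx, hmin⟩ := (G.filter fun h => φ g < φ h).exists_min_image φ
        (by obtain ⟨h, hh, hlt⟩ := h; exact ⟨h, Finset.mem_filter.2 ⟨hh, hlt⟩⟩)
      rw [Finset.mem_filter] at hx
      exact ⟨x, fun _ _ => ⟨hx.1, hx.2, fun h hh hlt => hmin h (Finset.mem_filter.2 ⟨hh, hlt⟩)⟩⟩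
    · exact ⟨g, fun _ h' => absurd h' h⟩
  choose s hs using hex
  rcases G.eq_empty_or_nonempty with hG | hG
  · simp [hG]
  obtain ⟨M, hM, hmax⟩ := G.exists_max_image φ hG
  have hsub : G ⊆ insert M ({g ∈ G | (∃ h ∈ G, φ g < φ h) ∧ α g ≠ α (s g)} ∪
      {g ∈ G | (∃ h ∈ G, φ g < φ h) ∧ β g ≠ β (s g)}) := by
    intro g hg
    by_cases hgM : g = M
    · simp [hgM]
    have hlt : ∃ h ∈ G, φ g < φ h :=
      ⟨M, hM, lt_of_le_of_ne (hmax g hg) fun h => hgM (hφ hg hM h)⟩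
    obtain ⟨hsG, hsg, -⟩ := hs g hg hlt
    by_cases h1 : α g = α (s g)
    · have h2 : β g ≠ β (s g) := fun h2 => by
        have := hinj g hg _ hsG h1 h2
        rw [← this] at hsg
        exact lt_irrefl _ hsg
      exact Finset.mem_insert_of_mem
        (Finset.mem_union_right _ (Finset.mem_filter.2 ⟨hg, hlt, h2⟩))
    · exact Finset.mem_insert_of_mem
        (Finset.mem_union_left _ (Finset.mem_filter.2 ⟨hg, hlt, h1⟩))
  have h1 := Finset.card_le_card hsub
  have h2 := Finset.card_insert_le M ({g ∈ G | (∃ h ∈ G, φ g < φ h) ∧ α g ≠ α (s g)} ∪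
      {g ∈ G | (∃ h ∈ G, φ g < φ h) ∧ β g ≠ β (s g)})
  have h3 := Finset.card_union_le {g ∈ G | (∃ h ∈ G, φ g < φ h) ∧ α g ≠ α (s g)}
      {g ∈ G | (∃ h ∈ G, φ g < φ h) ∧ β g ≠ β (s g)}
  have h4 := card_label_changes_le hφ hs hA hα
  have h5 := card_label_changes_le hφ hs hB hβ
  omega

/-! ### The number of Delaunay edges crossed by a useful edge -/

/-- Of three segments descending to a line, a higher one landing between two others with a common
lower apex must cross one of them. -/
theorem exists_meet_of_interleaved {u v a a' : Plane} (huv : u ≠ v) {r : ℝ} (hr : 0 < r)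
    (hr1 : r ≤ 1) (hside : side u v a' = r * side u v a) {x₁ x₂ x₃ : ℝ} (h12 : x₁ < x₂)
    (h23 : x₂ < x₃) :
    ∃ z ∈ segment ℝ (u + x₂ • (v - u)) a, (z ∈ segment ℝ (u + x₁ • (v - u)) a' ∨
      z ∈ segment ℝ (u + x₃ • (v - u)) a') ∧ ∃ ρ : ℝ, 0 < ρ ∧ side u v z = ρ * side u v a := by
  set X : ℝ → Plane := fun x => u + x • (v - u)
  -- `κ` measures the shift, parallel to the line, of `a'` from the point at its height on the
  -- segment from `X x₂` to `a`. Its sign decides which of the two segments to `a'` is met.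
  obtain ⟨κ, hκ⟩ : ∃ κ : ℝ, a' = X x₂ + r • (a - X x₂) + κ • (v - u) := by
    obtain ⟨κ, hκ⟩ := exists_of_side_eq_zero (p := u + (a' - (X x₂ + r • (a - X x₂)))) huv (by
      simp only [side, X] at hside ⊢
      simp
      linear_combination hside)
    refine ⟨κ, ?_⟩
    have := add_left_cancel hκ
    rw [← this]
    abel
  have main : ∀ τ : ℝ, 0 < τ → τ ≤ 1 → ∀ x : ℝ, (x₂ - x) * (1 - τ) = τ * κ →
      ∃ z ∈ segment ℝ (X x₂) a, z ∈ segment ℝ (X x) a' ∧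
        ∃ ρ : ℝ, 0 < ρ ∧ side u v z = ρ * side u v a := by
    intro τ h0 h1 x hx
    refine ⟨(1 - τ * r) • X x₂ + (τ * r) • a, ⟨1 - τ * r, τ * r, by nlinarith, by positivity,
      by ring, rfl⟩, ⟨1 - τ, τ, by linarith, h0.le, by ring, ?_⟩, τ * r, by positivity, ?_⟩
    · rw [hκ]
      have e : (1 - τ) • X x + τ • (X x₂ + r • (a - X x₂) + κ • (v - u)) =
          (1 - τ * r) • X x₂ + (τ * r) • a + (τ * κ - (x₂ - x) * (1 - τ)) • (v - u) := by
        simp only [X]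
        module
      rw [e, hx, sub_self, zero_smul, add_zero]
    · rw [(side_affine u v).combo (by ring)]
      have : side u v (X x₂) = 0 := by simp [side, X]; ring
      rw [this]
      ring
  rcases le_or_gt 0 κ with h | h
  · have hd : 0 < (x₂ - x₁) + κ := by linarith
    obtain ⟨z, hz, hz', hρ⟩ := main ((x₂ - x₁) / ((x₂ - x₁) + κ)) (div_pos (by linarith) hd)
      ((div_le_one hd).2 (by linarith)) x₁ (by field_simp; ring)
    exact ⟨z, hz, Or.inl hz', hρ⟩
  · have hd : 0 < (x₃ - x₂) - κ := by linarith
    obtain ⟨z, hz, hz', hρ⟩ := main ((x₃ - x₂) / ((x₃ - x₂) - κ)) (div_pos (by linarith) hd)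
      ((div_le_one hd).2 (by linarith)) x₃ (by field_simp; ring)
    exact ⟨z, hz, Or.inr hz', hρ⟩

/-- The Delaunay edges crossing `e`. -/
def crossEdges (P e : Finset Plane) : Finset (Finset Plane) := {g ∈ delEdges P | Cross e g}

theorem exists_param_of_mem_openSegment {u v q : Plane} (h : q ∈ openSegment ℝ u v) :
    ∃ x : ℝ, q = u + x • (v - u) := by
  obtain ⟨s, r, hs, hr, hsr, rfl⟩ := h
  obtain rfl : s = 1 - r := by linarith
  exact ⟨r, by module⟩

section
variable {P : Finset Plane} (hP : GeneralPosition P)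
include hP

theorem delEdges_inter_subset (hP3 : 3 ≤ #P) {g g' : Finset Plane} (hg : g ∈ delEdges P)
    (hg' : g' ∈ delEdges P) : convexHull ℝ (g : Set Plane) ∩ convexHull ℝ (g' : Set Plane) ⊆
      convexHull ℝ ((g ∩ g' : Finset Plane) : Set Plane) := by
  obtain ⟨τ, hτ, hgτ, -⟩ := mem_delEdges.1 hg
  obtain ⟨τ', hτ', hgτ', -⟩ := mem_delEdges.1 hg'
  refine hP.face_inter_subset hP3 (mem_Del.1 hτ).1 (mem_Del.1 hτ).2.1 (mem_Del.1 hτ').1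
    (mem_Del.1 hτ').2.1 (fun hne => ?_) hgτ hgτ'
  rw [Set.disjoint_left]
  exact fun x hx hx' => hne (Del_unique hP hτ hτ' hx hx')

/-- Two Delaunay edges with distinct endpoints on one side of a line do not meet on that side. -/
theorem delEdges_no_meet (hP3 : 3 ≤ #P) {a b a' b' z : Plane} (hg : {a, b} ∈ delEdges P)
    (hg' : {a', b'} ∈ delEdges P) {S : Plane → ℝ} (hS : IsAffine S) (ha : 0 < S a) (hb : S b < 0)
    (hb' : S b' < 0) (hne : a ≠ a')
    (hz : z ∈ segment ℝ a b) (hz' : z ∈ segment ℝ a' b') (hSz : 0 < S z) : False := by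
  have h := delEdges_inter_subset hP hP3 hg hg' (a := z) ⟨by simpa using hz, by simpa using hz'⟩
  have : S z ≤ 0 := by
    refine convexHull_min ?_ (hS.convex_le 0) h
    intro w hw
    simp only [Finset.coe_inter, Finset.coe_insert, Finset.coe_singleton, Set.mem_inter_iff,
      Set.mem_insert_iff, Set.mem_singleton_iff] at hw
    obtain ⟨rfl | rfl, h2 | h2⟩ := hw
    · exact absurd h2 hne
    · subst h2; linarith
    · exact hb.le
    · exact hb.le
  linarith

/-- The endpoints on one side of the Delaunay edges crossing a segment form an alternation-free
sequence. -/
theorem no_alternation (hP3 : 3 ≤ #P) {u v : Plane} (huv : u ≠ v) {S : Plane → ℝ}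
    (hS : IsAffine S) (hSu : S = side u v ∨ S = fun z => -side u v z)
    {a₁ a₂ a₃ a₄ b₁ b₂ b₃ b₄ : Plane} {x₁ x₂ x₃ x₄ : ℝ}
    (h₁ : {a₁, b₁} ∈ delEdges P) (h₂ : {a₂, b₂} ∈ delEdges P) (h₃ : {a₃, b₃} ∈ delEdges P)
    (h₄ : {a₄, b₄} ∈ delEdges P)
    (ha₁ : 0 < S a₁) (ha₂ : 0 < S a₂) (ha₃ : 0 < S a₃) (ha₄ : 0 < S a₄)
    (hb₁ : S b₁ < 0) (hb₂ : S b₂ < 0) (hb₃ : S b₃ < 0) (hb₄ : S b₄ < 0)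
    (hx₁ : u + x₁ • (v - u) ∈ segment ℝ a₁ b₁) (hx₂ : u + x₂ • (v - u) ∈ segment ℝ a₂ b₂)
    (hx₃ : u + x₃ • (v - u) ∈ segment ℝ a₃ b₃) (hx₄ : u + x₄ • (v - u) ∈ segment ℝ a₄ b₄)
    (h12 : x₁ < x₂) (h23 : x₂ < x₃) (h34 : x₃ < x₄) (h13 : a₁ = a₃) (h24 : a₂ = a₄) :
    a₁ = a₂ := by
  by_contra hne
  -- Planarity: an edge landing between two edges with common upper endpoint `a'` must have an upper
  -- endpoint lower than `a'`. An alternation makes each of two points lower than the other.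
  have key : ∀ {a a' b b' c' : Plane} {y₁ y₂ y₃ : ℝ}, {a, b} ∈ delEdges P →
      {a', b'} ∈ delEdges P → {a', c'} ∈ delEdges P → 0 < S a → 0 < S a' → S b < 0 → S b' < 0 →
      S c' < 0 → u + y₂ • (v - u) ∈ segment ℝ a b → u + y₁ • (v - u) ∈ segment ℝ a' b' →
      u + y₃ • (v - u) ∈ segment ℝ a' c' → y₁ < y₂ → y₂ < y₃ → a ≠ a' → S a < S a' := by
    intro a a' b b' c' y₁ y₂ y₃ hg hg' hg'' ha ha' hb hb' hc' hy₂ hy₁ hy₃ l1 l2 hne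
    by_contra hle
    push Not at hle
    have hside : side u v a' = S a' / S a * side u v a := by
      rcases hSu with h | h
      · rw [h] at ha ⊢
        field_simp
      · simp only [h] at ha ⊢
        have : side u v a ≠ 0 := by intro h0; simp [h0] at ha
        field_simp
    obtain ⟨z, hz, hz', ρ, hρ, hzρ⟩ := exists_meet_of_interleaved huv (div_pos ha' ha)
      ((div_le_one ha).2 hle) hside l1 l2
    have hSz : 0 < S z := by
      rcases hSu with h | h
      · rw [h] at ha ⊢
        rw [hzρ]; positivity
      · simp only [h] at ha ⊢
        rw [hzρ]; nlinarith
    have hzab : z ∈ segment ℝ a b :=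
      (convex_segment a b).segment_subset hy₂ (left_mem_segment ℝ a b) hz
    rcases hz' with hz' | hz'
    · exact delEdges_no_meet hP hP3 hg hg' hS ha hb hb' hne hzab
        ((convex_segment a' b').segment_subset hy₁ (left_mem_segment ℝ a' b') hz') hSz
    · exact delEdges_no_meet hP hP3 hg hg'' hS ha hb hc' hne hzab
        ((convex_segment a' c').segment_subset hy₃ (left_mem_segment ℝ a' c') hz') hSz
  subst h13 h24
  have l1 := key h₂ h₁ h₃ ha₂ ha₁ hb₂ hb₁ hb₃ hx₂ hx₁ hx₃ h12 h23 (Ne.symm hne)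
  have l2 := key h₃ h₂ h₄ ha₁ ha₂ hb₃ hb₂ hb₄ hx₃ hx₂ hx₄ h23 h34 hne
  linarith

/-- Ordered by crossing parameter, the left and right endpoints are alternation-free sequences over
at most `k` points each, namely those in the two side discs. Hence the bound `2 * (k - 1) + 2 * (k -
1) + 1`. -/
theorem card_crossEdges_le (hP3 : 3 ≤ #P) {k : ℕ} (hk : 1 ≤ k)
    {K : Geometry.SimplicialComplex ℝ Plane}
    (hK : IsOrderTriangulation P k K) {e : Finset Plane} (he2 : #e = 2) (he : e ∈ K.faces)
    (hnot : e ∉ delEdges P) : #(crossEdges P e) ≤ 4 * k - 3 := by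
  rcases (crossEdges P e).eq_empty_or_nonempty with h0 | ⟨g₀, hg₀⟩
  · simp [h0]
  have heP := faces_subset hK.1 he
  obtain ⟨u, v, huv, rfl⟩ := Finset.card_eq_two.1 he2
  have hu : u ∈ P := heP (by simp)
  have hv : v ∈ P := heP (by simp)
  have hex : ∀ g, ∃ a b : Plane, ∃ x : ℝ, g ∈ crossEdges P {u, v} → g = {a, b} ∧
      CrossAt u v a b (u + x • (v - u)) := by
    intro g
    by_cases hg : g ∈ crossEdges P {u, v}
    · obtain ⟨hgD, hgc⟩ := Finset.mem_filter.1 hg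
      obtain ⟨hgP, hg2⟩ := delEdges_subset hgD
      obtain ⟨a, b, q, rfl, hc⟩ := hgc.exists_crossAt hP hu hv huv hgP hg2
        (fun h => hnot (h ▸ hgD))
      obtain ⟨x, rfl⟩ := exists_param_of_mem_openSegment hc.mem_uv
      exact ⟨a, b, x, fun _ => ⟨rfl, hc⟩⟩
    · exact ⟨u, u, 0, fun h => absurd h hg⟩
  choose α β φ hαβ using hex
  have hD : ∀ g ∈ crossEdges P {u, v}, {α g, β g} ∈ delEdges P := fun g hg => by
    rw [← (hαβ g hg).1]; exact (Finset.mem_filter.1 hg).1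
  have hαpos : ∀ g ∈ crossEdges P {u, v}, 0 < side u v (α g) := fun g hg => (hαβ g hg).2.pos
  have hβneg : ∀ g ∈ crossEdges P {u, v}, side u v (β g) < 0 := fun g hg => (hαβ g hg).2.neg
  have hseg : ∀ g ∈ crossEdges P {u, v}, u + φ g • (v - u) ∈ segment ℝ (α g) (β g) :=
    fun g hg => openSegment_subset_segment _ _ _ (hαβ g hg).2.mem_ab
  have hinj : ∀ g ∈ crossEdges P {u, v}, ∀ g' ∈ crossEdges P {u, v}, α g = α g' → β g = β g' →
      g = g' := fun g hg g' hg' h1 h2 => by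
    rw [(hαβ g hg).1, (hαβ g' hg').1, h1, h2]
  have hφ : Set.InjOn φ (crossEdges P {u, v}) := by
    -- Two crossed Delaunay edges meeting on the line `u v` would meet in the hull of their common
    -- endpoints; if they are distinct, this lies strictly on one side.
    intro g hg g' hg' h
    by_contra hne
    have hg := Finset.mem_coe.1 hg
    have hg' := Finset.mem_coe.1 hg'
    have hm := delEdges_inter_subset hP hP3 (hD g hg) (hD g' hg') (a := u + φ g • (v - u))
      ⟨by simpa using hseg g hg, by rw [h]; simpa using hseg g' hg'⟩
    have hz : side u v (u + φ g • (v - u)) = 0 := openSegment_side (hαβ g hg).2.mem_uv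
    have p1 := hαpos g hg
    have p2 := hαpos g' hg'
    have n1 := hβneg g hg
    have n2 := hβneg g' hg'
    by_cases hα : α g = α g'
    · have : side u v (u + φ g • (v - u)) ∈ Set.Ioi (0 : ℝ) := by
        refine convexHull_min ?_ ((side_affine u v).convex_gt 0) hm
        intro w hw
        simp only [Finset.coe_inter, Finset.coe_insert, Finset.coe_singleton, Set.mem_inter_iff,
          Set.mem_insert_iff, Set.mem_singleton_iff] at hw
        obtain ⟨rfl | rfl, h2 | h2⟩ := hw
        · exact p1
        · exact p1
        · rw [h2] at n1; linarith
        · exact absurd (hinj g hg g' hg' hα h2) hne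
      rw [hz] at this
      exact absurd this (by simp)
    · have : side u v (u + φ g • (v - u)) ∈ Set.Iio (0 : ℝ) := by
        refine convexHull_min ?_ ((side_affine u v).convex_lt 0) hm
        intro w hw
        simp only [Finset.coe_inter, Finset.coe_insert, Finset.coe_singleton, Set.mem_inter_iff,
          Set.mem_insert_iff, Set.mem_singleton_iff] at hw
        obtain ⟨rfl | rfl, h2 | h2⟩ := hw
        · exact absurd h2 hα
        · rw [h2] at p1; linarith
        · exact n1
        · exact n1
      rw [hz] at this
      exact absurd this (by simp)
  have hαP : ∀ g ∈ crossEdges P {u, v}, α g ∈ P := fun g hg =>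
    (delEdges_subset (hD g hg)).1 (by simp)
  have hβP : ∀ g ∈ crossEdges P {u, v}, β g ∈ P := fun g hg =>
    (delEdges_subset (hD g hg)).1 (by simp)
  obtain ⟨B, -, -, -, hcard, hBab⟩ := disc_of_crossAt hP hK huv he
    ⟨α g₀, hαP g₀ hg₀, hαpos g₀ hg₀⟩
  obtain ⟨B', -, -, -, hcard', hBab'⟩ := disc_of_crossAt hP hK huv.symm
    (by rwa [Finset.pair_comm]) ⟨β g₀, hβP g₀ hg₀, (hαβ g₀ hg₀).2.swap.pos⟩
  have hβB : ∀ g ∈ crossEdges P {u, v}, β g ∈ ({p ∈ P | B p < 0} : Finset Plane) := by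
    intro g hg
    obtain ⟨-, -, -, -, -, h, -⟩ := hBab _ _ _ (hD g hg) (hαβ g hg).2
    exact Finset.mem_filter.2 ⟨hβP g hg, h⟩
  have hαB : ∀ g ∈ crossEdges P {u, v}, α g ∈ ({p ∈ P | B' p < 0} : Finset Plane) := by
    intro g hg
    obtain ⟨-, -, -, -, -, h, -⟩ := hBab' _ _ _ (by rw [Finset.pair_comm]; exact hD g hg)
      (hαβ g hg).2.swap
    exact Finset.mem_filter.2 ⟨hαP g hg, h⟩
  have main := card_le_of_no_alternation hφ hinj hαB hβB
    (fun g₁ h₁ g₂ h₂ g₃ h₃ g₄ h₄ h12 h23 h34 h13 h24 =>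
      no_alternation hP hP3 huv (side_affine u v) (Or.inl rfl) (hD g₁ h₁) (hD g₂ h₂) (hD g₃ h₃)
        (hD g₄ h₄) (hαpos g₁ h₁) (hαpos g₂ h₂) (hαpos g₃ h₃) (hαpos g₄ h₄) (hβneg g₁ h₁)
        (hβneg g₂ h₂) (hβneg g₃ h₃) (hβneg g₄ h₄) (hseg g₁ h₁) (hseg g₂ h₂) (hseg g₃ h₃)
        (hseg g₄ h₄) h12 h23 h34 h13 h24)
    (fun g₁ h₁ g₂ h₂ g₃ h₃ g₄ h₄ h12 h23 h34 h13 h24 => by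
      have hD' : ∀ g ∈ crossEdges P {u, v}, {β g, α g} ∈ delEdges P := fun g hg => by
        rw [Finset.pair_comm]; exact hD g hg
      have hp : ∀ g ∈ crossEdges P {u, v}, 0 < -side u v (β g) := fun g hg => by
        linarith [hβneg g hg]
      have hn : ∀ g ∈ crossEdges P {u, v}, -side u v (α g) < 0 := fun g hg => by
        linarith [hαpos g hg]
      have hs : ∀ g ∈ crossEdges P {u, v}, u + φ g • (v - u) ∈ segment ℝ (β g) (α g) :=
        fun g hg => by rw [segment_symm]; exact hseg g hg
      exact no_alternation hP hP3 huv (side_affine u v).neg (Or.inr rfl) (hD' g₁ h₁) (hD' g₂ h₂)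
        (hD' g₃ h₃) (hD' g₄ h₄) (hp g₁ h₁) (hp g₂ h₂) (hp g₃ h₃) (hp g₄ h₄) (hn g₁ h₁) (hn g₂ h₂)
        (hn g₃ h₃) (hn g₄ h₄) (hs g₁ h₁) (hs g₂ h₂) (hs g₃ h₃) (hs g₄ h₄) h12 h23 h34 h13 h24)
  omega

/-! ### Edges crossing Delaunay edges -/

/-- The edges contained in an order-`k` triangulation but not Delaunay. -/
def IsUsefulNonDel (P : Finset Plane) (k : ℕ) (e : Finset Plane) : Prop :=
  IsUsefulEdge P k e ∧ e ∉ delEdges P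

/-- The number of useful edges crossing a Delaunay edge. -/
theorem card_cross_le {k : ℕ} (hk : 1 ≤ k) {E : Finset (Finset Plane)}
    (hE : ∀ e ∈ E, IsUsefulNonDel P k e) {g : Finset Plane} (hg : g ∈ delEdges P) :
    #{e ∈ E | Cross e g} ≤ (2 * k - 1) ^ 2 := by
  obtain ⟨hgP, hg2⟩ := delEdges_subset hg
  obtain ⟨a, b, hab, rfl⟩ := Finset.card_eq_two.1 hg2
  have ha : a ∈ P := hgP (by simp)
  have hb : b ∈ P := hgP (by simp)
  have hsub : {e ∈ E | Cross e {a, b}} ⊆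
      (cand P k b a ×ˢ cand P k a b).image fun c => ({c.1, c.2} : Finset Plane) := by
    intro e he
    obtain ⟨heE, hc⟩ := Finset.mem_filter.1 he
    obtain ⟨⟨he2, K, hK, heK⟩, heD⟩ := hE e heE
    obtain ⟨u, v, huv, rfl⟩ := Finset.card_eq_two.1 he2
    have heP := faces_subset hK.1 heK
    have hne : ({a, b} : Finset Plane) ≠ {u, v} := fun h => heD (h ▸ hg)
    have main : ∀ {u v q : Plane}, u ≠ v → {u, v} ∈ K.faces → CrossAt u v a b q →
        ({u, v} : Finset Plane) ∈
          (cand P k b a ×ˢ cand P k a b).image fun c => ({c.1, c.2} : Finset Plane) := by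
      intro u v q huv heK hc
      refine Finset.mem_image.2 ⟨(u, v), Finset.mem_product.2 ⟨?_, ?_⟩, rfl⟩
      · exact mem_cand_of_crossAt hP hK huv.symm (by rwa [Finset.pair_comm])
          (by rwa [Finset.pair_comm]) hc.swap
      · exact mem_cand_of_crossAt hP hK huv heK hg hc
    obtain ⟨a', b', q, hab', hc'⟩ := hc.exists_crossAt hP (heP (by simp)) (heP (by simp)) huv hgP
      hg2 hne
    have hcase : (a' = a ∧ b' = b) ∨ (a' = b ∧ b' = a) := by
      have h1 : a' ∈ ({a, b} : Finset Plane) := by rw [hab']; simp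
      have h2 : b' ∈ ({a, b} : Finset Plane) := by rw [hab']; simp
      have h3 : a' ≠ b' := by rintro rfl; linarith [hc'.pos, hc'.neg]
      simp only [Finset.mem_insert, Finset.mem_singleton] at h1 h2
      rcases h1 with rfl | rfl <;> rcases h2 with rfl | rfl <;> simp_all
    rcases hcase with ⟨rfl, rfl⟩ | ⟨rfl, rfl⟩
    · exact main huv heK hc'
    · rw [Finset.pair_comm u v]
      exact main huv.symm (by rwa [Finset.pair_comm]) hc'.swap
  calc _ ≤ _ := Finset.card_le_card hsub
    _ ≤ _ := Finset.card_image_le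
    _ = #(cand P k b a) * #(cand P k a b) := Finset.card_product _ _
    _ ≤ (2 * k - 1) * (2 * k - 1) :=
      Nat.mul_le_mul (card_cand_le hP hb ha hk) (card_cand_le hP ha hb hk)
    _ = _ := (sq _).symm

/-- The number of useful edges with a given endpoint crossing a Delaunay edge. -/
theorem card_cross_of_mem_le {k : ℕ} (hk : 1 ≤ k) {E : Finset (Finset Plane)}
    (hE : ∀ e ∈ E, IsUsefulNonDel P k e) {g : Finset Plane} (hg : g ∈ delEdges P) (w : Plane) :
    #{e ∈ E | w ∈ e ∧ Cross e g} ≤ 2 * k - 1 := by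
  obtain ⟨hgP, hg2⟩ := delEdges_subset hg
  obtain ⟨a, b, hab, hgab, hw⟩ : ∃ a b, a ≠ b ∧ g = {a, b} ∧ side a b w ≤ 0 := by
    obtain ⟨a, b, hab, rfl⟩ := Finset.card_eq_two.1 hg2
    rcases le_total (side a b w) 0 with h | h
    · exact ⟨a, b, hab, rfl, h⟩
    · exact ⟨b, a, hab.symm, Finset.pair_comm _ _, by rw [side_swap]; linarith⟩
  subst hgab
  have ha : a ∈ P := hgP (by simp)
  have hb : b ∈ P := hgP (by simp)
  have hsub : {e ∈ E | w ∈ e ∧ Cross e {a, b}} ⊆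
      (cand P k a b).image fun z => ({w, z} : Finset Plane) := by
    intro e he
    obtain ⟨heE, hwe, hc⟩ := Finset.mem_filter.1 he
    obtain ⟨⟨he2, K, hK, heK⟩, heD⟩ := hE e heE
    have heP := faces_subset hK.1 heK
    obtain ⟨z, hwz, rfl⟩ : ∃ z, w ≠ z ∧ e = {w, z} := by
      obtain ⟨u, v, huv, rfl⟩ := Finset.card_eq_two.1 he2
      simp only [Finset.mem_insert, Finset.mem_singleton] at hwe
      rcases hwe with rfl | rfl
      · exact ⟨v, huv, rfl⟩
      · exact ⟨u, huv.symm, Finset.pair_comm _ _⟩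
    have hne : ({a, b} : Finset Plane) ≠ {w, z} := fun h => heD (h ▸ hg)
    obtain ⟨a', b', q, hab', hc'⟩ := hc.exists_crossAt hP (heP (by simp)) (heP (by simp)) hwz hgP
      hg2 hne
    have hcase : (a' = a ∧ b' = b) ∨ (a' = b ∧ b' = a) := by
      have h1 : a' ∈ ({a, b} : Finset Plane) := by rw [hab']; simp
      have h2 : b' ∈ ({a, b} : Finset Plane) := by rw [hab']; simp
      have h3 : a' ≠ b' := by rintro rfl; linarith [hc'.pos, hc'.neg]
      simp only [Finset.mem_insert, Finset.mem_singleton] at h1 h2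
      rcases h1 with rfl | rfl <;> rcases h2 with rfl | rfl <;> simp_all
    rcases hcase with ⟨rfl, rfl⟩ | ⟨rfl, rfl⟩
    · exact Finset.mem_image.2 ⟨z, mem_cand_of_crossAt hP hK hwz heK hg hc', rfl⟩
    · have := hc'.side_pos.1
      rw [side_swap] at this
      linarith
  exact (Finset.card_le_card hsub).trans (Finset.card_image_le.trans (card_cand_le hP ha hb hk))

/-- A Delaunay edge lies in at most two Delaunay triangles. -/
theorem card_Del_of_edge_le {g : Finset Plane} (hg : g ∈ delEdges P) :
    #{τ ∈ Del P | g ⊆ τ} ≤ 2 := by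
  obtain ⟨hgP, hg2⟩ := delEdges_subset hg
  obtain ⟨a, b, hab, rfl⟩ := Finset.card_eq_two.1 hg2
  have ha : a ∈ P := hgP (by simp)
  have hb : b ∈ P := hgP (by simp)
  have hthird : ∀ τ ∈ Del P, {a, b} ⊆ τ → ∃ c ∈ P, side a b c ≠ 0 ∧ τ = {a, b, c} := by
    intro τ hτ h
    obtain ⟨h1, h2, -⟩ := mem_Del.1 hτ
    obtain ⟨c, hc⟩ : (τ \ {a, b}).Nonempty := Finset.card_pos.1 (by
      rw [Finset.card_sdiff_of_subset h, h2, hg2]; norm_num)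
    simp only [Finset.mem_sdiff, Finset.mem_insert, Finset.mem_singleton, not_or] at hc
    refine ⟨c, h1 hc.1, hP.side_ne ha hb (h1 hc.1) hab (Ne.symm hc.2.1) (Ne.symm hc.2.2), ?_⟩
    refine (Finset.eq_of_subset_of_card_le (fun x hx => ?_) ?_).symm
    · simp only [Finset.mem_insert, Finset.mem_singleton] at hx
      rcases hx with rfl | rfl | rfl
      · exact h (by simp)
      · exact h (by simp)
      · exact hc.1
    · rw [h2, Finset.card_eq_three.2 ⟨a, b, c, hab, Ne.symm hc.2.1, Ne.symm hc.2.2, rfl⟩]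
  -- For apexes on the same side, emptiness of each circle with respect to the other apex compares
  -- the pencil parameters both ways, so they agree.
  have key : ∀ {c c' : Plane}, c ∈ P → c' ∈ P → {a, b, c} ∈ Del P → {a, b, c'} ∈ Del P →
      0 < side a b c * side a b c' → c = c' := by
    intro c c' hc hc' hτ hτ' hpos
    have h0 : side a b c ≠ 0 := left_ne_zero_of_mul hpos.ne'
    have h0' : side a b c' ≠ 0 := right_ne_zero_of_mul hpos.ne'
    have h1 := (mem_Del.1 hτ).2.2 c' hc'
    have h2 := (mem_Del.1 hτ').2.2 c hc
    rw [circ_eq_mul h0 h0'] at h1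
    rw [circ_eq_mul h0' h0] at h2
    refine pencil_injOn hP ha hb hc hc' h0 h0' ?_
    rcases lt_or_gt_of_ne h0 with h | h
    · have h' : side a b c' < 0 := by
        by_contra hn
        nlinarith
      have := nonpos_of_mul_nonneg_right h1 h'
      have := nonpos_of_mul_nonneg_right h2 h
      linarith
    · have h' : 0 < side a b c' := pos_of_mul_pos_right hpos h.le
      have := nonneg_of_mul_nonneg_right h1 h'
      have := nonneg_of_mul_nonneg_right h2 h
      linarith
  have hsplit : {τ ∈ Del P | {a, b} ⊆ τ} ⊆
      {τ ∈ Del P | ∃ c ∈ P, 0 < side a b c ∧ τ = {a, b, c}} ∪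
      {τ ∈ Del P | ∃ c ∈ P, side a b c < 0 ∧ τ = {a, b, c}} := by
    intro τ hτ
    obtain ⟨hτD, h⟩ := Finset.mem_filter.1 hτ
    obtain ⟨c, hc, hc0, hτc⟩ := hthird τ hτD h
    rcases lt_or_gt_of_ne hc0 with h | h
    · exact Finset.mem_union_right _ (Finset.mem_filter.2 ⟨hτD, c, hc, h, hτc⟩)
    · exact Finset.mem_union_left _ (Finset.mem_filter.2 ⟨hτD, c, hc, h, hτc⟩)
  have h1 : #{τ ∈ Del P | ∃ c ∈ P, 0 < side a b c ∧ τ = {a, b, c}} ≤ 1 := by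
    refine Finset.card_le_one.2 fun τ hτ τ' hτ' => ?_
    obtain ⟨hD, c, hc, h, rfl⟩ := Finset.mem_filter.1 hτ
    obtain ⟨hD', c', hc', h', rfl⟩ := Finset.mem_filter.1 hτ'
    rw [key hc hc' hD hD' (mul_pos h h')]
  have h2 : #{τ ∈ Del P | ∃ c ∈ P, side a b c < 0 ∧ τ = {a, b, c}} ≤ 1 := by
    refine Finset.card_le_one.2 fun τ hτ τ' hτ' => ?_
    obtain ⟨hD, c, hc, h, rfl⟩ := Finset.mem_filter.1 hτ
    obtain ⟨hD', c', hc', h', rfl⟩ := Finset.mem_filter.1 hτ'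
    rw [key hc hc' hD hD' (mul_pos_of_neg_of_neg h h')]
  have h3 := Finset.card_le_card hsplit
  have h4 := Finset.card_union_le {τ ∈ Del P | ∃ c ∈ P, 0 < side a b c ∧ τ = {a, b, c}}
    {τ ∈ Del P | ∃ c ∈ P, side a b c < 0 ∧ τ = {a, b, c}}
  omega

end

/-! ### Counting conflicts -/

section
variable {P : Finset Plane} (hP : GeneralPosition P)
include hP

/-- Leaving a triangle towards a point of `P`. -/
theorem exists_exit (hP3 : 3 ≤ #P) {t : Finset Plane} (ht : t ⊆ P) (h3 : #t = 3) {y v : Plane}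
    (hy : y ∈ otri t) (hv : v ∈ P) (hvt : v ∉ t) (hvo : v ∉ otri t)
    (hseg : ∀ z ∈ openSegment ℝ y v, z ∉ P) :
    ∃ a ∈ t, bc t a v < 0 ∧ ∃ z ∈ openSegment ℝ y v, z ∈ edgeInt (t.erase a) := by
  have hnd := hP.nonDeg ht h3
  have hne : (t.filter fun p => bc t p v < 0).Nonempty := by
    by_contra hc
    rw [Finset.not_nonempty_iff_eq_empty, Finset.filter_eq_empty_iff] at hc
    exact hvt (mem_triple_of_mem_convexHull hP hP3 ht h3 hv
      ((mem_convexHull_iff_bc hnd).2 fun p hp => not_lt.1 (hc hp)) hvo)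
  -- The minimised ratio is the parameter at which a coordinate vanishes along the way to `v`; the
  -- smallest is the moment of exit.
  obtain ⟨a, ha, hmin⟩ := Finset.exists_min_image _
    (fun p => bc t p y / (bc t p y - bc t p v)) hne
  rw [Finset.mem_filter] at ha
  obtain ⟨hat, hav⟩ := ha
  have hya := hy a hat
  have hd : 0 < bc t a y - bc t a v := by linarith
  set s := bc t a y / (bc t a y - bc t a v) with hs
  have hs0 : 0 < s := div_pos hya hd
  have hs1 : s < 1 := (div_lt_one hd).2 (by linarith)
  have hz : (1 - s) • y + s • v ∈ openSegment ℝ y v :=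
    ⟨1 - s, s, by linarith, hs0, by ring, rfl⟩
  refine ⟨a, hat, hav, _, hz, mem_convexHull_erase hnd ?_ hat ?_, fun hmem => ?_⟩
  · refine (mem_convexHull_iff_bc hnd).2 fun q hq => ?_
    rw [((bc_spec hnd).1 q).combo (by ring)]
    have hyq := hy q hq
    rcases lt_or_ge (bc t q v) 0 with h | h
    · have := hmin q (Finset.mem_filter.2 ⟨hq, h⟩)
      rw [le_div_iff₀ (by linarith)] at this
      linarith
    · have := mul_nonneg (sub_nonneg.2 hs1.le) hyq.le
      have := mul_nonneg hs0.le h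
      linarith
  · rw [((bc_spec hnd).1 a).combo (by ring)]
    have : s * (bc t a y - bc t a v) = bc t a y := div_mul_cancel₀ _ hd.ne'
    linarith
  · exact hseg _ hz (ht (Finset.mem_of_mem_erase (Finset.mem_coe.1 hmem)))

omit hP in
theorem openSegment_subset_left {u v y : Plane} (hy : y ∈ openSegment ℝ u v) :
    openSegment ℝ y v ⊆ openSegment ℝ u v := by
  rintro z ⟨c, d, hc, hd, hcd, rfl⟩
  obtain ⟨a, b, ha, hb, hab, rfl⟩ := hy
  refine ⟨c * a, c * b + d, by positivity, by positivity, ?_, by module⟩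
  linear_combination c * hab + hcd

/-- How an edge crosses the interior of a Delaunay triangle. -/
theorem cross_cases (hP3 : 3 ≤ #P) {e τ : Finset Plane} (he : e ⊆ P) (he2 : #e = 2)
    (hτ : τ ∈ Del P) (hd : ¬ Disjoint (otri τ) (edgeInt e)) (hnot : ¬ e ⊆ τ) :
    (∃ w ∈ τ, w ∈ e ∧ Cross e (τ.erase w)) ∨
      ∃ w₁ ∈ τ, ∃ w₂ ∈ τ, w₁ ≠ w₂ ∧ Cross e (τ.erase w₁) ∧ Cross e (τ.erase w₂) := by
  obtain ⟨h1, h2, h3⟩ := mem_Del.1 hτ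
  have hnd := hP.nonDeg h1 h2
  have hno : ∀ p ∈ P, p ∉ otri τ := fun p hp h =>
    absurd (h3 p hp) (not_le.2 (circ_neg_of_otri hnd h))
  have main : ∀ {u v y : Plane}, u ≠ v → u ∈ P → v ∈ P → y ∈ otri τ → y ∈ openSegment ℝ u v →
      v ∉ τ → ∃ a ∈ τ, bc τ a v < 0 ∧ Cross {u, v} (τ.erase a) := by
    intro u v y huv hu hv hy hyo hvt
    have hsub := openSegment_subset_left hyo
    obtain ⟨a, ha, hav, z, hz, hze⟩ := exists_exit hP hP3 h1 h2 hy hv hvt (hno v hv)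
      (fun z hz hzP => hP.notMem_openSegment hu hv hzP huv (hsub hz))
    exact ⟨a, ha, hav, z, by rw [edgeInt_pair huv]; exact hsub hz, hze⟩
  -- Every coordinate other than that of `u` vanishes at `u` and is positive at `y`, hence is
  -- positive at `v`; only the side opposite `u` can be the exit.
  have one : ∀ {u v y : Plane}, u ≠ v → u ∈ P → v ∈ P → y ∈ otri τ → y ∈ openSegment ℝ u v →
      v ∉ τ → u ∈ τ → Cross {u, v} (τ.erase u) := by
    intro u v y huv hu hv hy hyo hvt hut
    obtain ⟨a, ha, hav, hc⟩ := main huv hu hv hy hyo hvt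
    by_cases hau : a = u
    · exact hau ▸ hc
    · exfalso
      have := hy a ha
      obtain ⟨s, r, hs, hr, hsr, rfl⟩ := hyo
      rw [((bc_spec hnd).1 a).combo hsr, (bc_spec hnd).2.2.1 a ha u hut hau] at this
      nlinarith [mul_pos hr (neg_pos.2 hav)]
  obtain ⟨u, v, huv, rfl⟩ := Finset.card_eq_two.1 he2
  have hu : u ∈ P := he (by simp)
  have hv : v ∈ P := he (by simp)
  obtain ⟨y, hy, hyo⟩ := Set.not_disjoint_iff.1 hd
  rw [edgeInt_pair huv] at hyo
  have hyo' : y ∈ openSegment ℝ v u := openSegment_symm ℝ u v ▸ hyo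
  by_cases hut : u ∈ τ
  · have hvt : v ∉ τ := fun hvt => hnot (by simp [Finset.insert_subset_iff, hut, hvt])
    exact Or.inl ⟨u, hut, by simp, one huv hu hv hy hyo hvt hut⟩
  by_cases hvt : v ∈ τ
  · refine Or.inl ⟨v, hvt, by simp, ?_⟩
    rw [Finset.pair_comm]
    exact one huv.symm hv hu hy hyo' hut hvt
  · obtain ⟨a, ha, hav, hc⟩ := main huv hu hv hy hyo hvt
    obtain ⟨b, hb, hbu, hc'⟩ := main huv.symm hv hu hy hyo' hut
    rw [Finset.pair_comm] at hc'
    refine Or.inr ⟨a, ha, b, hb, ?_, hc, hc'⟩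
    rintro rfl
    have := hy a ha
    obtain ⟨s, r, hs, hr, hsr, rfl⟩ := hyo
    rw [((bc_spec hnd).1 a).combo hsr] at this
    nlinarith [mul_pos hr (neg_pos.2 hav), mul_pos hs (neg_pos.2 hbu)]

/-- Only one Delaunay triangle at an endpoint of an edge is crossed by the edge. -/
theorem Del_at_endpoint_unique {e τ τ' : Finset Plane} (he2 : #e = 2)
    {w : Plane} (hwe : w ∈ e) (hτ : τ ∈ Del P) (hτ' : τ' ∈ Del P) (hw : w ∈ τ) (hw' : w ∈ τ')
    (hd : ¬ Disjoint (otri τ) (edgeInt e)) (hd' : ¬ Disjoint (otri τ') (edgeInt e)) : τ = τ' := by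
  obtain ⟨z, hwz, rfl⟩ : ∃ z, w ≠ z ∧ e = {w, z} := by
    obtain ⟨u, v, huv, rfl⟩ := Finset.card_eq_two.1 he2
    simp only [Finset.mem_insert, Finset.mem_singleton] at hwe
    rcases hwe with rfl | rfl
    · exact ⟨v, huv, rfl⟩
    · exact ⟨u, huv.symm, Finset.pair_comm _ _⟩
  obtain ⟨y, hy, hyo⟩ := Set.not_disjoint_iff.1 hd
  obtain ⟨y', hy', hyo'⟩ := Set.not_disjoint_iff.1 hd'
  rw [edgeInt_pair hwz] at hyo hyo'
  -- The open triangle contains the open segment from its vertex `w` to any of its points, so the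
  -- intersections with the two triangles overlap near `w`.
  have key : ∀ {τ' : Finset Plane} {s s' : ℝ}, τ' ∈ Del P → w ∈ τ' → 0 < s → s ≤ s' →
      (1 - s') • w + s' • z ∈ otri τ' → (1 - s) • w + s • z ∈ otri τ' := by
    intro τ' s s' hτ' hw' hs hss hm
    have hnd := hP.nonDeg (mem_Del.1 hτ').1 (mem_Del.1 hτ').2.1
    have hs' : 0 < s' := by linarith
    have := mem_otri_of_combo hnd hm (subset_convexHull ℝ _ hw') (a := s / s') (b := 1 - s / s')
      (by positivity) (sub_nonneg.2 ((div_le_one hs').2 hss)) (by ring)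
    convert this using 1
    have e1 : s = s / s' * s' := (div_mul_cancel₀ _ hs'.ne').symm
    generalize s / s' = c at *
    subst e1
    module
  obtain ⟨r, s, hr, hs, hrs, rfl⟩ := hyo
  obtain ⟨r', s', hr', hs', hrs', rfl⟩ := hyo'
  obtain rfl : r = 1 - s := by linarith
  obtain rfl : r' = 1 - s' := by linarith
  rcases le_total s s' with h | h
  · exact Del_unique hP hτ hτ' hy (key hτ' hw' hs h hy')
  · exact Del_unique hP hτ hτ' (key hτ hw hs' h hy) hy'

omit hP in
theorem erase_mem_delEdges {τ : Finset Plane} (hτ : τ ∈ Del P) {w : Plane} (hw : w ∈ τ) :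
    τ.erase w ∈ delEdges P :=
  mem_delEdges.2 ⟨τ, hτ, Finset.erase_subset _ _, by
    rw [Finset.card_erase_of_mem hw, (mem_Del.1 hτ).2.1]⟩

/-- Useful edges crossing an edge of a Delaunay triangle from the opposite vertex, where the
triangle contains a given edge but the vertex is on that edge. -/
theorem card_cross_opposite_le {k : ℕ} (hk : 1 ≤ k) {E : Finset (Finset Plane)}
    (hE : ∀ e ∈ E, IsUsefulNonDel P k e) {g : Finset Plane} (hg : g ∈ delEdges P) :
    #{e ∈ E | ∃ τ ∈ Del P, g ⊆ τ ∧ ∃ w ∈ g, w ∈ e ∧ Cross e (τ.erase w)} ≤ 4 * (2 * k - 1) := by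
  have hsub : {e ∈ E | ∃ τ ∈ Del P, g ⊆ τ ∧ ∃ w ∈ g, w ∈ e ∧ Cross e (τ.erase w)} ⊆
      ({τ ∈ Del P | g ⊆ τ} : Finset _).biUnion fun τ =>
        g.biUnion fun w => {e ∈ E | w ∈ e ∧ Cross e (τ.erase w)} := by
    intro e he
    obtain ⟨heE, τ, hτ, hgτ, w, hw, h⟩ := Finset.mem_filter.1 he
    simp only [Finset.mem_biUnion, Finset.mem_filter]
    exact ⟨τ, ⟨hτ, hgτ⟩, w, hw, heE, h⟩
  refine (Finset.card_le_card hsub).trans ?_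
  refine (Finset.card_biUnion_le_card_mul _ _ (2 * (2 * k - 1)) fun τ hτ => ?_).trans ?_
  · obtain ⟨hτD, hgτ⟩ := Finset.mem_filter.1 hτ
    refine (Finset.card_biUnion_le_card_mul _ _ (2 * k - 1) fun w hw => ?_).trans ?_
    · exact card_cross_of_mem_le hP hk hE (erase_mem_delEdges hτD (hgτ hw)) w
    · rw [(delEdges_subset hg).2]
  · have := Nat.mul_le_mul_right (2 * (2 * k - 1)) (card_Del_of_edge_le hP hg)
    omega

/-- The triangle at `w` crossed by `e` is unique, so all counted edges cross one fixed side of it.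
-/
theorem card_cross_end_le {k : ℕ} (hk : 1 ≤ k) {E : Finset (Finset Plane)}
    (hE : ∀ e ∈ E, IsUsefulNonDel P k e) {e : Finset Plane} (he2 : #e = 2)
    {w : Plane} (hw : w ∈ e) :
    #{e' ∈ E | ∃ τ ∈ Del P, w ∈ τ ∧ ¬ Disjoint (otri τ) (edgeInt e) ∧
      ∀ w₁ ∈ τ, w₁ ≠ w → Cross e' (τ.erase w₁)} ≤ (2 * k - 1) ^ 2 := by
  rcases Finset.eq_empty_or_nonempty {e' ∈ E | ∃ τ ∈ Del P, w ∈ τ ∧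
    ¬ Disjoint (otri τ) (edgeInt e) ∧ ∀ w₁ ∈ τ, w₁ ≠ w → Cross e' (τ.erase w₁)} with h | ⟨e₀, he₀⟩
  · rw [h]; simp
  obtain ⟨-, τ, hτ, hwτ, hd, -⟩ := Finset.mem_filter.1 he₀
  obtain ⟨a, ha, haw⟩ := Finset.exists_mem_ne (by rw [(mem_Del.1 hτ).2.1]; norm_num : 1 < #τ) w
  refine (Finset.card_le_card fun e' he' => ?_).trans
    (card_cross_le hP hk hE (erase_mem_delEdges hτ ha))
  obtain ⟨heE, τ', hτ', hwτ', hd', h⟩ := Finset.mem_filter.1 he'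
  obtain rfl := Del_at_endpoint_unique hP he2 hw hτ hτ' hwτ hwτ' hd hd'
  exact Finset.mem_filter.2 ⟨heE, h a ha haw⟩

/-- A useful edge conflicts with a bounded number of useful edges. -/
theorem card_conflict_le (hP3 : 3 ≤ #P) {k : ℕ} (hk : 1 ≤ k) {E : Finset (Finset Plane)}
    (hE : ∀ e ∈ E, IsUsefulNonDel P k e) {e : Finset Plane} (he : e ∈ E) :
    #{e' ∈ E | Conflict P e e'} ≤ (4 * k + 1) * (2 * k + 1) ^ 2 := by
  have hEP : ∀ e ∈ E, e ⊆ P ∧ #e = 2 ∧ ∀ τ ∈ Del P, ¬ e ⊆ τ := by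
    intro e he
    obtain ⟨⟨h2, K, hK, heK⟩, hD⟩ := hE e he
    exact ⟨faces_subset hK.1 heK, h2, fun τ hτ h => hD (mem_delEdges.2 ⟨τ, hτ, h, h2⟩)⟩
  obtain ⟨heP, he2, hnot⟩ := hEP e he
  -- In a commonly crossed triangle there are three possibilities: both edges cross the same side;
  -- `e'` starts at a vertex lying on a side crossed by `e`; or `e` starts at a vertex `w` and `e'`
  -- crosses the two sides at `w`.
  have hsub : {e' ∈ E | Conflict P e e'} ⊆
      ((crossEdges P e).biUnion fun g => {e' ∈ E | Cross e' g} ∪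
        {e' ∈ E | ∃ τ ∈ Del P, g ⊆ τ ∧ ∃ w ∈ g, w ∈ e' ∧ Cross e' (τ.erase w)}) ∪
      e.biUnion fun w => {e' ∈ E | ∃ τ ∈ Del P, w ∈ τ ∧ ¬ Disjoint (otri τ) (edgeInt e) ∧
        ∀ w₁ ∈ τ, w₁ ≠ w → Cross e' (τ.erase w₁)} := by
    intro e' he'
    obtain ⟨heE', τ, hτ, hd, hd'⟩ := Finset.mem_filter.1 he'
    obtain ⟨heP', he2', hnot'⟩ := hEP e' heE'
    have h3 := (mem_Del.1 hτ).2.1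
    have hcr : ∀ w ∈ τ, Cross e (τ.erase w) → τ.erase w ∈ crossEdges P e := fun w hw h =>
      Finset.mem_filter.2 ⟨erase_mem_delEdges hτ hw, h⟩
    simp only [Finset.mem_union, Finset.mem_biUnion, Finset.mem_filter]
    have common : ∀ w ∈ τ, Cross e (τ.erase w) → Cross e' (τ.erase w) → ∃ g ∈ crossEdges P e,
        (e' ∈ E ∧ Cross e' g) ∨
          (e' ∈ E ∧ ∃ τ ∈ Del P, g ⊆ τ ∧ ∃ w ∈ g, w ∈ e' ∧ Cross e' (τ.erase w)) :=
      fun w hw h h' => ⟨_, hcr w hw h, Or.inl ⟨heE', h'⟩⟩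
    have rest : ∀ w ∈ τ, ∀ w' ∈ τ, w' ≠ w → Cross e (τ.erase w) → w' ∈ e' →
        Cross e' (τ.erase w') → ∃ g ∈ crossEdges P e, (e' ∈ E ∧ Cross e' g) ∨
          (e' ∈ E ∧ ∃ τ ∈ Del P, g ⊆ τ ∧ ∃ w ∈ g, w ∈ e' ∧ Cross e' (τ.erase w)) :=
      fun w hw w' hw' hne h hwe h' => ⟨_, hcr w hw h, Or.inr ⟨heE', τ, hτ, Finset.erase_subset _ _,
        w', Finset.mem_erase.2 ⟨hne, hw'⟩, hwe, h'⟩⟩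
    have four : ∀ x₁ ∈ τ, ∀ x₂ ∈ τ, ∀ x₃ ∈ τ, ∀ x₄ ∈ τ, x₁ ≠ x₂ → x₁ ≠ x₃ → x₁ ≠ x₄ → x₂ ≠ x₃ →
        x₂ ≠ x₄ → x₃ = x₄ := by
      intro x₁ h₁ x₂ h₂ x₃ h₃ x₄ h₄ h12 h13 h14 h23 h24
      by_contra h34
      have hle : #({x₁, x₂, x₃, x₄} : Finset Plane) ≤ #τ := Finset.card_le_card (by
        simp [Finset.insert_subset_iff, h₁, h₂, h₃, h₄])
      rw [Finset.card_insert_of_notMem (by simp [h12, h13, h14]),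
        Finset.card_insert_of_notMem (by simp [h23, h24]), Finset.card_pair h34] at hle
      omega
    rcases cross_cases hP hP3 heP he2 hτ hd (hnot τ hτ) with
      ⟨w, hw, hwe, hc⟩ | ⟨w₁, hw₁, w₂, hw₂, hne, hc₁, hc₂⟩ <;>
    rcases cross_cases hP hP3 heP' he2' hτ hd' (hnot' τ hτ) with
      ⟨w', hw', hwe', hc'⟩ | ⟨w₁', hw₁', w₂', hw₂', hne', hc₁', hc₂'⟩
    · left
      by_cases h : w' = w
      · subst h; exact common _ hw hc hc'
      · exact rest w hw w' hw' h hc hwe' hc'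
    · by_cases h1 : w₁' = w
      · subst h1; exact Or.inl (common _ hw hc hc₁')
      by_cases h2 : w₂' = w
      · subst h2; exact Or.inl (common _ hw hc hc₂')
      refine Or.inr ⟨w, hwe, heE', τ, hτ, hw, hd, fun x hx hxw => ?_⟩
      by_cases hx1 : w₁' = x
      · rwa [← hx1]
      · rwa [← four w hw w₁' hw₁' w₂' hw₂' x hx (Ne.symm h1) (Ne.symm h2) hxw.symm hne' hx1]
    · left
      by_cases h : w' = w₁
      · subst h; exact common _ hw₁ hc₁ hc'
      · exact rest w₁ hw₁ w' hw' h hc₁ hwe' hc'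
    · left
      by_cases h1 : w₁' = w₁
      · subst h1; exact common _ hw₁ hc₁ hc₁'
      by_cases h2 : w₂' = w₁
      · subst h2; exact common _ hw₁ hc₁ hc₂'
      by_cases h3 : w₁' = w₂
      · subst h3; exact common _ hw₂ hc₂ hc₁'
      have := four w₁' hw₁' w₁ hw₁ w₂' hw₂' w₂ hw₂ h1 hne' h3 (Ne.symm h2) hne
      subst this
      exact common _ hw₂ hc₂ hc₂'
  have hcross : #(crossEdges P e) ≤ 4 * k - 3 := by
    obtain ⟨⟨-, K, hK, heK⟩, hD⟩ := hE e he
    exact card_crossEdges_le hP hP3 hk hK he2 heK hD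
  have h1 := Finset.card_biUnion_le_card_mul (crossEdges P e) (fun g => {e' ∈ E | Cross e' g} ∪
    {e' ∈ E | ∃ τ ∈ Del P, g ⊆ τ ∧ ∃ w ∈ g, w ∈ e' ∧ Cross e' (τ.erase w)})
    ((2 * k - 1) ^ 2 + 4 * (2 * k - 1)) (fun g hg => by
      have hg := (Finset.mem_filter.1 hg).1
      exact (Finset.card_union_le _ _).trans
        (add_le_add (card_cross_le hP hk hE hg) (card_cross_opposite_le hP hk hE hg)))
  have h2 := Finset.card_biUnion_le_card_mul e (fun w => {e' ∈ E | ∃ τ ∈ Del P, w ∈ τ ∧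
    ¬ Disjoint (otri τ) (edgeInt e) ∧ ∀ w₁ ∈ τ, w₁ ≠ w → Cross e' (τ.erase w₁)})
    ((2 * k - 1) ^ 2) (fun w hw => card_cross_end_le hP hk hE he2 hw)
  have h3 := (Finset.card_le_card hsub).trans (Finset.card_union_le _ _)
  have h4 := Nat.mul_le_mul_right ((2 * k - 1) ^ 2 + 4 * (2 * k - 1)) hcross
  refine (h3.trans (add_le_add (h1.trans h4) h2)).trans ?_
  rw [he2]
  -- The total is `(4k-3)((2k-1)²+4(2k-1)) + 2(2k-1)²`, and `(2k-1)²+4(2k-1) = (2k+1)²-4`. The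
  -- substitution removes truncated subtraction.
  obtain ⟨m, rfl⟩ : ∃ m, k = m + 1 := ⟨k - 1, by omega⟩
  have e1 : 4 * (m + 1) - 3 = 4 * m + 1 := by omega
  have e2 : 2 * (m + 1) - 1 = 2 * m + 1 := by omega
  rw [e1, e2]
  nlinarith [sq_nonneg m, pow_pos (Nat.succ_pos m) 3]

/-! ### Triangulations from independent sets of useful edges -/

/-- Kept Delaunay triangles have empty circles; new ones inherit the order from the triangulation
witnessing that their edge is useful. -/
theorem exists_orderTriangulation (hP3 : 3 ≤ #P) {k : ℕ} {S : Finset (Finset Plane)}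
    (hS : ∀ e ∈ S, IsUsefulEdge P k e) (hconf : ∀ e ∈ S, ∀ e' ∈ S, Conflict P e e' → e = e') :
    ∃ K : Geometry.SimplicialComplex ℝ Plane, IsOrderTriangulation P k K ∧
      K.faces = {s | s.Nonempty ∧ ∃ t ∈ multiCdt P S, s ⊆ t} := by
  have hS' : ∀ e ∈ S, e ⊆ P ∧ #e = 2 := by
    intro e he
    obtain ⟨h2, K, hK, heK⟩ := hS e he
    exact ⟨faces_subset hK.1 heK, h2⟩
  obtain ⟨K, hK, hKf⟩ := exists_multiCdt hP hS' hconf hP3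
  refine ⟨K, ⟨hK, fun t ht h3 => ?_⟩, hKf⟩
  rw [hKf] at ht
  obtain ⟨-, t', ht', htt⟩ := ht
  obtain ⟨h1', h3'⟩ := multiCdt_triple ht'
  obtain rfl := Finset.eq_of_subset_of_card_le htt (by omega)
  have hnd := hP.nonDeg h1' h3
  refine isOrderTriangle_of_card_circ_le hnd ?_
  rcases mem_multiCdt.1 ht' with ⟨hD, -⟩ | ⟨e, he, hC, -⟩
  · rw [Finset.filter_false_of_mem]
    · simp
    · exact fun p hp => not_lt.2 ((mem_Del.1 hD).2.2 p hp)
  · obtain ⟨h2, K', hK', heK'⟩ := hS e he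
    exact card_circ_le_of_mem_Cdt hP hK' h2 heK' hC

theorem isUsefulEdge_zero_of_mem_delEdges (hP3 : 3 ≤ #P) {e : Finset Plane}
    (he : e ∈ delEdges P) : IsUsefulEdge P 0 e := by
  obtain ⟨K, hK, hKf⟩ := exists_orderTriangulation hP hP3 (k := 0) (S := ∅) (by simp) (by simp)
  obtain ⟨τ, hτ, heτ, h2⟩ := mem_delEdges.1 he
  refine ⟨h2, K, hK, ?_⟩
  rw [hKf]
  exact ⟨Finset.card_pos.1 (by omega), τ, mem_multiCdt.2 (Or.inl ⟨hτ, by simp⟩), heτ⟩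

end

/-! ### Finiteness, independent sets and the final count -/

theorem finite_triangulations (P : Finset Plane) :
    {K : Geometry.SimplicialComplex ℝ Plane | IsTriangulation P K}.Finite := by
  refine Set.Finite.of_finite_image (f := fun K => K.faces) ?_ ?_
  · refine (P.powerset.finite_toSet.finite_subsets).subset ?_
    rintro _ ⟨K, hK, rfl⟩ s hs
    simpa using faces_subset hK hs
  · intro K _ K' _ h
    exact Geometry.SimplicialComplex.ext h

/-- A maximal independent set of a relation of bounded degree. -/
theorem exists_independent {ι : Type*} (E : Finset ι) (r : ι → ι → Prop)
    (hr : ∀ a b, r a b → r b a) (M : ℕ) (hM : ∀ e ∈ E, #{e' ∈ E | r e e'} ≤ M) :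
    ∃ I ⊆ E, (∀ e ∈ I, ∀ e' ∈ I, r e e' → e = e') ∧ #E ≤ #I * (M + 1) := by
  obtain ⟨I, hI, hmax⟩ := (E.powerset.filter fun I => ∀ e ∈ I, ∀ e' ∈ I, r e e' → e = e')
    |>.exists_max_image Finset.card ⟨∅, by simp⟩
  simp only [Finset.mem_filter, Finset.mem_powerset] at hI hmax
  refine ⟨I, hI.1, hI.2, ?_⟩
  -- By maximality each element of `E` is in `I` or related to a member of `I`; the inserted `e`
  -- accounts for the `+ 1` in the bound.
  have hsub : E ⊆ I.biUnion fun e => insert e {e' ∈ E | r e e'} := by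
    intro e he
    by_contra hc
    simp only [Finset.mem_biUnion, Finset.mem_insert, Finset.mem_filter, not_exists, not_and,
      not_or] at hc
    have heI : e ∉ I := fun h => (hc e h).1 rfl
    have := hmax (insert e I) ⟨Finset.insert_subset he hI.1, ?_⟩
    · rw [Finset.card_insert_of_notMem heI] at this
      omega
    · intro a ha b hb hab
      rcases Finset.mem_insert.1 ha with h1 | h1 <;> rcases Finset.mem_insert.1 hb with h2 | h2
      · rw [h1, h2]
      · exact absurd (hr _ _ (h1 ▸ hab)) ((hc b h2).2 he)
      · exact absurd (h2 ▸ hab) ((hc a h1).2 he)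
      · exact hI.2 a h1 b h2 hab
  refine (Finset.card_le_card hsub).trans (Finset.card_biUnion_le_card_mul _ _ _ fun e he => ?_)
  exact (Finset.card_insert_le _ _).trans (Nat.succ_le_succ (hM e (hI.1 he)))

theorem isUsefulEdge_of_mem_exact {P e : Finset Plane} {k : ℕ} (he : e ∈ exactUsefulEdges P k) :
    IsUsefulEdge P k e :=
  (Finset.mem_filter.1 he).2.1

section
variable {P : Finset Plane} (hP : GeneralPosition P)
include hP

/-- An edge of `I` appears in the triangulation built from `S` exactly when it is in `S`, since
appearing without being Delaunay requires a conflict with a member of `S`. -/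
theorem two_pow_le_ncard (hP3 : 3 ≤ #P) {k : ℕ} {I : Finset (Finset Plane)}
    (hI : I ⊆ exactUsefulEdges P k) (hD : ∀ e ∈ I, e ∉ delEdges P)
    (hconf : ∀ e ∈ I, ∀ e' ∈ I, Conflict P e e' → e = e') :
    2 ^ #I - 1 ≤ (exactOrderTriangulations P k).ncard := by
  have hex : ∀ S : Finset (Finset Plane), ∃ K : Geometry.SimplicialComplex ℝ Plane, S ⊆ I →
      IsOrderTriangulation P k K ∧ K.faces = {s | s.Nonempty ∧ ∃ t ∈ multiCdt P S, s ⊆ t} := by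
    intro S
    by_cases hS : S ⊆ I
    · obtain ⟨K, hK⟩ := exists_orderTriangulation hP hP3 (k := k) (S := S)
        (fun e he => (Finset.mem_filter.1 (hI (hS he))).2.1)
        (fun e he e' he' h => hconf e (hS he) e' (hS he') h)
      exact ⟨K, fun _ => hK⟩
    -- Arbitrary value for sets outside `I`.
    · exact ⟨⊥, fun h => absurd h hS⟩
  choose K hK using hex
  have hI2 : ∀ e ∈ I, e ⊆ P ∧ #e = 2 := fun e he =>
    Finset.mem_powersetCard.1 (Finset.mem_filter.1 (hI he)).1
  have hDel : ∀ e ∈ I, ∀ τ ∈ Del P, ¬ e ⊆ τ := fun e he τ hτ h =>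
    hD e he (mem_delEdges.2 ⟨τ, hτ, h, (hI2 e he).2⟩)
  have hmem : ∀ S ⊆ I, ∀ e ∈ S, e ∈ (K S).faces := by
    intro S hS e he
    obtain ⟨t, ht, het⟩ := exists_mem_multiCdt hP (fun e he => hI2 e (hS he)) hP3
      (fun e he => hDel e (hS he)) he
    rw [(hK S hS).2]
    exact ⟨Finset.card_pos.1 (by rw [(hI2 e (hS he)).2]; norm_num), t, ht, het⟩
  have hsub : ∀ S ⊆ I, ∀ S' ⊆ I, K S = K S' → S ⊆ S' := by
    intro S hS S' hS' h e he
    have := hmem S hS e he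
    rw [h, (hK S' hS').2] at this
    obtain ⟨-, t, ht, het⟩ := this
    obtain ⟨e', he', hc⟩ := exists_conflict_of_subset hP (fun e he => hI2 e (hS' he)) hP3
      (hI2 e (hS he)).1 (hI2 e (hS he)).2 (hDel e (hS he)) ht het
    rwa [hconf e (hS he) e' (hS' he') hc]
  have hfin : (exactOrderTriangulations P k).Finite :=
    (finite_triangulations P).subset fun K hK => hK.1.1
  -- The empty set is dropped: it contributes the Delaunay triangulation, in which no exact edge
  -- certifies the order.
  have hcard : #(I.powerset.erase ∅) = 2 ^ #I - 1 := by
    rw [Finset.card_erase_of_mem (by simp), Finset.card_powerset]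
  rw [← hcard, ← Set.ncard_coe_finset]
  refine Set.ncard_le_ncard_of_injOn K (fun S hS => ?_) (fun S hS S' hS' h => ?_) hfin
  · simp only [Finset.coe_erase, Finset.coe_powerset, Set.mem_sdiff, Set.mem_preimage,
      Set.mem_powerset_iff, Finset.coe_subset, Set.mem_singleton_iff] at hS
    refine ⟨(hK S hS.1).1, fun i hi hKi => ?_⟩
    obtain ⟨e, he⟩ := Finset.nonempty_iff_ne_empty.2 hS.2
    have heE := Finset.mem_filter.1 (hI (hS.1 he))
    exact heE.2.2 i hi ⟨(hI2 e (hS.1 he)).2, K S, hKi, hmem S hS.1 e he⟩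
  · simp only [Finset.coe_erase, Finset.coe_powerset, Set.mem_sdiff, Set.mem_preimage,
      Set.mem_powerset_iff, Finset.coe_subset, Set.mem_singleton_iff] at hS hS'
    exact (hsub S hS.1 S' hS'.1 h).antisymm (hsub S' hS'.1 S hS.1 h.symm)

theorem notMem_delEdges_of_exact (hP3 : 3 ≤ #P) {k : ℕ} (hk : 0 < k) {e : Finset Plane}
    (he : e ∈ exactUsefulEdges P k) : e ∉ delEdges P := fun h =>
  (Finset.mem_filter.1 he).2.2 0 hk (isUsefulEdge_zero_of_mem_delEdges hP hP3 h)

-- With fewer than three points there are no triangles, so every triangulation has order `0`.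
omit hP in
theorem exactUsefulEdges_eq_empty (hP3 : #P < 3) {k : ℕ} (hk : 0 < k) :
    exactUsefulEdges P k = ∅ := by
  refine Finset.eq_empty_of_forall_notMem fun e he => ?_
  obtain ⟨-, ⟨h2, K, hK, heK⟩, hno⟩ := Finset.mem_filter.1 he
  refine hno 0 hk ⟨h2, K, ⟨hK.1, fun t ht h3 => ?_⟩, heK⟩
  have := Finset.card_le_card (faces_subset hK.1 ht)
  omega

end

end HigherOrderDelaunay

end

theorem mainTheorem5 (P : Finset HigherOrderDelaunay.Plane)
    (hP : HigherOrderDelaunay.GeneralPosition P) (k : ℕ) (hk : 1 < k) :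
    (HigherOrderDelaunay.exactOrderTriangulations P k).Finite ∧
      (2 : ℝ) ^ (((HigherOrderDelaunay.exactUsefulEdges P k).card : ℝ) /
          ((4 * (k : ℝ) + 1) * (2 * (k : ℝ) + 1) ^ 2 + 1)) - 1 ≤
        ((HigherOrderDelaunay.exactOrderTriangulations P k).ncard : ℝ) := by
  open HigherOrderDelaunay in
  refine ⟨(finite_triangulations P).subset fun K hK => hK.1.1, ?_⟩
  rcases lt_or_ge P.card 3 with h3 | h3
  · rw [exactUsefulEdges_eq_empty h3 (by omega)]
    simp
  have hD : ∀ e ∈ exactUsefulEdges P k, e ∉ delEdges P := fun e he =>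
    notMem_delEdges_of_exact hP h3 (by omega) he
  obtain ⟨I, hI, hconf, hcard⟩ := exists_independent (exactUsefulEdges P k) (Conflict P)
    (fun a b ⟨τ, hτ, h, h'⟩ => ⟨τ, hτ, h', h⟩) _
    (fun e he => card_conflict_le hP h3 hk.le
      (fun e he => ⟨isUsefulEdge_of_mem_exact he, hD e he⟩) he)
  have hmain := two_pow_le_ncard hP h3 hI (fun e he => hD e (hI he)) hconf
  have h1 : ((exactUsefulEdges P k).card : ℝ) /
      ((4 * (k : ℝ) + 1) * (2 * (k : ℝ) + 1) ^ 2 + 1) ≤ (I.card : ℝ) := by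
    rw [div_le_iff₀ (by positivity)]
    exact_mod_cast hcard
  have h2 := Real.rpow_le_rpow_of_exponent_le (one_le_two : (1 : ℝ) ≤ 2) h1
  rw [Real.rpow_natCast] at h2
  have h4 : (2 : ℝ) ^ I.card ≤ ((exactOrderTriangulations P k).ncard : ℝ) + 1 := by
    have : 2 ^ I.card ≤ (exactOrderTriangulations P k).ncard + 1 := by omega
    exact_mod_cast this
  linarith
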